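/- All graphs are finite and simple. A graph $G=(V,E)$ is *2-connected* if $|V|\ge 3$ and $G[V\setminus X]$ is connected for every $X\subseteq V$ with $|X|\le 1$. **Definitions.** A *tree decomposition* of $G$ is a tree $T$ with bags $B_x\subseteq V$ ($x\in V(T)$) such that the bags cover $V$, both ends of each edge of $G$ lie in a common bag, and for each $v\in V$ the nodes $x$ with $v\in B_x$ induce a subtree of $T$; its *width* is $\max_x|B_x|-1$. It is a *path decomposition* if $T$ is a path. It is a *directed spaghetti tree decomposition* if $T$ is a directed tree (an orientation of a tree) and for each $v\in V$ the nodes whose bags contain $v$ induce a directed path in $T$; it is a *special tree decomposition* if moreover $T$ is rooted, that is, all arcs are directed to one root. The *pathwidth*, *directed spaghetti treewidth* and *special treewidth* of $G$ are the minimum widths of such decompositions. A *mamba* is a graph that is a 2-connected graph of pathwidth two, or a single edge, or an isolated vertex. $D_3$ is the graph formed by three internally vertex-disjoint paths of length three between two vertices. $S_3$ (the 3-sun) is the graph formed by a cycle $v_1v_2\cdots v_6v_1$ and the triangle $v_2v_4v_6$. The *cell completion* $\widetilde G$ of $G$ is obtained by adding an edge $vw$ for all pairs of nonadjacent vertices $v,w$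 such that $G[V\setminus\{v,w\}]$ has at least three connected components. *Trees of cycles* are defined recursively: every cycle is a tree of cycles, and if $H$ is a tree of cycles and $C$ a cycle, then the graph obtained from their disjoint union by identifying an edge of $H$ and its ends with an edge of $C$ and its ends is a tree of cycles. An *edge separator* is an edge contained in at least two distinct chordless cycles. A *simplicial triangle* is a triangle containing a vertex whose neighborhood is a clique. A *path of cycles* is a tree of cycles in which each chordless cycle has at most two edge separators and in which, whenever an edge is contained in $m\ge 3$ chordless cycles, at least $m-2$ of these cycles are simplicial triangles. **Statement.** Let $G$ be a 2-connected graph. The following are equivalent: 1. $G$ has pathwidth two (equivalently, $G$ is a mamba). 2. $G$ has special treewidth two. 3. $G$ has directed spaghetti treewidth two. 4. $G$ has no minor isomorphic to $K_4$, $D_3$ or $S_3$. 5. The cell completion $\widetilde G$ of $G$ is a path of cycles. -/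

import Mathlib

namespace SimpleGraph

universe u

/-- `2`-connected: at least three vertices, and removing at most one vertex leaves a connected
graph. -/
def IsTwoConnected {V : Type u} [Fintype V] (G : SimpleGraph V) : Prop :=
  3 ≤ Fintype.card V ∧ ∀ X : Finset V, X.card ≤ 1 → (G.induce ((X : Set V)ᶜ)).Connected

/-- `H` is (isomorphic to) a minor of `G`: there are pairwise disjoint connected branch sets in `G`,
one for each vertex of `H`, with an edge of `G` between the branch sets of adjacent vertices. -/
def IsMinorOf {W : Type*} {V : Type*} (H : SimpleGraph W) (G : SimpleGraph V) : Prop :=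
  ∃ B : W → Set V,
    (∀ a, (G.induce (B a)).Connected) ∧
    (∀ a b, a ≠ b → Disjoint (B a) (B b)) ∧
    (∀ a b, H.Adj a b → ∃ x ∈ B a, ∃ y ∈ B b, G.Adj x y)

/-- The graph `D₃`: the vertices `0` and `1`, joined by three internally disjoint paths of
length three. -/
def graphD3 : SimpleGraph (Fin 8) :=
  fromEdgeSet {s(0, 2), s(2, 3), s(3, 1), s(0, 4), s(4, 5), s(5, 1), s(0, 6), s(6, 7), s(7, 1)}

/-- The graph `S₃`, the `3`-sun: a cycle `0 1 2 3 4 5` together with the triangle `1 3 5`. -/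
def graphS3 : SimpleGraph (Fin 6) :=
  fromEdgeSet {s(0, 1), s(1, 2), s(2, 3), s(3, 4), s(4, 5), s(5, 0), s(1, 3), s(3, 5), s(5, 1)}

/-! ### Tree decompositions and width parameters -/

/-- A tree decomposition of `G`, over a finite tree. -/
structure TreeDecomposition {V : Type u} (G : SimpleGraph V) where
  /-- the nodes of the tree -/
  Node : Type
  [fintypeNode : Fintype Node]
  /-- the tree -/
  tree : SimpleGraph Node
  isTree : tree.IsTree
  /-- the bags -/
  bag : Node → Finset V
  exists_mem_bag : ∀ v : V, ∃ x, v ∈ bag x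
  exists_edge_bag : ∀ u v : V, G.Adj u v → ∃ x, u ∈ bag x ∧ v ∈ bag x
  connected_bags : ∀ v : V, (tree.induce {x | v ∈ bag x}).Connected

namespace TreeDecomposition

variable {V : Type u} {G : SimpleGraph V}

/-- The width: the maximum size of a bag, minus one. -/
def width (D : TreeDecomposition G) : ℕ :=
  (@Finset.univ D.Node D.fintypeNode).sup (fun x => (D.bag x).card) - 1

/-- The set of nodes whose bag contains `v`. -/
def nodesOf (D : TreeDecomposition G) (v : V) : Set D.Node :=
  {x | v ∈ D.bag x}

end TreeDecomposition

/-- `A` is an orientation of `T`: each edge of `T` becomes exactly one arc of `A`, and `A` has no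
other arcs. -/
def IsOrientation {ι : Type*} (T : SimpleGraph ι) (A : Digraph ι) : Prop :=
  (∀ x y, T.Adj x y ↔ A.Adj x y ∨ A.Adj y x) ∧ ∀ x y, A.Adj x y → ¬ A.Adj y x

/-- The set `S` induces in the digraph `A` a directed path `p 0 → p 1 → ⋯ → p n`
(possibly with a single vertex). -/
def InducesDirectedPath {ι : Type*} (A : Digraph ι) (S : Set ι) : Prop :=
  ∃ (n : ℕ) (p : Fin (n + 1) → ι), Function.Injective p ∧ Set.range p = S ∧
    ∀ i j : Fin (n + 1), A.Adj (p i) (p j) ↔ (j : ℕ) = (i : ℕ) + 1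

/-- All arcs of the orientation `A` of the tree `T` are directed to the root `r`. -/
def IsRootedAt {ι : Type*} (T : SimpleGraph ι) (A : Digraph ι) (r : ι) : Prop :=
  ∀ x y, A.Adj x y → T.dist x r = T.dist y r + 1

namespace TreeDecomposition

variable {V : Type u} {G : SimpleGraph V}

/-- A path decomposition: the tree is a path. -/
def IsPathDecomposition (D : TreeDecomposition G) : Prop :=
  ∃ n : ℕ, Nonempty (D.tree ≃g pathGraph n)

/-- The tree can be made a directed tree in which the bags containing any given vertex induce a
directed path. -/
def IsDirectedSpaghetti (D : TreeDecomposition G) : Prop :=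
  ∃ A : Digraph D.Node, IsOrientation D.tree A ∧ ∀ v : V, InducesDirectedPath A (D.nodesOf v)

/-- The tree can be made a rooted tree (all arcs directed to the root) in which the bags containing
any given vertex induce a directed path. -/
def IsSpecial (D : TreeDecomposition G) : Prop :=
  ∃ (A : Digraph D.Node) (r : D.Node), IsOrientation D.tree A ∧ IsRootedAt D.tree A r ∧
    ∀ v : V, InducesDirectedPath A (D.nodesOf v)

end TreeDecomposition

/-- The pathwidth: the minimum width of a path decomposition. -/
noncomputable def pathwidth {V : Type u} (G : SimpleGraph V) : ℕ :=
  sInf {k | ∃ D : TreeDecomposition G, D.IsPathDecomposition ∧ D.width = k}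

/-- The special treewidth: the minimum width of a special tree decomposition. -/
noncomputable def specialTreewidth {V : Type u} (G : SimpleGraph V) : ℕ :=
  sInf {k | ∃ D : TreeDecomposition G, D.IsSpecial ∧ D.width = k}

/-- The directed spaghetti treewidth: the minimum width of a directed spaghetti tree
decomposition. -/
noncomputable def directedSpaghettiTreewidth {V : Type u} (G : SimpleGraph V) : ℕ :=
  sInf {k | ∃ D : TreeDecomposition G, D.IsDirectedSpaghetti ∧ D.width = k}

/-- A mamba: a `2`-connected graph of pathwidth two, or a single edge, or an isolated vertex. -/
def IsMamba {V : Type u} [Fintype V] (G : SimpleGraph V) : Prop :=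
  (G.IsTwoConnected ∧ G.pathwidth = 2) ∨
    Nonempty (G ≃g completeGraph (Fin 2)) ∨ Nonempty (G ≃g completeGraph (Fin 1))

/-! ### Cell completion, trees of cycles, paths of cycles -/

/-- The cell completion: nonadjacent `v ≠ w` are joined whenever `G - {v, w}` has at least three
connected components. -/
def cellCompletion {V : Type u} (G : SimpleGraph V) : SimpleGraph V where
  Adj v w := G.Adj v w ∨
    (v ≠ w ∧ 3 ≤ Nat.card (G.induce (({v, w} : Set V)ᶜ)).ConnectedComponent)
  symm := ⟨by
    rintro v w (h | ⟨h, h'⟩)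
    · exact Or.inl h.symm
    · exact Or.inr ⟨h.symm, by rwa [Set.pair_comm]⟩⟩
  loopless := ⟨by
    rintro v (h | ⟨h, -⟩)
    · exact G.loopless.irrefl v h
    · exact h rfl⟩

/-- `G` is a cycle (of length at least three). -/
def IsCycleGraph {V : Type u} (G : SimpleGraph V) : Prop :=
  ∃ n : ℕ, 3 ≤ n ∧ Nonempty (G ≃g cycleGraph n)

/-- Trees of cycles. The second clause says that `G` arises from the tree of cycles `G[A]` and the
cycle `G[B]` by identifying one edge, with its ends: `G` is the union of `G[A]` and `G[B]`, which
have in common exactly the edge `uv` and its ends. -/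
inductive IsTreeOfCycles : ∀ {V : Type u}, SimpleGraph V → Prop
  | cycle {V : Type u} (G : SimpleGraph V) (hG : G.IsCycleGraph) : IsTreeOfCycles G
  | glue {V : Type u} (G : SimpleGraph V) (A B : Set V) (u v : V)
      (huv : G.Adj u v) (hinter : A ∩ B = {u, v}) (hunion : A ∪ B = Set.univ)
      (hedge : ∀ x y, G.Adj x y → (x ∈ A ∧ y ∈ A) ∨ (x ∈ B ∧ y ∈ B))
      (hA : IsTreeOfCycles (G.induce A)) (hB : (G.induce B).IsCycleGraph) : IsTreeOfCycles G

/-- `C` is the vertex set of a chordless cycle of `G`. A chordless cycle is an induced subgraph, so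
it is determined by its vertex set, and it contains an edge of `G` exactly if it contains both
ends. -/
def IsChordlessCycle {V : Type u} (G : SimpleGraph V) (C : Finset V) : Prop :=
  (G.induce (C : Set V)).IsCycleGraph

/-- The chordless cycles of `G` that contain the edge `e`. -/
def chordlessCyclesThrough {V : Type u} (G : SimpleGraph V) (e : Sym2 V) : Set (Finset V) :=
  {C | G.IsChordlessCycle C ∧ ∀ x ∈ e, x ∈ C}

/-- An edge separator: an edge contained in at least two distinct chordless cycles. -/
def IsEdgeSeparator {V : Type u} (G : SimpleGraph V) (e : Sym2 V) : Prop :=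
  e ∈ G.edgeSet ∧ 2 ≤ (G.chordlessCyclesThrough e).ncard

/-- A simplicial triangle: a triangle with a vertex whose neighbourhood is a clique. -/
def IsSimplicialTriangle {V : Type u} (G : SimpleGraph V) (C : Finset V) : Prop :=
  G.IsNClique 3 C ∧ ∃ v ∈ C, G.IsClique (G.neighborSet v)

/-- A path of cycles: a tree of cycles in which each chordless cycle has at most two edge
separators, and in which, if an edge is in `m ≥ 3` chordless cycles, then at least `m - 2` of these
are simplicial triangles. -/
def IsPathOfCycles {V : Type u} (G : SimpleGraph V) : Prop :=
  G.IsTreeOfCycles ∧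
  (∀ C : Finset V, G.IsChordlessCycle C →
    {e : Sym2 V | G.IsEdgeSeparator e ∧ ∀ x ∈ e, x ∈ C}.ncard ≤ 2) ∧
  (∀ e ∈ G.edgeSet, 3 ≤ (G.chordlessCyclesThrough e).ncard →
    (G.chordlessCyclesThrough e).ncard - 2 ≤
      {C ∈ G.chordlessCyclesThrough e | G.IsSimplicialTriangle C}.ncard)

end SimpleGraph

/-! The implications from pathwidth to special treewidth to directed spaghetti treewidth hold
because a path, oriented towards one end, is a rooted tree in which every subpath is directed
(`TreeDecomposition.IsPathDecomposition.isSpecial`). The four substantial steps are these.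

Spaghetti to path (`IsTwoConnected.exists_isPathDecomposition`). As `G` is 2-connected, a tree
decomposition can be pruned until adjacent bags share at least two vertices. If bags have at most
three vertices, the bags of two neighbours of a node share a vertex with the bag of that node. The
directed path of this vertex forbids two in-neighbours or two out-neighbours, so the remaining tree
is a path.

Path to minors. Branch sets of a minor occupy intervals of the path, with no four through one node
(`IsMinorOf.exists_intervalModel`). None of `K₄`, `D₃`, `S₃` admits such intervals.

Minors to path of cycles. Without `K₄` there is a vertex of degree two; suppressing it and arguing
by induction shows that the cell completion is a tree of cycles
(`IsTwoConnected.treeOfCyclesOn_cellCompletion`). Distinct chordless cycles through `uv` lie in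
distinct components of `G - {u, v}`. Three of them that are not simplicial triangles give `D₃`, and
three edge separators on one cycle give `S₃`; each edge of the completion missing from `G` is
replaced by a route through a spare component.

Path of cycles to path (`TreeOfCyclesOn.exists_marked_bagList`). Each cycle is swept from one of its
edge separators to the other, and the sweeps are concatenated at common separators. Simplicial
triangles are inserted at the bag of their separator. This decomposes the completion, hence `G`.

Connectivity is handled through closed sets: a set is connected if its only nonempty part closed
under adjacency is the whole set. -/

namespace SimpleGraph

/-! ### Connectivity through closed sets -/

/-- `T` is a subset of `S` closed under adjacency inside `S`. -/
def ClosedIn {V : Type*} (G : SimpleGraph V) (S T : Set V) : Prop :=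
  T ⊆ S ∧ ∀ x ∈ T, ∀ y ∈ S, G.Adj x y → y ∈ T

/-- `S` is nonempty and its only nonempty closed subset is `S`. -/
def ConnectedOn {V : Type*} (G : SimpleGraph V) (S : Set V) : Prop :=
  S.Nonempty ∧ ∀ T, G.ClosedIn S T → T.Nonempty → T = S

section ClosedSets

variable {V W : Type*} {G : SimpleGraph V} {S T U : Set V} {x y z : V}

theorem ClosedIn.diff (h : G.ClosedIn S T) : G.ClosedIn S (S \ T) :=
  ⟨Set.sdiff_subset, fun x hx y hy hxy => ⟨hy, fun hyT => hx.2 (h.2 y hyT x hx.1 hxy.symm)⟩⟩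

theorem closedIn_self : G.ClosedIn S S := ⟨subset_rfl, fun _ _ _ h _ => h⟩

theorem ClosedIn.trans (h : G.ClosedIn S T) (h' : G.ClosedIn T U) : G.ClosedIn S U :=
  ⟨h'.1.trans h.1, fun x hx y hy hxy => h'.2 x hx y (h.2 x (h'.1 hx) y hy hxy) hxy⟩

theorem ClosedIn.inter_left (h : G.ClosedIn S T) (hU : U ⊆ S) : G.ClosedIn U (U ∩ T) :=
  ⟨Set.inter_subset_left, fun x hx y hy hxy => ⟨hy, h.2 x hx.2 y (hU hy) hxy⟩⟩

/-- This takes the place of following a walk: a connected set cannot leave a closed set that it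
meets. -/
theorem ConnectedOn.subset_of_closedIn (hU : G.ConnectedOn U) (hT : G.ClosedIn S T) (hUS : U ⊆ S)
    (h : (U ∩ T).Nonempty) : U ⊆ T := by
  have := hU.2 _ (hT.inter_left hUS) h
  exact Set.inter_eq_left.1 this

/-- The component of `x` in `S`. -/
def compIn (G : SimpleGraph V) (S : Set V) (x : V) : Set V :=
  ⋂₀ {T | G.ClosedIn S T ∧ x ∈ T}

theorem mem_compIn : x ∈ G.compIn S x := fun _ h => h.2

theorem compIn_subset_of_closedIn (hT : G.ClosedIn S T) (hx : x ∈ T) : G.compIn S x ⊆ T :=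
  Set.sInter_subset_of_mem ⟨hT, hx⟩

theorem closedIn_compIn (hx : x ∈ S) : G.ClosedIn S (G.compIn S x) :=
  ⟨compIn_subset_of_closedIn closedIn_self hx,
    fun a ha b hb hab T hT => hT.1.2 a (ha T hT) b hb hab⟩

/-- A closed part containing `x` is everything by minimality. If a closed part misses `x`, its
complement is closed and contains `x`, so it is everything and the part is empty. -/
theorem connectedOn_compIn (hx : x ∈ S) : G.ConnectedOn (G.compIn S x) := by
  refine ⟨⟨x, mem_compIn⟩, fun T hT hne => ?_⟩
  have key : ∀ T, G.ClosedIn (G.compIn S x) T → x ∈ T → T = G.compIn S x := fun T hT hxT =>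
    hT.1.antisymm (compIn_subset_of_closedIn ((closedIn_compIn hx).trans hT) hxT)
  by_cases hxT : x ∈ T
  · exact key T hT hxT
  · have := key _ hT.diff ⟨mem_compIn, hxT⟩
    obtain ⟨t, ht⟩ := hne
    have h2 := hT.1 ht
    rw [← this] at h2
    exact absurd ht h2.2

theorem connectedOn_iff : (G.induce S).Connected ↔ G.ConnectedOn S := by
  constructor
  · intro h
    refine ⟨Set.nonempty_coe_sort.1 h.nonempty, fun T hT hne => hT.1.antisymm fun y hy => ?_⟩
    obtain ⟨x, hx⟩ := hne
    obtain ⟨p⟩ := h.preconnected ⟨x, hT.1 hx⟩ ⟨y, hy⟩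
    have : ∀ (a b : S) (p : (G.induce S).Walk a b), (a : V) ∈ T → (b : V) ∈ T := by
      intro a b p
      induction p with
      | nil => exact id
      | cons h _ ih => exact fun ha => ih (hT.2 _ ha _ (Subtype.prop _) h)
    exact this _ _ p hx
  · intro h
    have := Set.nonempty_coe_sort.2 h.1
    refine ⟨fun a b => ?_⟩
    have h2 := h.2 {y | ∃ hy : y ∈ S, (G.induce S).Reachable a ⟨y, hy⟩} ⟨fun y hy => hy.1, ?_⟩
      ⟨a, a.2, Reachable.refl _⟩
    · exact (h2.symm.subset b.2).2
    · rintro x ⟨hx, hax⟩ y hy hxy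
      exact ⟨hy, hax.trans (Adj.reachable (G := G.induce S) (u := ⟨x, hx⟩) (v := ⟨y, hy⟩) hxy)⟩

theorem connectedOn_singleton (x : V) : G.ConnectedOn {x} :=
  ⟨⟨x, rfl⟩, fun _ hT hne => (Set.subset_singleton_iff_eq.1 hT.1).resolve_left hne.ne_empty⟩

theorem ConnectedOn.union_of_adj (hS : G.ConnectedOn S) (hT : G.ConnectedOn T)
    (hx : x ∈ S) (hy : y ∈ T) (hxy : G.Adj x y) : G.ConnectedOn (S ∪ T) := by
  refine ⟨⟨x, Or.inl hx⟩, fun U hU hne => hU.1.antisymm ?_⟩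
  have h1 : (S ∩ U).Nonempty → S ⊆ U := hS.subset_of_closedIn hU Set.subset_union_left
  have h2 : (T ∩ U).Nonempty → T ⊆ U := hT.subset_of_closedIn hU Set.subset_union_right
  obtain ⟨u, hu⟩ := hne
  rcases hU.1 hu with h | h
  · have h3 := h1 ⟨u, h, hu⟩
    exact Set.union_subset h3 (h2 ⟨y, hy, hU.2 x (h3 hx) y (Or.inr hy) hxy⟩)
  · have h3 := h2 ⟨u, h, hu⟩
    exact Set.union_subset (h1 ⟨x, hx, hU.2 y (h3 hy) x (Or.inl hx) hxy.symm⟩) h3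

theorem connectedOn_pair (h : G.Adj x y) : G.ConnectedOn {x, y} :=
  (connectedOn_singleton x).union_of_adj (connectedOn_singleton y) rfl rfl h

theorem ConnectedOn.mono {H : SimpleGraph V} (hS : G.ConnectedOn S)
    (h : ∀ x ∈ S, ∀ y ∈ S, G.Adj x y → H.Adj x y) : H.ConnectedOn S :=
  ⟨hS.1, fun T hT hne => hS.2 T ⟨hT.1, fun x hx y hy hxy => hT.2 x hx y hy
    (h x (hT.1 hx) y hy hxy)⟩ hne⟩

/-- A nonempty proper subset of a connected set has a neighbour in the rest. -/
theorem ConnectedOn.exists_adj (hS : G.ConnectedOn S) (hTS : T ⊆ S) (hne : T.Nonempty)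
    (hT : (S \ T).Nonempty) : ∃ x ∈ T, ∃ y ∈ S \ T, G.Adj x y := by
  by_contra! h
  have := hS.2 T ⟨hTS, fun x hx y hy hxy => by_contra fun hyT => h x hx y ⟨hy, hyT⟩ hxy⟩ hne
  simp [this] at hT

/-- A connected set splits into two adjacent connected parts containing two given vertices. -/
theorem ConnectedOn.exists_split (hS : G.ConnectedOn S) (hx : x ∈ S) (hy : y ∈ S) (hxy : x ≠ y) :
    ∃ P Q : Set V, P ∪ Q = S ∧ Disjoint P Q ∧ x ∈ P ∧ y ∈ Q ∧ G.ConnectedOn P ∧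
      G.ConnectedOn Q ∧ ∃ p ∈ P, ∃ q ∈ Q, G.Adj p q := by
  have hx' : x ∈ S \ {y} := ⟨hx, hxy⟩
  -- The part of `x` is its component in `S \ {y}`; everything else goes with `y`.
  set P := G.compIn (S \ {y}) x with hP
  have hPc : G.ClosedIn (S \ {y}) P := closedIn_compIn hx'
  have hPS : P ⊆ S := hPc.1.trans Set.sdiff_subset
  have hyP : y ∉ P := fun h => (hPc.1 h).2 rfl
  have hPy : ∃ p ∈ P, G.Adj p y := by
    obtain ⟨p, hp, q, hq, hpq⟩ := hS.exists_adj hPS ⟨x, mem_compIn⟩ ⟨y, hy, hyP⟩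
    by_cases hqy : q = y
    · exact ⟨p, hp, hqy ▸ hpq⟩
    · exact absurd (hPc.2 p hp q ⟨hq.1, hqy⟩ hpq) hq.2
  refine ⟨P, S \ P, Set.union_sdiff_cancel hPS, Set.disjoint_sdiff_right, mem_compIn, ⟨hy, hyP⟩,
    connectedOn_compIn hx', ?_, ?_⟩
  · refine ⟨⟨y, hy, hyP⟩, fun T hT hne => ?_⟩
    -- Within `S`, the only vertex outside `P` adjacent to `P` is `y`, so a closed part of `S \ P`
    -- without `y` would be closed in all of `S`. A closed part and its complement cannot both
    -- contain `y`.
    have key : ∀ T, G.ClosedIn (S \ P) T → T.Nonempty → y ∈ T := by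
      intro T hT hne
      by_contra hyT
      have : T = S := by
        refine hS.2 T ⟨hT.1.trans Set.sdiff_subset, fun a ha b hb hab => ?_⟩ hne
        by_cases hbP : b ∈ P
        · have haP := hPc.2 b hbP a ⟨(hT.1 ha).1, fun h => hyT (h ▸ ha)⟩ hab.symm
          exact absurd haP (hT.1 ha).2
        · exact hT.2 a ha b ⟨hb, hbP⟩ hab
      exact hyT (this ▸ hy)
    by_contra hTne
    have h2 : ((S \ P) \ T).Nonempty := by
      rw [Set.nonempty_iff_ne_empty, Ne, Set.sdiff_eq_empty]
      exact fun h => hTne (hT.1.antisymm h)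
    exact (key _ hT.diff h2).2 (key _ hT hne)
  · obtain ⟨p, hp, hpy⟩ := hPy
    exact ⟨p, hp, y, ⟨hy, hyP⟩, hpy⟩

/-- A union of connected sets indexed by a connected set, adjacent index sets being adjacent. -/
theorem ConnectedOn.biUnion {H : SimpleGraph W} {I : Set W} (hI : H.ConnectedOn I)
    {B : W → Set V} (hB : ∀ i ∈ I, G.ConnectedOn (B i))
    (hadj : ∀ i ∈ I, ∀ j ∈ I, H.Adj i j → ∃ x ∈ B i, ∃ y ∈ B j, G.Adj x y) :
    G.ConnectedOn (⋃ i ∈ I, B i) := by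
  obtain ⟨i₀, hi₀⟩ := hI.1
  refine ⟨?_, fun T hT hne => hT.1.antisymm ?_⟩
  · obtain ⟨x, hx⟩ := (hB i₀ hi₀).1
    exact ⟨x, Set.mem_biUnion hi₀ hx⟩
  have hsub : ∀ i ∈ I, (B i ∩ T).Nonempty → B i ⊆ T := fun i hi =>
    (hB i hi).subset_of_closedIn hT (Set.subset_biUnion_of_mem (u := B) hi)
  have := hI.2 {i ∈ I | B i ⊆ T} ⟨fun i hi => hi.1, fun i hi j hj hij => ⟨hj, ?_⟩⟩ ?_
  · refine Set.iUnion₂_subset fun i hi => ?_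
    rw [← this] at hi
    exact hi.2
  · obtain ⟨x, hx, y, hy, hxy⟩ := hadj i hi.1 j hj hij
    exact hsub j hj ⟨y, hy, hT.2 x (hi.2 hx) y (Set.mem_biUnion hj hy) hxy⟩
  · obtain ⟨t, ht⟩ := hne
    obtain ⟨i, hi, hti⟩ := Set.mem_iUnion₂.1 (hT.1 ht)
    exact ⟨i, hi, hsub i hi ⟨t, hti, ht⟩⟩

end ClosedSets

/-! ### Two-connected graphs and closed sets -/

section TwoConnected

variable {V : Type*} [Fintype V] {G : SimpleGraph V}

theorem isTwoConnected_iff : G.IsTwoConnected ↔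
    3 ≤ Fintype.card V ∧ G.ConnectedOn Set.univ ∧ ∀ x, G.ConnectedOn {x}ᶜ := by
  unfold IsTwoConnected
  refine and_congr_right fun _ => ⟨fun h => ⟨?_, fun x => ?_⟩, fun h X hX => ?_⟩
  · have := connectedOn_iff.1 (h ∅ (by simp))
    simpa using this
  · have := connectedOn_iff.1 (h {x} (by simp))
    simpa using this
  · rw [connectedOn_iff]
    rcases Nat.le_one_iff_eq_zero_or_eq_one.1 hX with h0 | h1
    · rw [Finset.card_eq_zero.1 h0]
      simpa using h.1
    · obtain ⟨x, rfl⟩ := Finset.card_eq_one.1 h1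
      simpa using h.2 x

theorem IsTwoConnected.connectedOn_univ (hG : G.IsTwoConnected) : G.ConnectedOn Set.univ :=
  (isTwoConnected_iff.1 hG).2.1

theorem IsTwoConnected.connectedOn_compl (hG : G.IsTwoConnected) (x : V) : G.ConnectedOn {x}ᶜ :=
  (isTwoConnected_iff.1 hG).2.2 x

/-- In a `2`-connected graph, a nonempty set closed in the complement of `{a, b}` has a neighbour
`a`. -/
theorem IsTwoConnected.exists_adj_of_closedIn (hG : G.IsTwoConnected) {a b : V} (hab : a ≠ b)
    {K : Set V} (hK : G.ClosedIn ({a, b}ᶜ) K) (hne : K.Nonempty) : ∃ x ∈ K, G.Adj x a := by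
  by_contra! h
  have hsub : ∀ x ∈ K, x ≠ a ∧ x ≠ b := fun x hx => by simpa using hK.1 hx
  have := (hG.connectedOn_compl b).2 K ⟨fun x hx => (hsub x hx).2, fun x hx y hy hxy => ?_⟩ hne
  · have ha : a ∈ K := this ▸ (hab : a ∈ ({b} : Set V)ᶜ)
    exact (hsub a ha).1 rfl
  · refine hK.2 x hx y ?_ hxy
    rintro (rfl | h')
    · exact h x hx hxy
    · exact hy h'

theorem IsTwoConnected.exists_adj_of_closedIn' (hG : G.IsTwoConnected) {a b : V} (hab : a ≠ b)
    {K : Set V} (hK : G.ClosedIn ({a, b}ᶜ) K) (hne : K.Nonempty) : ∃ x ∈ K, G.Adj x b :=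
  hG.exists_adj_of_closedIn hab.symm (Set.pair_comm a b ▸ hK) hne

end TwoConnected

/-! ### Minors -/

section Minors

variable {V W U : Type*}

theorem isMinorOf_iff {H : SimpleGraph W} {G : SimpleGraph V} : H.IsMinorOf G ↔
    ∃ B : W → Set V, (∀ a, G.ConnectedOn (B a)) ∧ (∀ a b, a ≠ b → Disjoint (B a) (B b)) ∧
      (∀ a b, H.Adj a b → ∃ x ∈ B a, ∃ y ∈ B b, G.Adj x y) := by
  unfold IsMinorOf
  simp_rw [connectedOn_iff]

theorem IsMinorOf.trans {K : SimpleGraph U} {H : SimpleGraph W} {G : SimpleGraph V}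
    (h : K.IsMinorOf H) (h' : H.IsMinorOf G) : K.IsMinorOf G := by
  rw [isMinorOf_iff] at *
  obtain ⟨B, hB1, hB2, hB3⟩ := h
  obtain ⟨C, hC1, hC2, hC3⟩ := h'
  refine ⟨fun a => ⋃ i ∈ B a, C i, fun a => (hB1 a).biUnion (fun i _ => hC1 i)
    (fun i _ j _ hij => hC3 i j hij), fun a b hab => ?_, fun a b hab => ?_⟩
  · simp only [Set.disjoint_iUnion_left, Set.disjoint_iUnion_right]
    exact fun i hi j hj => hC2 _ _ fun hij => (hB2 a b hab).le_bot ⟨hj, hij ▸ hi⟩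
  · obtain ⟨i, hi, j, hj, hij⟩ := hB3 a b hab
    obtain ⟨x, hx, y, hy, hxy⟩ := hC3 i j hij
    exact ⟨x, Set.mem_biUnion hi hx, y, Set.mem_biUnion hj hy, hxy⟩

/-- Contract the vertices of `S` into the vertex `a` (which should not be in `S`). -/
def contractInto (G : SimpleGraph V) (S : Set V) (a : V) : SimpleGraph ↥(Sᶜ) where
  Adj x y := x ≠ y ∧ (G.Adj x y ∨ ((x : V) = a ∧ ∃ s ∈ S, G.Adj s y) ∨
    ((y : V) = a ∧ ∃ s ∈ S, G.Adj s x))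
  symm := ⟨by
    rintro x y ⟨h, h1 | h1 | h1⟩
    · exact ⟨h.symm, Or.inl h1.symm⟩
    · exact ⟨h.symm, Or.inr (Or.inr h1)⟩
    · exact ⟨h.symm, Or.inr (Or.inl h1)⟩⟩
  loopless := ⟨fun x h => h.1 rfl⟩

open Classical in
theorem contractInto_isMinorOf {G : SimpleGraph V} {S : Set V} {a : V}
    (hS : G.ConnectedOn (insert a S)) : (G.contractInto S a).IsMinorOf G := by
  rw [isMinorOf_iff]
  refine ⟨fun x => if (x : V) = a then insert a S else {(x : V)}, fun x => ?_, fun x y hxy => ?_,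
    fun x y hxy => ?_⟩
  · dsimp only
    split_ifs
    · exact hS
    · exact connectedOn_singleton _
  · have hxy' : (x : V) ≠ y := fun h => hxy (Subtype.ext h)
    dsimp only
    split_ifs with h1 h2 h2
    · exact absurd (h1.trans h2.symm) hxy'
    · rw [Set.disjoint_singleton_right]
      rintro (h | h)
      · exact h2 h
      · exact y.2 h
    · rw [Set.disjoint_singleton_left]
      rintro (h | h)
      · exact h1 h
      · exact x.2 h
    · simpa using hxy'
  · have hself : ∀ z : ↥(Sᶜ), (z : V) ∈ (if (z : V) = a then insert a S else {(z : V)}) := by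
      intro z
      split_ifs with h
      · exact Or.inl h
      · rfl
    rcases hxy.2 with h | ⟨h, s, hs, hsy⟩ | ⟨h, s, hs, hsy⟩
    · exact ⟨x, hself x, y, hself y, h⟩
    · exact ⟨s, by simp [h, hs], y, hself y, hsy⟩
    · exact ⟨x, hself x, s, by simp [h, hs], hsy.symm⟩

end Minors

/-! ### Graphs of minimum degree three have a `K₄` minor -/

section MinDegree

variable {V : Type u}

theorem exists_three_of_three_le_ncard {α : Type*} {s : Set α} (h : 3 ≤ s.ncard) :
    ∃ a ∈ s, ∃ b ∈ s, ∃ c ∈ s, a ≠ b ∧ a ≠ c ∧ b ≠ c := by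
  obtain ⟨t, hts, ht⟩ := Set.exists_subset_card_eq h
  obtain ⟨a, b, c, hab, hac, hbc, rfl⟩ := Set.ncard_eq_three.1 ht
  exact ⟨a, hts (by simp), b, hts (by simp), c, hts (by simp), hab, hac, hbc⟩

theorem three_le_ncard {α : Type*} [Finite α] {s : Set α} {a b c : α} (ha : a ∈ s) (hb : b ∈ s)
    (hc : c ∈ s) (hab : a ≠ b) (hac : a ≠ c) (hbc : b ≠ c) : 3 ≤ s.ncard := by
  have h : ({a, b, c} : Set α).ncard = 3 := Set.ncard_eq_three.2 ⟨a, b, c, hab, hac, hbc, rfl⟩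
  rw [← h]
  refine Set.ncard_le_ncard ?_ s.toFinite
  rintro x (rfl | rfl | rfl) <;> assumption

theorem ncard_pair_le {α : Type*} (a b : α) : ({a, b} : Set α).ncard ≤ 2 :=
  (Set.ncard_insert_le a {b}).trans (by simp)

theorem completeGraph_four_isMinorOf_of_clique {G : SimpleGraph V} {a b c d : V}
    (hab : G.Adj a b) (hac : G.Adj a c) (had : G.Adj a d) (hbc : G.Adj b c) (hbd : G.Adj b d)
    (hcd : G.Adj c d) : (completeGraph (Fin 4)).IsMinorOf G := by
  rw [isMinorOf_iff]
  have key : ∀ i j : Fin 4, i ≠ j → G.Adj (![a, b, c, d] i) (![a, b, c, d] j) := by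
    intro i j hij
    fin_cases i <;> fin_cases j <;> first | exact absurd rfl hij | skip
    all_goals first | assumption | (refine SimpleGraph.Adj.symm ?_; assumption)
  refine ⟨fun i => {![a, b, c, d] i}, fun i => connectedOn_singleton _, fun i j hij => ?_,
    fun i j hij => ⟨_, rfl, _, rfl, key i j hij⟩⟩
  simpa using (key i j hij).ne

/-- The neighbours of a vertex other than the target do not disappear in a contraction into `a`,
except that the contracted ones become `a`. -/
theorem ncard_contractInto_le [Finite V] {G : SimpleGraph V} {S : Set V} {a : V} (x : ↥(Sᶜ))
    (hS : ∀ s ∈ S, ¬ G.Adj x s) :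
    (G.neighborSet x).ncard ≤ ((G.contractInto S a).neighborSet x).ncard := by
  have : G.neighborSet x ⊆ Subtype.val '' ((G.contractInto S a).neighborSet x) := by
    intro y hy
    have hyS : y ∈ Sᶜ := fun h => hS y h hy
    exact ⟨⟨y, hyS⟩, ⟨fun h => by rw [h] at hy; exact G.loopless.irrefl _ hy, Or.inl hy⟩, rfl⟩
  calc _ ≤ (Subtype.val '' ((G.contractInto S a).neighborSet x)).ncard :=
        Set.ncard_le_ncard this (Set.toFinite _)
    _ = _ := Set.ncard_image_of_injective _ Subtype.val_injective

/-- Two things can lower a degree below three when `v` is contracted into `u`. Either a vertex of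
degree exactly three sees both `u` and `v`, and two of its edges merge; or the merged vertex itself
is left with at most two neighbours. In both cases `uv` lies in a triangle. -/
theorem exists_common_neighbor_of_contract [Finite V] {G : SimpleGraph V} {u v : V}
    (huv : G.Adj u v) (hdeg : ∀ x, 3 ≤ (G.neighborSet x).ncard)
    (h : ∃ x, ((G.contractInto {v} u).neighborSet x).ncard < 3) :
    (∃ x, G.Adj x u ∧ G.Adj x v ∧ (G.neighborSet x).ncard = 3) ∨
      ((∃ x, G.Adj x u ∧ G.Adj x v) ∧
        ∀ a b c, a ≠ b → a ≠ c → b ≠ c → (∀ x ∈ ({a, b, c} : Set V), x ≠ u ∧ x ≠ v ∧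
          (G.Adj u x ∨ G.Adj v x)) → False) := by
  obtain ⟨⟨x, hxv⟩, hx⟩ := h
  have hxv' : x ≠ v := hxv
  by_cases hxu : x = u
  · subst hxu
    have key : ∀ a b c, a ≠ b → a ≠ c → b ≠ c → (∀ y ∈ ({a, b, c} : Set V), y ≠ x ∧ y ≠ v ∧
          (G.Adj x y ∨ G.Adj v y)) → False := by
      intro a b c hab hac hbc h
      refine hx.not_ge ?_
      have hmem : ∀ y (hy : y ∈ ({a, b, c} : Set V)), (⟨y, (h y hy).2.1⟩ : ↥(({v} : Set V)ᶜ)) ∈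
          (G.contractInto {v} x).neighborSet ⟨x, hxv⟩ := by
        intro y hy
        refine ⟨fun h' => (h y hy).1 (Subtype.ext_iff.1 h').symm, ?_⟩
        rcases (h y hy).2.2 with h1 | h1
        · exact Or.inl h1
        · exact Or.inr (Or.inl ⟨rfl, v, rfl, h1⟩)
      refine three_le_ncard (hmem a (by simp)) (hmem b (by simp)) (hmem c (by simp)) ?_ ?_ ?_ <;>
        exact fun h' => by first | exact hab (Subtype.ext_iff.1 h') | exact hac (Subtype.ext_iff.1 h') | exact hbc (Subtype.ext_iff.1 h')
    refine Or.inr ⟨?_, key⟩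
    -- Without a common neighbour, two neighbours of `x` other than `v` and one neighbour of `v`
    -- other than `x` would be three neighbours of the merged vertex.
    by_contra! hcom
    obtain ⟨a, ha, b, hb, c, hc, hab, hac, hbc⟩ := exists_three_of_three_le_ncard (hdeg x)
    obtain ⟨d, hd, hdx⟩ : ∃ d, G.Adj v d ∧ d ≠ x := by
      obtain ⟨a, ha, b, hb, -, -, hab, -, -⟩ := exists_three_of_three_le_ncard (hdeg v)
      by_cases h : a = x
      · exact ⟨b, hb, fun h' => hab (h.trans h'.symm)⟩
      · exact ⟨a, ha, h⟩
    have hdn : ∀ y, G.Adj x y → y ≠ d := fun y hy h => hcom y hy.symm (h ▸ hd.symm)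
    have hx1 : ∀ y, G.Adj x y → y ≠ v → y ≠ x ∧ y ≠ v ∧ (G.Adj x y ∨ G.Adj v y) :=
      fun y hy hyv => ⟨hy.ne', hyv, Or.inl hy⟩
    have hd1 : d ≠ x ∧ d ≠ v ∧ (G.Adj x d ∨ G.Adj v d) := ⟨hdx, hd.ne', Or.inr hd⟩
    by_cases hav : a = v
    · refine key b c d hbc (hdn b hb) (hdn c hc) ?_
      rintro y (rfl | rfl | rfl)
      · exact hx1 _ hb (hav ▸ hab.symm)
      · exact hx1 _ hc (hav ▸ hac.symm)
      · exact hd1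
    · by_cases hbv : b = v
      · refine key a c d hac (hdn a ha) (hdn c hc) ?_
        rintro y (rfl | rfl | rfl)
        · exact hx1 _ ha hav
        · exact hx1 _ hc (hbv ▸ hbc.symm)
        · exact hd1
      · refine key a b d hab (hdn a ha) (hdn b hb) ?_
        rintro y (rfl | rfl | rfl)
        · exact hx1 _ ha hav
        · exact hx1 _ hb hbv
        · exact hd1
  · left
    have hadj : G.Adj x v := by
      by_contra hn
      have := ncard_contractInto_le (G := G) (S := {v}) (a := u) ⟨x, hxv⟩
        (by rintro s rfl; exact hn)
      exact absurd (this.trans_lt hx) (hdeg x).not_gt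
    have hsub : G.neighborSet x \ {v} ⊆
        Subtype.val '' ((G.contractInto {v} u).neighborSet ⟨x, hxv⟩) := by
      rintro y ⟨hy, hyv⟩
      exact ⟨⟨y, hyv⟩, ⟨fun h => hy.ne (Subtype.ext_iff.1 h), Or.inl hy⟩, rfl⟩
    have hu : u ∈ Subtype.val '' ((G.contractInto {v} u).neighborSet ⟨x, hxv⟩) :=
      ⟨⟨u, huv.ne⟩, ⟨fun h => hxu (Subtype.ext_iff.1 h), Or.inr (Or.inr ⟨rfl, v, rfl, hadj.symm⟩)⟩,
        rfl⟩
    rw [← Set.ncard_image_of_injective _ Subtype.val_injective] at hx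
    have h1 : (G.neighborSet x \ {v}).ncard = (G.neighborSet x).ncard - 1 :=
      Set.ncard_sdiff_singleton_of_mem hadj
    have h2 := Set.ncard_le_ncard hsub (Set.toFinite _)
    have h3 := hdeg x
    refine ⟨x, ?_, hadj, by omega⟩
    by_contra hn
    have h4 : insert u (G.neighborSet x \ {v}) ⊆
        Subtype.val '' ((G.contractInto {v} u).neighborSet ⟨x, hxv⟩) :=
      Set.insert_subset hu hsub
    have h5 := Set.ncard_le_ncard h4 (Set.toFinite _)
    rw [Set.ncard_insert_of_notMem (fun h => hn h.1)] at h5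
    omega

theorem card_compl_lt [Fintype V] {S : Set V} [Fintype ↥(Sᶜ)] (h : S.Nonempty) :
    Fintype.card ↥(Sᶜ) < Fintype.card V := by
  obtain ⟨s, hs⟩ := h
  exact Fintype.card_subtype_lt (p := fun x => x ∈ Sᶜ) (x := s) (by simpa using hs)

/-- In a minimal counterexample every contraction creates a vertex of degree below three. Hence
every edge lies in a triangle and some vertex `w` has degree three, with a path `a`, `b`, `c` on its
neighbourhood. The edge `ac` would complete a `K₄`; without it, `b` has degree three as well, and
contracting `w` and `b` into `a` keeps all degrees at least three. -/
theorem completeGraph_four_isMinorOf_of_three_le_degree : ∀ (n : ℕ) {V : Type u} [Fintype V]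
    [Nonempty V] (G : SimpleGraph V), Fintype.card V = n →
    (∀ x, 3 ≤ (G.neighborSet x).ncard) → (completeGraph (Fin 4)).IsMinorOf G := by
  classical
  intro n
  induction n using Nat.strong_induction_on with
  | _ n ih =>
  intro V _ _ G hn hdeg
  by_contra hK
  have hcontr : ∀ (S : Set V) (a : V), S.Nonempty → a ∉ S → G.ConnectedOn (insert a S) →
      ∃ x, ((G.contractInto S a).neighborSet x).ncard < 3 := by
    intro S a hS ha hc
    by_contra! h
    have : Nonempty ↥(Sᶜ) := ⟨⟨a, ha⟩⟩
    exact hK ((ih _ (hn ▸ card_compl_lt hS) (G.contractInto S a) rfl h).trans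
      (contractInto_isMinorOf hc))
  have hedge : ∀ u v, G.Adj u v → _ := fun u v huv =>
    exists_common_neighbor_of_contract huv hdeg
      (hcontr {v} u ⟨v, rfl⟩ huv.ne (connectedOn_pair huv))
  have hcommon : ∀ u v, G.Adj u v → ∃ x, G.Adj x u ∧ G.Adj x v := by
    intro u v huv
    rcases hedge u v huv with ⟨x, h1, h2, -⟩ | ⟨h, -⟩
    exacts [⟨x, h1, h2⟩, h]
  -- If it is the merged vertex whose degree drops, then `u` has degree three: a fourth neighbour
  -- would leave three neighbours besides `v`.
  obtain ⟨w, hw⟩ : ∃ w, (G.neighborSet w).ncard = 3 := by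
    obtain ⟨u⟩ := ‹Nonempty V›
    obtain ⟨v, hv, -⟩ := exists_three_of_three_le_ncard (hdeg u)
    rcases hedge u v hv with ⟨x, -, -, h⟩ | ⟨-, h⟩
    · exact ⟨x, h⟩
    · refine ⟨u, le_antisymm ?_ (hdeg u)⟩
      by_contra! h4
      have h5 : 3 ≤ (G.neighborSet u \ {v}).ncard := by
        rw [Set.ncard_sdiff_singleton_of_mem hv]
        omega
      obtain ⟨a, ha, b, hb, c, hc, hab, hac, hbc⟩ := exists_three_of_three_le_ncard h5
      refine h a b c hab hac hbc ?_
      rintro y (rfl | rfl | rfl)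
      exacts [⟨ha.1.ne', ha.2, Or.inl ha.1⟩, ⟨hb.1.ne', hb.2, Or.inl hb.1⟩,
        ⟨hc.1.ne', hc.2, Or.inl hc.1⟩]
  -- the main argument, with `b` the middle vertex of the neighbourhood of `w`
  have main : ∀ a b c, a ≠ b → a ≠ c → b ≠ c → G.neighborSet w = {a, b, c} → G.Adj a b →
      G.Adj b c → False := by
    intro a b c hab hac hbc hN hadjab hadjbc
    have hwa : G.Adj w a := by
      have : a ∈ G.neighborSet w := by simp [hN]
      exact this
    have hwb : G.Adj w b := by
      have : b ∈ G.neighborSet w := by simp [hN]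
      exact this
    have hwc : G.Adj w c := by
      have : c ∈ G.neighborSet w := by simp [hN]
      exact this
    have hNw : ∀ x, G.Adj w x → x = a ∨ x = b ∨ x = c := by
      intro x hx
      have : x ∈ G.neighborSet w := hx
      simpa [hN] using this
    have hnac : ¬ G.Adj a c := fun h =>
      hK (completeGraph_four_isMinorOf_of_clique hwa hwb hwc hadjab h hadjbc)
    -- Consider contracting the edge `wa`. A common neighbour of its ends can only be `b`, as `a`
    -- and `c` are not adjacent. The other alternative fails, since `b`, `c` and a further neighbour
    -- of `a` are three neighbours of the merged vertex.
    have hNb : (G.neighborSet b).ncard = 3 := by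
      rcases hedge w a hwa with ⟨x, hxw, hxa, hx⟩ | ⟨-, h⟩
      · rcases hNw x hxw.symm with rfl | rfl | rfl
        · exact absurd rfl hxa.ne
        · exact hx
        · exact absurd hxa.symm hnac
      · exfalso
        have h3 : ∃ d, G.Adj a d ∧ d ≠ w ∧ d ≠ b := by
          by_contra! hcon
          have : G.neighborSet a ⊆ {w, b} := by
            intro d hd
            by_cases hdw : d = w
            · exact Or.inl hdw
            · exact Or.inr (hcon d hd hdw)
          have := Set.ncard_le_ncard this (Set.toFinite _)
          have h2 := ncard_pair_le w b
          have := hdeg a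
          omega
        obtain ⟨d, hd, hdw, hdb⟩ := h3
        refine h b c d hbc hdb.symm (fun h => hnac (h ▸ hd)) ?_
        rintro y (rfl | rfl | rfl)
        · exact ⟨hwb.ne', hadjab.ne', Or.inl hwb⟩
        · exact ⟨hwc.ne', hac.symm, Or.inl hwc⟩
        · exact ⟨hdw, hd.ne', Or.inr hd⟩
    have hNb' : G.neighborSet b = {a, c, w} := by
      symm
      refine Set.eq_of_subset_of_ncard_le ?_ ?_ (Set.toFinite _)
      · rintro y (rfl | rfl | rfl)
        exacts [hadjab.symm, hadjbc, hwb.symm]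
      · rw [hNb, Set.ncard_eq_three.2 ⟨a, c, w, hac, hwa.ne', hwc.ne', rfl⟩]
    have hNb2 : ∀ x, G.Adj b x → x = a ∨ x = c ∨ x = w := by
      intro x hx
      have : x ∈ G.neighborSet b := hx
      simpa [hNb'] using this
    -- `a` and `c` have two more neighbours
    have hmore : ∀ a c, G.Adj a b → G.Adj a w → ¬ G.Adj a c → c ≠ a →
        (∀ x, G.Adj w x → x = a ∨ x = b ∨ x = c) → (∀ x, G.Adj b x → x = a ∨ x = c ∨ x = w) →
        ∃ p q, p ≠ q ∧ G.Adj a p ∧ G.Adj a q ∧ p ≠ b ∧ p ≠ w ∧ q ≠ b ∧ q ≠ w := by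
      intro a c hab haw hnac hca hNw hNb
      obtain ⟨p, hp, hpb, hpw⟩ : ∃ p, G.Adj a p ∧ p ≠ b ∧ p ≠ w := by
        by_contra! hcon
        have : G.neighborSet a ⊆ {b, w} := by
          intro d hd
          by_cases hdw : d = b
          · exact Or.inl hdw
          · exact Or.inr (hcon d hd hdw)
        have := Set.ncard_le_ncard this (Set.toFinite _)
        have h2 := ncard_pair_le b w
        have := hdeg a
        omega
      obtain ⟨q, hqa, hqp⟩ := hcommon a p hp
      refine ⟨p, q, hqp.ne', hp, hqa.symm, hpb, hpw, ?_, ?_⟩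
      · rintro rfl
        rcases hNb p hqp with rfl | rfl | rfl
        exacts [hp.ne rfl, hnac hp, hpw rfl]
      · rintro rfl
        rcases hNw p hqp with rfl | rfl | rfl
        exacts [hp.ne rfl, hpb rfl, hnac hp]
    have hconn : G.ConnectedOn (insert a {w, b}) := by
      have := (connectedOn_singleton (G := G) a).union_of_adj (connectedOn_pair hwb) rfl
        (Set.mem_insert w {b}) hwa.symm
      rwa [Set.insert_eq a]
    have haS : a ∉ ({w, b} : Set V) := by rintro (h | h); exacts [hwa.ne' h, hab h]
    have hcS : c ∉ ({w, b} : Set V) := by rintro (h | h); exacts [hwc.ne' h, hbc h.symm]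
    -- The contracted vertices `w` and `b` have no neighbours outside `{a, b, c, w}`, so only `a`
    -- and `c` can lose degree. Each of these keeps two further neighbours and gains the edge `ac`.
    obtain ⟨⟨x, hxS⟩, hx⟩ := hcontr {w, b} a ⟨w, by simp⟩ haS hconn
    have hxw : x ≠ w := fun h => hxS (by simp [h])
    have hxb : x ≠ b := fun h => hxS (by simp [h])
    refine hx.not_ge ?_
    by_cases hxa : x = a
    · subst hxa
      obtain ⟨p, q, hpq, hp, hq, hpb, hpw, hqb, hqw⟩ :=
        hmore x c hadjab hwa.symm hnac hac.symm hNw hNb2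
      have hpS : p ∈ ({w, b} : Set V)ᶜ := by rintro (h | h); exacts [hpw h, hpb h]
      have hqS : q ∈ ({w, b} : Set V)ᶜ := by rintro (h | h); exacts [hqw h, hqb h]
      have hpc : p ≠ c := fun h => hnac (h ▸ hp)
      have hqc : q ≠ c := fun h => hnac (h ▸ hq)
      exact three_le_ncard (a := ⟨p, hpS⟩) (b := ⟨q, hqS⟩) (c := ⟨c, hcS⟩)
        ⟨fun h => hp.ne (Subtype.ext_iff.1 h), Or.inl hp⟩
        ⟨fun h => hq.ne (Subtype.ext_iff.1 h), Or.inl hq⟩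
        ⟨fun h => hac (Subtype.ext_iff.1 h), Or.inr (Or.inl ⟨rfl, w, by simp, hwc⟩)⟩
        (fun h => hpq (Subtype.ext_iff.1 h)) (fun h => hpc (Subtype.ext_iff.1 h))
        (fun h => hqc (Subtype.ext_iff.1 h))
    · by_cases hxc : x = c
      · subst hxc
        obtain ⟨p, q, hpq, hp, hq, hpb, hpw, hqb, hqw⟩ :=
          hmore x a hadjbc.symm hwc.symm (fun h => hnac h.symm) hac (fun x hx => by
            rcases hNw x hx with h | h | h <;> simp [h]) (fun x hx => by
            rcases hNb2 x hx with h | h | h <;> simp [h])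
        have hpS : p ∈ ({w, b} : Set V)ᶜ := by rintro (h | h); exacts [hpw h, hpb h]
        have hqS : q ∈ ({w, b} : Set V)ᶜ := by rintro (h | h); exacts [hqw h, hqb h]
        have hpa : p ≠ a := fun h => hnac (h ▸ hp.symm)
        have hqa : q ≠ a := fun h => hnac (h ▸ hq.symm)
        exact three_le_ncard (a := ⟨p, hpS⟩) (b := ⟨q, hqS⟩) (c := ⟨a, haS⟩)
          ⟨fun h => hp.ne (Subtype.ext_iff.1 h), Or.inl hp⟩
          ⟨fun h => hq.ne (Subtype.ext_iff.1 h), Or.inl hq⟩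
          ⟨fun h => hac (Subtype.ext_iff.1 h).symm, Or.inr (Or.inr ⟨rfl, w, by simp, hwc⟩)⟩
          (fun h => hpq (Subtype.ext_iff.1 h)) (fun h => hpa (Subtype.ext_iff.1 h))
          (fun h => hqa (Subtype.ext_iff.1 h))
      · refine (hdeg x).trans (ncard_contractInto_le (G := G) (a := a) ⟨x, hxS⟩ ?_)
        rintro s (rfl | rfl) hs
        · rcases hNw x hs.symm with h | h | h <;> contradiction
        · rcases hNb2 x hs.symm with h | h | h <;> contradiction
  obtain ⟨a, b, c, hab, hac, hbc, hN⟩ := Set.ncard_eq_three.1 hw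
  have hmem : ∀ x, G.Adj w x ↔ x = a ∨ x = b ∨ x = c := by
    intro x
    have : x ∈ G.neighborSet w ↔ x = a ∨ x = b ∨ x = c := by simp [hN]
    exact this
  -- No vertex is isolated in the neighbourhood of `w`, so its three vertices carry a path; the
  -- cases below decide which of them is in the middle.
  have hnb : ∀ x, G.Adj w x → ∃ y, G.Adj w y ∧ G.Adj y x := by
    intro x hx
    obtain ⟨y, h1, h2⟩ := hcommon w x hx
    exact ⟨y, h1.symm, h2⟩
  have hN1 : G.neighborSet w = {b, a, c} := by rw [hN, Set.insert_comm]
  have hN2 : G.neighborSet w = {a, c, b} := by rw [hN, Set.pair_comm b c]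
  obtain ⟨y, hy, hya⟩ := hnb a ((hmem a).2 (by simp))
  obtain ⟨z, hz, hzb⟩ := hnb b ((hmem b).2 (by simp))
  obtain ⟨t, ht, htc⟩ := hnb c ((hmem c).2 (by simp))
  by_cases h1 : G.Adj a b
  · rcases (hmem t).1 ht with rfl | rfl | rfl
    · exact main b t c hab.symm hbc hac hN1 h1.symm htc
    · exact main a t c hab hac hbc hN h1 htc
    · exact htc.ne rfl
  · have h2 : G.Adj b c := by
      rcases (hmem z).1 hz with rfl | rfl | rfl
      · exact absurd hzb h1
      · exact absurd rfl hzb.ne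
      · exact hzb.symm
    have h3 : G.Adj a c := by
      rcases (hmem y).1 hy with rfl | rfl | rfl
      · exact absurd rfl hya.ne
      · exact absurd hya.symm h1
      · exact hya.symm
    exact main a c b hac hab hbc.symm hN2 h3 h2.symm

/-- A `2`-connected graph without `K₄` minor has a vertex with exactly two neighbours. -/
theorem IsTwoConnected.exists_degree_two [Fintype V] {G : SimpleGraph V} (hG : G.IsTwoConnected)
    (hK : ¬ (completeGraph (Fin 4)).IsMinorOf G) :
    ∃ v a b, a ≠ b ∧ ∀ x, G.Adj v x ↔ x = a ∨ x = b := by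
  have hcard := hG.1
  have : Nonempty V := Fintype.card_pos_iff.1 (by omega)
  obtain ⟨v, hv⟩ : ∃ v, (G.neighborSet v).ncard < 3 := by
    by_contra! h
    exact hK (completeGraph_four_isMinorOf_of_three_le_degree _ G rfl h)
  have hex : ∀ c, ∃ a, a ≠ c ∧ G.Adj v a := by
    intro c
    by_cases hcv : c = v
    · subst hcv
      have h1 : (Set.univ \ {c} : Set V).Nonempty := by
        obtain ⟨d, hd⟩ := Fintype.exists_ne_of_one_lt_card (by omega) c
        exact ⟨d, trivial, hd⟩
      obtain ⟨x, rfl, y, hy, hxy⟩ := hG.connectedOn_univ.exists_adj (T := {c})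
        (Set.subset_univ _) ⟨c, rfl⟩ h1
      exact ⟨y, hxy.ne', hxy⟩
    · have h1 : (({c} : Set V)ᶜ \ {v}).Nonempty := by
        have h2 : ((Set.univ : Set V) \ {c, v}).Nonempty := by
          rw [Set.nonempty_iff_ne_empty, Ne, Set.sdiff_eq_empty]
          intro h
          have h3 := (Set.ncard_le_ncard h (Set.toFinite _)).trans (ncard_pair_le c v)
          rw [Set.ncard_univ, Nat.card_eq_fintype_card] at h3
          omega
        obtain ⟨d, -, hd⟩ := h2
        exact ⟨d, fun h => hd (Or.inl h), fun h => hd (Or.inr h)⟩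
      obtain ⟨x, rfl, y, hy, hxy⟩ := (hG.connectedOn_compl c).exists_adj (T := {v})
        (by rintro _ rfl h; exact hcv h.symm) ⟨v, rfl⟩ h1
      exact ⟨y, hy.1, hxy⟩
  obtain ⟨a, -, ha⟩ := hex v
  obtain ⟨b, hba, hb⟩ := hex a
  have hset : G.neighborSet v = {a, b} := by
    symm
    refine Set.eq_of_subset_of_ncard_le ?_ ?_ (Set.toFinite _)
    · rintro y (rfl | rfl)
      exacts [ha, hb]
    · rw [Set.ncard_pair hba.symm]
      omega
  refine ⟨v, a, b, hba.symm, fun x => ?_⟩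
  have : x ∈ G.neighborSet v ↔ x = a ∨ x = b := by simp [hset]
  exact this

end MinDegree

end SimpleGraph

namespace SimpleGraph

/-! ### Induced cycles -/

section InducedCycle

variable {V : Type*} {G H : SimpleGraph V} {A B C : Set V} {n : ℕ} {c : ℕ → V} {u v x : V}

/-- `C` induces a cycle in `G`. -/
def IsInducedCycle (G : SimpleGraph V) (C : Set V) : Prop :=
  (G.induce C).IsCycleGraph

/-- `c 0, …, c (n - 1)` runs once around the induced cycle `C`. -/
structure CycleEnum (G : SimpleGraph V) (C : Set V) (n : ℕ) (c : ℕ → V) : Prop where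
  three_le : 3 ≤ n
  mem : ∀ i < n, c i ∈ C
  surj : ∀ x ∈ C, ∃ i < n, c i = x
  inj : ∀ i < n, ∀ j < n, c i = c j → i = j
  adj : ∀ i j, i < j → j < n → (G.Adj (c i) (c j) ↔ j = i + 1 ∨ (i = 0 ∧ j = n - 1))

theorem cycleGraph_adj_iff {n : ℕ} (hn : 3 ≤ n) {i j : Fin n} (hij : i < j) :
    (cycleGraph n).Adj i j ↔ (j : ℕ) = i + 1 ∨ ((i : ℕ) = 0 ∧ (j : ℕ) = n - 1) := by
  have hi := i.2
  have hj := j.2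
  have hij' : (i : ℕ) < j := hij
  rw [cycleGraph_adj', Fin.sub_def, Fin.sub_def]
  dsimp only
  have h1 : (n - (j : ℕ) + i) % n = n - j + i := Nat.mod_eq_of_lt (by omega)
  have h2 : (n - (i : ℕ) + j) % n = j - i := by
    have : n - (i : ℕ) + j = (j - i) + n := by omega
    rw [this, Nat.add_mod_right, Nat.mod_eq_of_lt (by omega)]
  rw [h1, h2]
  omega

theorem isInducedCycle_iff : G.IsInducedCycle C ↔ ∃ n c, G.CycleEnum C n c := by
  constructor
  · rintro ⟨n, hn, ⟨e⟩⟩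
    have : NeZero n := ⟨by omega⟩
    have hval : ∀ i < n, ((Fin.ofNat n i : Fin n) : ℕ) = i := fun i hi => by
      simp [Nat.mod_eq_of_lt hi]
    refine ⟨n, fun i => e.symm (Fin.ofNat n i), hn, fun i _ => Subtype.prop _, fun x hx => ?_,
      fun i hi j hj hij => ?_, fun i j hij hj => ?_⟩
    · exact ⟨e ⟨x, hx⟩, Fin.is_lt _, by simp⟩
    · have := e.symm.injective (Subtype.ext hij)
      rw [← hval i hi, ← hval j hj, this]
    · have h1 : G.Adj (e.symm (Fin.ofNat n i)) (e.symm (Fin.ofNat n j)) ↔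
          (cycleGraph n).Adj (Fin.ofNat n i) (Fin.ofNat n j) := e.symm.map_adj_iff
      rw [h1, cycleGraph_adj_iff hn, hval i (by omega), hval j hj]
      rw [Fin.lt_def, hval i (by omega), hval j hj]
      exact hij
  · rintro ⟨n, c, h⟩
    let f : Fin n → C := fun i => ⟨c i, h.mem i i.2⟩
    have hf : Function.Bijective f := by
      refine ⟨fun i j hij => Fin.ext (h.inj i i.2 j j.2 (Subtype.ext_iff.1 hij)), fun x => ?_⟩
      obtain ⟨i, hi, hix⟩ := h.surj x x.2
      exact ⟨⟨i, hi⟩, Subtype.ext hix⟩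
    refine ⟨n, h.three_le, ⟨RelIso.symm ⟨Equiv.ofBijective f hf, ?_⟩⟩⟩
    intro i j
    change G.Adj (c i) (c j) ↔ _
    rcases lt_trichotomy i j with hij | rfl | hij
    · rw [cycleGraph_adj_iff h.three_le hij, h.adj _ _ hij j.2]
    · simp
    · rw [adj_comm, (cycleGraph n).adj_comm, cycleGraph_adj_iff h.three_le hij, h.adj _ _ hij i.2]

theorem CycleEnum.rotate (h : G.CycleEnum C n c) :
    G.CycleEnum C n (fun i => if i = n - 1 then c 0 else c (i + 1)) := by
  have hn := h.three_le
  refine ⟨hn, fun i hi => ?_, fun x hx => ?_, fun i hi j hj hij => ?_, fun i j hij hj => ?_⟩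
  · split_ifs
    · exact h.mem 0 (by omega)
    · exact h.mem (i + 1) (by omega)
  · obtain ⟨i, hi, rfl⟩ := h.surj x hx
    rcases i with _ | i
    · exact ⟨n - 1, by omega, by simp⟩
    · exact ⟨i, by omega, by rw [if_neg (by omega)]⟩
  · beta_reduce at hij
    split_ifs at hij
    · omega
    · have := h.inj _ (by omega) _ (by omega) hij; omega
    · have := h.inj _ (by omega) _ (by omega) hij; omega
    · have := h.inj _ (by omega) _ (by omega) hij; omega
  · rw [if_neg (by omega : i ≠ n - 1)]
    split_ifs
    · rw [adj_comm, h.adj _ _ (by omega) (by omega)]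
      omega
    · rw [h.adj _ _ (by omega) (by omega)]
      omega

theorem CycleEnum.exists_start (h : G.CycleEnum C n c) (hx : x ∈ C) :
    ∃ c', G.CycleEnum C n c' ∧ c' 0 = x := by
  have : ∀ k, ∀ c, G.CycleEnum C n c → k < n → ∃ c', G.CycleEnum C n c' ∧ c' 0 = c k := by
    intro k
    induction k with
    | zero => exact fun c h _ => ⟨c, h, rfl⟩
    | succ k ih =>
      intro c h hk
      obtain ⟨c', h', h0⟩ := ih _ h.rotate (by omega)
      exact ⟨c', h', by rw [h0, if_neg (by omega)]⟩
  obtain ⟨i, hi, rfl⟩ := h.surj x hx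
  exact this i c h hi

/-- Makes a prescribed edge the closing edge, so that the rest of the cycle is enumerated as a path.
Rotations keep the direction, so the order of the two ends is not controlled. -/
theorem CycleEnum.exists_ends (h : G.CycleEnum C n c) (hu : u ∈ C) (hv : v ∈ C)
    (huv : G.Adj u v) : ∃ c', G.CycleEnum C n c' ∧
      ((c' 0 = u ∧ c' (n - 1) = v) ∨ (c' 0 = v ∧ c' (n - 1) = u)) := by
  obtain ⟨c, h, rfl⟩ := h.exists_start hu
  have hn := h.three_le
  obtain ⟨j, hj, rfl⟩ := h.surj v hv
  have h0 : 0 < j := by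
    rcases Nat.eq_zero_or_pos j with rfl | h0
    · exact absurd rfl huv.ne
    · exact h0
  rcases (h.adj _ _ h0 hj).1 huv with rfl | ⟨-, rfl⟩
  · exact ⟨_, h.rotate, Or.inr ⟨by rw [if_neg (by omega)], by simp⟩⟩
  · exact ⟨c, h, Or.inl ⟨rfl, rfl⟩⟩

theorem IsInducedCycle.exists_enum (h : G.IsInducedCycle C) (hu : u ∈ C) (hv : v ∈ C)
    (huv : G.Adj u v) : ∃ n c, G.CycleEnum C n c ∧
      ((c 0 = u ∧ c (n - 1) = v) ∨ (c 0 = v ∧ c (n - 1) = u)) := by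
  obtain ⟨n, c, h⟩ := isInducedCycle_iff.1 h
  exact ⟨n, h.exists_ends hu hv huv⟩

/-- A union of consecutively adjacent connected sets is connected. -/
theorem connectedOn_biUnion_Icc {X : ℕ → Set V} {l r : ℕ} (hlr : l ≤ r)
    (hX : ∀ i, l ≤ i → i ≤ r → G.ConnectedOn (X i))
    (hadj : ∀ i, l ≤ i → i < r → ∃ x ∈ X i, ∃ y ∈ X (i + 1), G.Adj x y) :
    G.ConnectedOn (⋃ i ∈ Set.Icc l r, X i) := by
  induction r, hlr using Nat.le_induction with
  | base => simpa using hX l le_rfl le_rfl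
  | succ r hlr ih =>
    have ih := ih (fun i h1 h2 => hX i h1 (by omega)) (fun i h1 h2 => hadj i h1 (by omega))
    obtain ⟨x, hx, y, hy, hxy⟩ := hadj r hlr (by omega)
    have := ih.union_of_adj (hX (r + 1) (by omega) le_rfl)
      (Set.mem_biUnion (Set.mem_Icc.2 ⟨hlr, le_rfl⟩) hx) hy hxy
    convert this using 1
    ext z
    simp only [Set.mem_iUnion, Set.mem_Icc, Set.mem_union, exists_prop]
    constructor
    · rintro ⟨i, ⟨h1, h2⟩, hz⟩
      rcases Nat.lt_or_ge r i with h3 | h3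
      · exact Or.inr (by rwa [show i = r + 1 by omega] at hz)
      · exact Or.inl ⟨i, ⟨h1, h3⟩, hz⟩
    · rintro (⟨i, ⟨h1, h2⟩, hz⟩ | hz)
      · exact ⟨i, ⟨h1, by omega⟩, hz⟩
      · exact ⟨r + 1, ⟨by omega, le_rfl⟩, hz⟩

theorem CycleEnum.connectedOn_Icc (h : G.CycleEnum C n c) {l r : ℕ} (hlr : l ≤ r) (hr : r < n) :
    G.ConnectedOn (c '' Set.Icc l r) := by
  have := connectedOn_biUnion_Icc (G := G) (X := fun i => {c i}) hlr
    (fun i _ _ => connectedOn_singleton _)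
    (fun i _ h2 => ⟨_, rfl, _, rfl, (h.adj _ _ (by omega) (by omega)).2 (Or.inl rfl)⟩)
  convert this using 1
  ext z
  simp [eq_comm]

theorem IsInducedCycle.connectedOn (h : G.IsInducedCycle C) : G.ConnectedOn C := by
  obtain ⟨n, c, h⟩ := isInducedCycle_iff.1 h
  have hn := h.three_le
  convert h.connectedOn_Icc (l := 0) (r := n - 1) (by omega) (by omega) using 1
  ext x
  constructor
  · intro hx
    obtain ⟨i, hi, rfl⟩ := h.surj x hx
    exact ⟨i, ⟨by omega, by omega⟩, rfl⟩
  · rintro ⟨i, ⟨_, hi⟩, rfl⟩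
    exact h.mem i (by omega)

theorem IsInducedCycle.connectedOn_diff_singleton (h : G.IsInducedCycle C) (hx : x ∈ C) :
    G.ConnectedOn (C \ {x}) := by
  obtain ⟨n, c, h⟩ := isInducedCycle_iff.1 h
  obtain ⟨c, h, rfl⟩ := h.exists_start hx
  have hn := h.three_le
  convert h.connectedOn_Icc (l := 1) (r := n - 1) (by omega) (by omega) using 1
  ext x
  constructor
  · rintro ⟨hx, hx0⟩
    obtain ⟨i, hi, rfl⟩ := h.surj x hx
    refine ⟨i, ⟨?_, by omega⟩, rfl⟩
    rcases i with _ | i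
    · exact absurd rfl hx0
    · omega
  · rintro ⟨i, ⟨h1, hi⟩, rfl⟩
    exact ⟨h.mem i (by omega), fun h0 => by have := h.inj _ (by omega) _ (by omega) h0; omega⟩

theorem IsInducedCycle.connectedOn_diff_pair (h : G.IsInducedCycle C) (hu : u ∈ C) (hv : v ∈ C)
    (huv : G.Adj u v) : G.ConnectedOn (C \ {u, v}) := by
  obtain ⟨n, c, h, hc⟩ := h.exists_enum hu hv huv
  have hset : ({u, v} : Set V) = {c 0, c (n - 1)} := by
    rcases hc with ⟨rfl, rfl⟩ | ⟨rfl, rfl⟩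
    · rfl
    · exact Set.pair_comm _ _
  rw [hset]
  have hn := h.three_le
  convert h.connectedOn_Icc (l := 1) (r := n - 2) (by omega) (by omega) using 1
  ext x
  constructor
  · rintro ⟨hx, hx0⟩
    obtain ⟨i, hi, rfl⟩ := h.surj x hx
    have h0 : i ≠ 0 := by rintro rfl; exact hx0 (Or.inl rfl)
    have h1 : i ≠ n - 1 := by rintro rfl; exact hx0 (Or.inr rfl)
    exact ⟨i, ⟨by omega, by omega⟩, rfl⟩
  · rintro ⟨i, ⟨h1, hi⟩, rfl⟩
    refine ⟨h.mem i (by omega), ?_⟩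
    rintro (h0 | h0)
    · have := h.inj _ (by omega) _ (by omega) h0; omega
    · have := h.inj _ (by omega) _ (by omega) h0; omega

/-- A vertex of an induced cycle has exactly two neighbours on it. -/
theorem IsInducedCycle.exists_neighbors (h : G.IsInducedCycle C) (hx : x ∈ C) :
    ∃ y ∈ C, ∃ z ∈ C, y ≠ z ∧ G.Adj x y ∧ G.Adj x z ∧ ∀ w ∈ C, G.Adj x w → w = y ∨ w = z := by
  obtain ⟨n, c, h⟩ := isInducedCycle_iff.1 h
  obtain ⟨c, h, rfl⟩ := h.exists_start hx
  have hn := h.three_le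
  refine ⟨c 1, h.mem _ (by omega), c (n - 1), h.mem _ (by omega), fun h0 => ?_, ?_, ?_,
    fun w hw hadj => ?_⟩
  · have := h.inj _ (by omega) _ (by omega) h0; omega
  · exact (h.adj _ _ (by omega) (by omega)).2 (Or.inl rfl)
  · exact (h.adj _ _ (by omega) (by omega)).2 (Or.inr ⟨rfl, rfl⟩)
  · obtain ⟨i, hi, rfl⟩ := h.surj w hw
    rcases Nat.eq_zero_or_pos i with rfl | h0
    · exact absurd rfl hadj.ne
    · rcases (h.adj _ _ h0 hi).1 hadj with rfl | ⟨-, rfl⟩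
      · exact Or.inl rfl
      · exact Or.inr rfl

/-- A vertex of `C` already has both of its `B`-neighbours in `C`, so `C` is closed in the connected
set `B`. -/
theorem IsInducedCycle.eq_of_subset (hC : G.IsInducedCycle C) (hB : G.IsInducedCycle B)
    (h : C ⊆ B) : C = B := by
  refine hB.connectedOn.2 C ⟨h, fun x hx y hy hxy => ?_⟩ hC.connectedOn.1
  obtain ⟨p, hp, q, hq, hpq, hxp, hxq, -⟩ := hC.exists_neighbors hx
  obtain ⟨p', -, q', -, -, -, -, h'⟩ := hB.exists_neighbors (h hx)
  have h1 := h' p (h hp) hxp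
  have h2 := h' q (h hq) hxq
  have h3 := h' y hy hxy
  have : y = p ∨ y = q := by
    rcases h1 with rfl | rfl <;> rcases h2 with rfl | rfl <;> tauto
  rcases this with rfl | rfl <;> assumption

theorem IsInducedCycle.congr (h : G.IsInducedCycle C)
    (hGH : ∀ x ∈ C, ∀ y ∈ C, G.Adj x y ↔ H.Adj x y) : H.IsInducedCycle C := by
  have : H.induce C = G.induce C := by
    ext x y
    exact (hGH x x.2 y y.2).symm
  unfold IsInducedCycle
  rw [this]
  exact h

theorem isInducedCycle_triangle {a b c : V} (hab : G.Adj a b) (hac : G.Adj a c)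
    (hbc : G.Adj b c) : G.IsInducedCycle {a, b, c} := by
  rw [isInducedCycle_iff]
  refine ⟨3, fun i => if i = 0 then a else if i = 1 then b else c, le_rfl, fun i hi => ?_,
    fun x hx => ?_, fun i hi j hj h => ?_, fun i j hij hj => ?_⟩
  · interval_cases i <;> simp
  · rcases hx with rfl | rfl | rfl
    exacts [⟨0, by simp⟩, ⟨1, by simp⟩, ⟨2, by simp⟩]
  · interval_cases i <;> interval_cases j <;>
      first | rfl | exact absurd h (by simp [hab.ne, hac.ne, hbc.ne, hab.ne', hac.ne', hbc.ne'])
  · interval_cases j <;> interval_cases i <;> simp [hab, hac, hbc]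

/-- Subdividing an edge of an induced cycle. -/
theorem IsInducedCycle.subdivide (hA : G.IsInducedCycle A) {a b v : V} (ha : a ∈ A) (hb : b ∈ A)
    (hab : G.Adj a b) (hv : v ∉ A)
    (hadj : ∀ x ∈ A, ∀ y ∈ A, H.Adj x y ↔ G.Adj x y ∧ ({x, y} : Set V) ≠ {a, b})
    (hvadj : ∀ x ∈ A, H.Adj x v ↔ x = a ∨ x = b) : H.IsInducedCycle (insert v A) := by
  obtain ⟨n, c, h, hc⟩ := hA.exists_enum ha hb hab
  have hset : ({a, b} : Set V) = {c 0, c (n - 1)} := by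
    rcases hc with ⟨rfl, rfl⟩ | ⟨rfl, rfl⟩
    · rfl
    · exact Set.pair_comm _ _
  have hvadj' : ∀ x ∈ A, H.Adj x v ↔ x = c 0 ∨ x = c (n - 1) := by
    intro x hx
    rw [hvadj x hx]
    have : x ∈ ({a, b} : Set V) ↔ x ∈ ({c 0, c (n - 1)} : Set V) := by rw [hset]
    simpa using this
  rw [hset] at hadj
  have hn := h.three_le
  rw [isInducedCycle_iff]
  -- The subdivided edge is the closing edge of the enumeration, so `v` is appended at the end.
  refine ⟨n + 1, fun i => if i = n then v else c i, by omega, fun i hi => ?_, fun x hx => ?_,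
    fun i hi j hj hij => ?_, fun i j hij hj => ?_⟩
  · split_ifs
    · exact Or.inl rfl
    · exact Or.inr (h.mem i (by omega))
  · rcases hx with rfl | hx
    · exact ⟨n, by omega, by simp⟩
    · obtain ⟨i, hi, rfl⟩ := h.surj x hx
      exact ⟨i, by omega, by rw [if_neg (by omega)]⟩
  · beta_reduce at hij
    split_ifs at hij
    · omega
    · exact absurd (hij ▸ h.mem j (by omega)) hv
    · exact absurd (hij ▸ h.mem i (by omega)) hv
    · exact h.inj _ (by omega) _ (by omega) hij
  · rw [if_neg (by omega : i ≠ n)]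
    split_ifs with hjn
    · rw [hvadj' _ (h.mem i (by omega))]
      constructor
      · rintro (h1 | h1)
        · have := h.inj _ (by omega) _ (by omega) h1; omega
        · have := h.inj _ (by omega) _ (by omega) h1; omega
      · rintro (h1 | ⟨h1, -⟩)
        · exact Or.inr (by rw [show i = n - 1 by omega])
        · exact Or.inl (by rw [h1])
    · rw [hadj _ (h.mem i (by omega)) _ (h.mem j (by omega)), h.adj i j hij (by omega)]
      constructor
      · rintro ⟨h1 | ⟨rfl, rfl⟩, h2⟩
        · exact Or.inl h1
        · exact absurd rfl h2
      · rintro (h1 | h1)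
        · refine ⟨Or.inl h1, fun h2 => ?_⟩
          have h3 : c i ∈ ({c 0, c (n - 1)} : Set V) := h2 ▸ Or.inl rfl
          have h4 : c j ∈ ({c 0, c (n - 1)} : Set V) := h2 ▸ Or.inr rfl
          rcases h3 with h3 | h3 <;> rcases h4 with h4 | h4 <;>
          · have := h.inj _ (by omega) _ (by omega) h3
            have := h.inj _ (by omega) _ (by omega) h4
            omega
        · omega

end InducedCycle

/-! ### Trees of cycles inside an ambient graph -/

section TreeOfCyclesOn

variable {V : Type u} {G H : SimpleGraph V} {A B C C' P Q : Set V} {a b c d u v x : V}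

/-- `P` and `Q` meet in `{c, d}` and there is no edge between `P \ Q` and `Q \ P`. -/
structure PairSeparates (G : SimpleGraph V) (P Q : Set V) (c d : V) : Prop where
  inter : P ∩ Q = {c, d}
  noCross : ∀ x ∈ P, ∀ y ∈ Q, G.Adj x y → x ∈ Q ∨ y ∈ P

namespace PairSeparates

theorem symm (h : G.PairSeparates P Q c d) : G.PairSeparates Q P c d :=
  ⟨by rw [Set.inter_comm, h.inter], fun x hx y hy hxy => (h.noCross y hy x hx hxy.symm).symm⟩

theorem left_mem (h : G.PairSeparates P Q c d) : c ∈ P ∧ c ∈ Q := by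
  have : c ∈ P ∩ Q := by rw [h.inter]; exact Or.inl rfl
  exact this

theorem right_mem (h : G.PairSeparates P Q c d) : d ∈ P ∧ d ∈ Q := by
  have : d ∈ P ∩ Q := by rw [h.inter]; exact Or.inr rfl
  exact this

theorem eq_or_eq (h : G.PairSeparates P Q c d) (hP : x ∈ P) (hQ : x ∈ Q) : x = c ∨ x = d := by
  have : x ∈ P ∩ Q := ⟨hP, hQ⟩
  rwa [h.inter] at this

theorem adj_mem (h : G.PairSeparates P Q c d) (hx : x ∈ P ∪ Q) {y : V} (hy : y ∈ P ∪ Q)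
    (hxy : G.Adj x y) : (x ∈ P ∧ y ∈ P) ∨ (x ∈ Q ∧ y ∈ Q) := by
  rcases hx with hx | hx <;> rcases hy with hy | hy
  · exact Or.inl ⟨hx, hy⟩
  · rcases h.noCross x hx y hy hxy with h' | h'
    exacts [Or.inr ⟨h', hy⟩, Or.inl ⟨hx, h'⟩]
  · rcases h.symm.noCross x hx y hy hxy with h' | h'
    exacts [Or.inl ⟨h', hy⟩, Or.inr ⟨hx, h'⟩]
  · exact Or.inr ⟨hx, hy⟩

/-- The part of one side off the separator is closed off the separator. -/
theorem closedIn (h : G.PairSeparates P Q c d) : G.ClosedIn ((P ∪ Q) \ {c, d}) (P \ {c, d}) := by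
  refine ⟨Set.sdiff_subset_sdiff_left Set.subset_union_left, fun x hx y hy hxy => ⟨?_, hy.2⟩⟩
  rcases h.adj_mem (Or.inl hx.1) hy.1 hxy with h' | h'
  · exact h'.2
  · exact absurd (h.eq_or_eq hx.1 h'.1) hx.2

/-- A piece glued along a pair inside `P` meets `P ∪ Q` only in `P`, so it can join that side
without creating an edge across. -/
theorem extend (h : G.PairSeparates P Q c d) (h' : G.PairSeparates (P ∪ Q) B u v) (hu : u ∈ P)
    (hv : v ∈ P) : G.PairSeparates (P ∪ B) Q c d := by
  have hB : ∀ x ∈ B, x ∈ P ∪ Q → x ∈ P := by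
    intro x hx hx'
    rcases h'.eq_or_eq hx' hx with rfl | rfl <;> assumption
  refine ⟨?_, fun x hx y hy hxy => ?_⟩
  · rw [← h.inter]
    ext x
    constructor
    · rintro ⟨hx | hx, hQ⟩
      exacts [⟨hx, hQ⟩, ⟨hB x hx (Or.inr hQ), hQ⟩]
    · exact fun hx => ⟨Or.inl hx.1, hx.2⟩
  · have key : x ∈ P → x ∈ Q ∨ y ∈ P ∪ B := fun hx => (h.noCross x hx y hy hxy).imp_right Or.inl
    rcases hx with hx | hx
    · exact key hx
    · rcases h'.noCross y (Or.inr hy) x hx hxy.symm with h1 | h1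
      · exact Or.inr (Or.inr h1)
      · exact key (hB x hx h1)

end PairSeparates

/-- The vertex set `A` induces a tree of cycles in `G`. -/
inductive TreeOfCyclesOn (G : SimpleGraph V) : Set V → Prop
  | cycle (C : Set V) (hC : G.IsInducedCycle C) : TreeOfCyclesOn G C
  | glue (A B : Set V) (u v : V) (huv : G.Adj u v) (hsep : G.PairSeparates A B u v)
      (hA : TreeOfCyclesOn G A) (hB : G.IsInducedCycle B) : TreeOfCyclesOn G (A ∪ B)

theorem isInducedCycle_image {W : Type*} {K : SimpleGraph W} (φ : K ↪g G) (S : Set W) :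
    G.IsInducedCycle (φ '' S) ↔ K.IsInducedCycle S := by
  let e : K.induce S ≃g G.induce (φ '' S) :=
    ⟨Equiv.Set.image φ S φ.injective, fun {a b} => φ.map_adj_iff⟩
  exact ⟨fun ⟨n, hn, ⟨f⟩⟩ => ⟨n, hn, ⟨e.trans f⟩⟩, fun ⟨n, hn, ⟨f⟩⟩ => ⟨n, hn, ⟨e.symm.trans f⟩⟩⟩

/-- `IsTreeOfCycles` changes its vertex type at each gluing. Quantifying over all embeddings lets
the induction place both pieces in one fixed ambient graph. -/
theorem IsTreeOfCycles.treeOfCyclesOn_range {V' : Type u} {K : SimpleGraph V'}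
    (h : K.IsTreeOfCycles) : ∀ {V : Type u} {G : SimpleGraph V} (φ : K ↪g G),
    G.TreeOfCyclesOn (Set.range φ) := by
  induction h with
  | cycle K hK =>
    intro V G φ
    refine .cycle _ ?_
    rw [← Set.image_univ, isInducedCycle_image]
    obtain ⟨n, hn, ⟨f⟩⟩ := hK
    exact ⟨n, hn, ⟨(induceUnivIso K).trans f⟩⟩
  | glue K A B u v huv hinter hunion hedge hA hB ih =>
    intro V G φ
    have h1 := ih ((Embedding.induce A).trans φ)
    have h2 : Set.range ((Embedding.induce (G := K) A).trans φ) = φ '' A := by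
      ext x
      simp
    rw [h2] at h1
    have h3 := TreeOfCyclesOn.glue (φ '' A) (φ '' B) (φ u) (φ v) (φ.map_adj_iff.2 huv) ⟨?_, ?_⟩ h1
      ((isInducedCycle_image φ B).2 hB)
    · rwa [← Set.image_union, hunion, Set.image_univ] at h3
    · rw [← Set.image_inter φ.injective, hinter, Set.image_pair]
    · rintro _ ⟨x, hx, rfl⟩ _ ⟨y, hy, rfl⟩ hxy
      rcases hedge x y (φ.map_adj_iff.1 hxy) with h | h
      · exact Or.inr ⟨y, h.2, rfl⟩
      · exact Or.inl ⟨x, h.1, rfl⟩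

theorem TreeOfCyclesOn.isTreeOfCycles (h : G.TreeOfCyclesOn A) : ∀ {W : Type u}
    {K : SimpleGraph W} (φ : K ↪g G), Set.range φ = A → K.IsTreeOfCycles := by
  induction h with
  | cycle C hC =>
    intro W K φ hφ
    refine .cycle _ ?_
    rw [← hφ, ← Set.image_univ, isInducedCycle_image] at hC
    obtain ⟨n, hn, ⟨f⟩⟩ := hC
    exact ⟨n, hn, ⟨(induceUnivIso K).symm.trans f⟩⟩
  | glue A B u v huv hsep hA hB ih =>
    intro W K φ hφ
    have hAr : φ '' (φ ⁻¹' A) = A :=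
      Set.image_preimage_eq_of_subset (hφ ▸ Set.subset_union_left)
    have hBr : φ '' (φ ⁻¹' B) = B :=
      Set.image_preimage_eq_of_subset (hφ ▸ Set.subset_union_right)
    obtain ⟨u, rfl⟩ : u ∈ Set.range φ := hφ ▸ Or.inl hsep.left_mem.1
    obtain ⟨v, rfl⟩ : v ∈ Set.range φ := hφ ▸ Or.inl hsep.right_mem.1
    refine .glue K (φ ⁻¹' A) (φ ⁻¹' B) u v (φ.map_adj_iff.1 huv) ?_ ?_ ?_ ?_ ?_
    · rw [← Set.preimage_inter, hsep.inter, ← Set.image_pair,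
        Set.preimage_image_eq _ φ.injective]
    · rw [← Set.preimage_union, ← hφ, Set.preimage_range]
    · intro x y hxy
      exact hsep.adj_mem (hφ ▸ ⟨x, rfl⟩) (hφ ▸ ⟨y, rfl⟩) (φ.map_adj_iff.2 hxy)
    · refine ih ((Embedding.induce _).trans φ) ?_
      rw [← hAr]
      ext x
      simp
    · have := (isInducedCycle_image φ (φ ⁻¹' B)).1 (by rwa [hBr])
      exact this

theorem isTreeOfCycles_iff : G.IsTreeOfCycles ↔ G.TreeOfCyclesOn Set.univ := by
  constructor
  · intro h
    have := h.treeOfCyclesOn_range (Embedding.refl : G ↪g G)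
    rwa [show Set.range (Embedding.refl : G ↪g G) = Set.univ from Set.range_id] at this
  · intro h
    exact h.isTreeOfCycles (Embedding.refl : G ↪g G) Set.range_id

theorem TreeOfCyclesOn.congr (h : G.TreeOfCyclesOn A)
    (hGH : ∀ x ∈ A, ∀ y ∈ A, G.Adj x y ↔ H.Adj x y) : H.TreeOfCyclesOn A := by
  induction h with
  | cycle C hC => exact .cycle _ (hC.congr hGH)
  | glue A B u v huv hsep hA hB ih =>
    have hu := hsep.left_mem.1
    have hv := hsep.right_mem.1
    refine .glue A B u v ((hGH u (Or.inl hu) v (Or.inl hv)).1 huv)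
      ⟨hsep.inter, fun x hx y hy hxy =>
        hsep.noCross x hx y hy ((hGH x (Or.inl hx) y (Or.inr hy)).2 hxy)⟩
      (ih fun x hx y hy => hGH x (Or.inl hx) y (Or.inl hy))
      (hB.congr fun x hx y hy => hGH x (Or.inr hx) y (Or.inr hy))

theorem TreeOfCyclesOn.exists_cycle (h : G.TreeOfCyclesOn A) : ∃ C ⊆ A, G.IsInducedCycle C := by
  induction h with
  | cycle C hC => exact ⟨C, subset_rfl, hC⟩
  | glue A B u v huv hsep hA hB ih => exact ⟨B, Set.subset_union_right, hB⟩

/-- The edge need not meet the cycle; this generality is needed to compare a cycle with an arbitrary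
separation along an edge. -/
theorem IsInducedCycle.connectedOn_diff_edge (h : G.IsInducedCycle C) (huv : G.Adj u v) :
    G.ConnectedOn (C \ {u, v}) := by
  by_cases hu : u ∈ C
  · by_cases hv : v ∈ C
    · exact h.connectedOn_diff_pair hu hv huv
    · rw [Set.pair_comm, Set.insert_eq, ← Set.sdiff_sdiff, Set.sdiff_singleton_eq_self hv]
      exact h.connectedOn_diff_singleton hu
  · rw [Set.insert_eq, ← Set.sdiff_sdiff, Set.sdiff_singleton_eq_self hu]
    by_cases hv : v ∈ C
    · exact h.connectedOn_diff_singleton hv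
    · rw [Set.sdiff_singleton_eq_self hv]
      exact h.connectedOn

theorem TreeOfCyclesOn.nonempty_diff (h : G.TreeOfCyclesOn A) (hab : G.Adj a b) :
    (A \ {a, b}).Nonempty := by
  obtain ⟨C, hC, hcyc⟩ := h.exists_cycle
  exact (hcyc.connectedOn_diff_edge hab).1.mono (Set.sdiff_subset_sdiff_left hC)

/-- An induced cycle lies on one side of a separation along an edge. -/
theorem IsInducedCycle.subset_or_subset (hC : G.IsInducedCycle C) (hCA : C ⊆ P ∪ Q)
    (hsep : G.PairSeparates P Q u v) (huv : G.Adj u v) : C ⊆ P ∨ C ⊆ Q := by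
  have hconn := hC.connectedOn_diff_edge huv
  have hcl := hsep.closedIn.inter_left (U := C \ {u, v}) (Set.sdiff_subset_sdiff_left hCA)
  have hu := hsep.left_mem
  have hv := hsep.right_mem
  by_cases hne : ((C \ {u, v}) ∩ (P \ {u, v})).Nonempty
  · left
    intro x hx
    by_cases hxuv : x ∈ ({u, v} : Set V)
    · rcases hxuv with rfl | rfl
      exacts [hu.1, hv.1]
    · have := (hconn.2 _ hcl hne).symm.subset ⟨hx, hxuv⟩
      exact this.2.1
  · right
    intro x hx
    by_cases hxuv : x ∈ ({u, v} : Set V)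
    · rcases hxuv with rfl | rfl
      exacts [hu.2, hv.2]
    · exact (hCA hx).resolve_left fun hxP => hne ⟨x, ⟨hx, hxuv⟩, ⟨hxP, hxuv⟩⟩

/-- Distinct induced cycles of a tree of cycles are separated by an edge. -/
theorem TreeOfCyclesOn.exists_pairSeparates (h : G.TreeOfCyclesOn A) :
    ∀ C C' : Set V, C ≠ C' → C ⊆ A → C' ⊆ A → G.IsInducedCycle C → G.IsInducedCycle C' →
    ∃ P Q c d, G.Adj c d ∧ P ∪ Q = A ∧ G.PairSeparates P Q c d ∧ C ⊆ P ∧ C' ⊆ Q := by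
  induction h with
  | cycle D hD =>
    intro C C' hne hCA hCA' hC hC'
    exact absurd ((hC.eq_of_subset hD hCA).trans (hC'.eq_of_subset hD hCA').symm) hne
  | glue A B u v huv hsep hA hB ih =>
    intro C C' hne hCA hCA' hC hC'
    rcases hC.subset_or_subset hCA hsep huv with h1 | h1 <;>
      rcases hC'.subset_or_subset hCA' hsep huv with h2 | h2
    · obtain ⟨P, Q, c, d, hcd, hPQ, hs, hCP, hCQ⟩ := ih C C' hne h1 h2 hC hC'
      subst hPQ
      -- The gluing edge lies on one side of the separation found in the smaller tree of cycles, and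
      -- `B` is added to that side.
      rcases hs.adj_mem hsep.left_mem.1 hsep.right_mem.1 huv with h3 | h3
      · refine ⟨P ∪ B, Q, c, d, hcd, ?_, hs.extend hsep h3.1 h3.2, hCP.trans Set.subset_union_left,
          hCQ⟩
        ext; simp; tauto
      · refine ⟨P, Q ∪ B, c, d, hcd, ?_, (hs.symm.extend ?_ h3.1 h3.2).symm, hCP,
          hCQ.trans Set.subset_union_left⟩
        · ext; simp; tauto
        · rwa [Set.union_comm]
    · exact ⟨A, B, u, v, huv, rfl, hsep, h1, h2⟩
    · exact ⟨B, A, u, v, huv, Set.union_comm _ _, hsep.symm, h1, h2⟩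
    · exact absurd ((hC.eq_of_subset hB h1).trans (hC'.eq_of_subset hB h2).symm) hne

/-- Subdividing an edge that does not separate a tree of cycles. -/
theorem TreeOfCyclesOn.subdivide (h : G.TreeOfCyclesOn A) (ha : a ∈ A) (hb : b ∈ A)
    (hab : G.Adj a b) (hv : v ∉ A) (hconn : G.ConnectedOn (A \ {a, b}))
    (hadj : ∀ x ∈ A, ∀ y ∈ A, H.Adj x y ↔ G.Adj x y ∧ ({x, y} : Set V) ≠ {a, b})
    (hvadj : ∀ x ∈ A, H.Adj x v ↔ x = a ∨ x = b) : H.TreeOfCyclesOn (insert v A) := by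
  induction h with
  | cycle C hC => exact .cycle _ (hC.subdivide ha hb hab hv hadj hvadj)
  | glue A B c d hcd hsep hA hB ih =>
    have hc := hsep.left_mem
    have hd := hsep.right_mem
    -- Deleting the ends of the gluing edge separates the two pieces, which `hconn` excludes for
    -- `ab`. Hence `ab` lies in exactly one piece, and the subdivision happens there.
    have hne : ({c, d} : Set V) ≠ {a, b} := by
      intro heq
      rw [← heq] at hconn
      have h1 := hconn.2 _ hsep.closedIn (hA.nonempty_diff hcd)
      obtain ⟨x, hx⟩ := (hB.connectedOn_diff_edge hcd).1
      have h2 : x ∈ A \ {c, d} := h1.symm.subset ⟨Or.inr hx.1, hx.2⟩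
      exact hx.2 (hsep.eq_or_eq h2.1 hx.1)
    have hnotboth : ¬ ((a ∈ A ∧ b ∈ A) ∧ (a ∈ B ∧ b ∈ B)) := by
      rintro ⟨⟨h1, h2⟩, h3, h4⟩
      apply hne
      rcases hsep.eq_or_eq h1 h3 with rfl | rfl <;> rcases hsep.eq_or_eq h2 h4 with rfl | rfl
      · exact absurd rfl hab.ne
      · rfl
      · exact Set.pair_comm _ _
      · exact absurd rfl hab.ne
    have hnotpair : ∀ S : Set V, ¬ (a ∈ S ∧ b ∈ S) → ∀ x ∈ S, ∀ y ∈ S, ({x, y} : Set V) ≠ {a, b} := by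
      intro S hS x hx y hy heq
      have h1 : a ∈ ({x, y} : Set V) := heq ▸ Or.inl rfl
      have h2 : b ∈ ({x, y} : Set V) := heq ▸ Or.inr rfl
      refine hS ⟨?_, ?_⟩
      · rcases h1 with rfl | rfl <;> assumption
      · rcases h2 with rfl | rfl <;> assumption
    have hHcd : H.Adj c d := (hadj c (Or.inl hc.1) d (Or.inl hd.1)).2 ⟨hcd, hne⟩
    have hvA : v ∉ A := fun h => hv (Or.inl h)
    have hvB : v ∉ B := fun h => hv (Or.inr h)
    by_cases hAab : a ∈ A ∧ b ∈ A
    · have hBab : ¬ (a ∈ B ∧ b ∈ B) := fun h => hnotboth ⟨hAab, h⟩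
      -- A detour through `B` enters and leaves `A` at `c` and `d`, which are adjacent. So a closed
      -- part of `A \ {a, b}` stays closed in the whole, after adding `B \ A` if it contains `c` or
      -- `d`.
      have hconnA : G.ConnectedOn (A \ {a, b}) := by
        refine ⟨hA.nonempty_diff hab, fun T hT hTne => hT.1.antisymm ?_⟩
        by_cases hcdT : c ∈ T ∨ d ∈ T
        · have hTcl : G.ClosedIn ((A ∪ B) \ {a, b}) (T ∪ B \ A) := by
            refine ⟨?_, ?_⟩
            · rintro x (hx | hx)
              · exact ⟨Or.inl (hT.1 hx).1, (hT.1 hx).2⟩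
              · refine ⟨Or.inr hx.1, ?_⟩
                rintro (rfl | rfl)
                exacts [hx.2 hAab.1, hx.2 hAab.2]
            · rintro x hx y hy hxy
              by_cases hyA : y ∈ A
              · left
                rcases hx with hx | hx
                · exact hT.2 x hx y ⟨hyA, hy.2⟩ hxy
                · have hyB := (hsep.noCross y hyA x hx.1 hxy.symm).resolve_right hx.2
                  rcases hsep.eq_or_eq hyA hyB with rfl | rfl
                  · rcases hcdT with h | h
                    exacts [h, hT.2 d h y ⟨hyA, hy.2⟩ hcd.symm]
                  · rcases hcdT with h | h
                    exacts [hT.2 c h y ⟨hyA, hy.2⟩ hcd, h]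
              · exact Or.inr ⟨hy.1.resolve_left hyA, hyA⟩
          have := hconn.2 _ hTcl (hTne.mono Set.subset_union_left)
          intro x hx
          have h1 : x ∈ T ∪ B \ A := this.symm.subset ⟨Or.inl hx.1, hx.2⟩
          exact h1.resolve_right fun h2 => h2.2 hx.1
        · have hTcl : G.ClosedIn ((A ∪ B) \ {a, b}) T := by
            refine ⟨fun x hx => ⟨Or.inl (hT.1 hx).1, (hT.1 hx).2⟩, fun x hx y hy hxy => ?_⟩
            by_cases hyA : y ∈ A
            · exact hT.2 x hx y ⟨hyA, hy.2⟩ hxy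
            · have hxB := (hsep.noCross x (hT.1 hx).1 y (hy.1.resolve_left hyA) hxy).resolve_right
                hyA
              refine absurd ?_ hcdT
              rcases hsep.eq_or_eq (hT.1 hx).1 hxB with rfl | rfl
              exacts [Or.inl hx, Or.inr hx]
          have := hconn.2 _ hTcl hTne
          intro x hx
          exact this.symm.subset ⟨Or.inl hx.1, hx.2⟩
      rw [← Set.insert_union]
      refine .glue _ _ c d hHcd ⟨?_, ?_⟩ (ih hAab.1 hAab.2 hvA hconnA
        (fun x hx y hy => hadj x (Or.inl hx) y (Or.inl hy)) (fun x hx => hvadj x (Or.inl hx)))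
        (hB.congr fun x hx y hy => ?_)
      · rw [Set.insert_inter_of_notMem hvB, hsep.inter]
      · rintro x (rfl | hx) y hy hxy
        · rcases (hvadj y (Or.inr hy)).1 hxy.symm with rfl | rfl
          exacts [Or.inr (Or.inr hAab.1), Or.inr (Or.inr hAab.2)]
        · exact (hsep.noCross x hx y hy ((hadj x (Or.inl hx) y (Or.inr hy)).1 hxy).1).imp_right
            Or.inr
      · rw [hadj x (Or.inr hx) y (Or.inr hy)]
        exact ⟨fun h => ⟨h, hnotpair B hBab x hx y hy⟩, fun h => h.1⟩
    · have hBab : a ∈ B ∧ b ∈ B := (hsep.adj_mem ha hb hab).resolve_left hAab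
      rw [← Set.union_insert]
      refine .glue _ _ c d hHcd ⟨?_, ?_⟩ (hA.congr fun x hx y hy => ?_)
        (hB.subdivide hBab.1 hBab.2 hab hvB
          (fun x hx y hy => hadj x (Or.inr hx) y (Or.inr hy)) (fun x hx => hvadj x (Or.inr hx)))
      · rw [Set.inter_insert_of_notMem hvA, hsep.inter]
      · rintro x hx y (rfl | hy) hxy
        · rcases (hvadj x (Or.inl hx)).1 hxy with rfl | rfl
          exacts [Or.inl (Or.inr hBab.1), Or.inl (Or.inr hBab.2)]
        · exact (hsep.noCross x hx y hy ((hadj x (Or.inl hx) y (Or.inr hy)).1 hxy).1).imp_left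
            Or.inr
      · rw [hadj x (Or.inl hx) y (Or.inl hy)]
        exact ⟨fun h => ⟨h, hnotpair A hAab x hx y hy⟩, fun h => h.1⟩

end TreeOfCyclesOn

/-! ### The cell completion of a `2`-connected graph without `K₄` minor -/

section CellCompletion

variable {V : Type u} {G : SimpleGraph V} {a b v : V}

/-- Components are counted through colourings that are constant along edges, because a colouring is
easily restricted or extended when the vertex set changes. -/
theorem three_le_card_component_iff [Finite V] :
    3 ≤ Nat.card (G.induce (({a, b} : Set V)ᶜ)).ConnectedComponent ↔
      ∃ f : V → Fin 3, (∀ x ∈ ({a, b} : Set V)ᶜ, ∀ y ∈ ({a, b} : Set V)ᶜ, G.Adj x y → f x = f y) ∧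
        ∀ i, ∃ x ∈ ({a, b} : Set V)ᶜ, f x = i := by
  classical
  constructor
  · intro h
    have e := Finite.equivFin (G.induce (({a, b} : Set V)ᶜ)).ConnectedComponent
    -- The components are numbered; all those beyond the first three receive colour `0`.
    let g : (G.induce (({a, b} : Set V)ᶜ)).ConnectedComponent → Fin 3 :=
      fun c => if h : (e c : ℕ) < 3 then ⟨e c, h⟩ else 0
    refine ⟨fun x => if hx : x ∈ ({a, b} : Set V)ᶜ then
      g ((G.induce (({a, b} : Set V)ᶜ)).connectedComponentMk ⟨x, hx⟩) else 0,
      fun x hx y hy hxy => ?_, fun i => ?_⟩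
    · beta_reduce
      rw [dif_pos hx, dif_pos hy]
      congr 1
      refine ConnectedComponent.eq.2 (Adj.reachable ?_)
      exact hxy
    · obtain ⟨⟨x, hx⟩, hxi⟩ := (e.symm ⟨i, i.2.trans_le h⟩).exists_rep
      refine ⟨x, hx, ?_⟩
      beta_reduce
      rw [dif_pos hx]
      have : (G.induce (({a, b} : Set V)ᶜ)).connectedComponentMk ⟨x, hx⟩ =
        e.symm ⟨i, i.2.trans_le h⟩ := hxi
      simp [g, this]
  · rintro ⟨f, hf, hsurj⟩
    let g : (G.induce (({a, b} : Set V)ᶜ)).ConnectedComponent → Fin 3 :=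
      ConnectedComponent.lift (fun x => f x) (by
        intro x y p hp
        clear hp
        induction p with
        | nil => rfl
        | cons h _ ih => exact (hf _ (Subtype.prop _) _ (Subtype.prop _) h).trans ih)
    have hg : Function.Surjective g := fun i => by
      obtain ⟨x, hx, hxi⟩ := hsurj i
      exact ⟨(G.induce (({a, b} : Set V)ᶜ)).connectedComponentMk ⟨x, hx⟩, hxi⟩
    simpa using Nat.card_le_card_of_surjective g hg

theorem cellCompletion_adj [Finite V] : G.cellCompletion.Adj a b ↔ G.Adj a b ∨ (a ≠ b ∧
      ∃ f : V → Fin 3, (∀ x ∈ ({a, b} : Set V)ᶜ, ∀ y ∈ ({a, b} : Set V)ᶜ, G.Adj x y → f x = f y) ∧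
        ∀ i, ∃ x ∈ ({a, b} : Set V)ᶜ, f x = i) := by
  rw [← three_le_card_component_iff]
  rfl

theorem le_cellCompletion : G ≤ G.cellCompletion := fun _ _ h => Or.inl h

/-- For a vertex of degree two, contraction is suppression: nothing changes among the other vertices
except that `a` and `b` become adjacent. -/
theorem contractInto_adj_iff
    (hN : ∀ x, G.Adj v x ↔ x = a ∨ x = b) {x y : ↥(({v} : Set V)ᶜ)} (hab : a ≠ b) :
    (G.contractInto {v} a).Adj x y ↔
      G.Adj x y ∨ ((x : V) = a ∧ (y : V) = b) ∨ ((x : V) = b ∧ (y : V) = a) := by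
  constructor
  · rintro ⟨hne, h | ⟨hx, s, rfl, h⟩ | ⟨hy, s, rfl, h⟩⟩
    · exact Or.inl h
    · rcases (hN _).1 h with hy | hy
      · exact absurd (Subtype.ext (hx.trans hy.symm)) hne
      · exact Or.inr (Or.inl ⟨hx, hy⟩)
    · rcases (hN _).1 h with hx | hx
      · exact absurd (Subtype.ext (hx.trans hy.symm)) hne
      · exact Or.inr (Or.inr ⟨hx, hy⟩)
  · rintro (h | ⟨hx, hy⟩ | ⟨hx, hy⟩)
    · exact ⟨fun h' => h.ne (Subtype.ext_iff.1 h'), Or.inl h⟩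
    · exact ⟨fun h' => hab (by rw [← hx, ← hy, h']), Or.inr (Or.inl ⟨hx, v, rfl,
        (hN _).2 (Or.inr hy)⟩)⟩
    · exact ⟨fun h' => hab (by rw [← hx, ← hy, h']), Or.inr (Or.inr ⟨hy, v, rfl,
        (hN _).2 (Or.inr hx)⟩)⟩

theorem connectedOn_contractInto (hN : ∀ x, G.Adj v x ↔ x = a ∨ x = b)
    (hab : a ≠ b) {S : Set V} (hS : G.ConnectedOn S)
    (hne : (S \ {v}).Nonempty) :
    (G.contractInto {v} a).ConnectedOn (Subtype.val ⁻¹' S) := by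
  have hva : v ≠ a := ((hN a).2 (Or.inl rfl)).ne
  have hvb : v ≠ b := ((hN b).2 (Or.inr rfl)).ne
  refine ⟨?_, fun T hT hTne => hT.1.antisymm ?_⟩
  · obtain ⟨x, hx, hxv⟩ := hne
    exact ⟨⟨x, hxv⟩, hx⟩
  have hTab : ∀ x ∈ T, ((x : V) = a ∨ (x : V) = b) → ∀ y : ↥(({v} : Set V)ᶜ),
      ((y : V) = a ∨ (y : V) = b) → (y : V) ∈ S → y ∈ T := by
    intro x hx hxab y hyab hyS
    by_cases hxy : x = y
    · exact hxy ▸ hx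
    · refine hT.2 x hx y hyS ((contractInto_adj_iff hN hab).2 (Or.inr ?_))
      have hxy' : (x : V) ≠ y := fun h => hxy (Subtype.ext h)
      rcases hxab with h1 | h1 <;> rcases hyab with h2 | h2
      · exact absurd (h1.trans h2.symm) hxy'
      · exact Or.inl ⟨h1, h2⟩
      · exact Or.inr ⟨h1, h2⟩
      · exact absurd (h1.trans h2.symm) hxy'
  -- A closed set of the contracted graph is lifted by adding `v` exactly when it contains `a` or
  -- `b`.
  have hcl : G.ClosedIn S (S ∩ {x | (∃ h, (⟨x, h⟩ : ↥(({v} : Set V)ᶜ)) ∈ T) ∨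
      (x = v ∧ ∃ t ∈ T, (t : V) = a ∨ (t : V) = b)}) := by
    refine ⟨Set.inter_subset_left, ?_⟩
    rintro x ⟨hxS, ⟨hxv, hxT⟩ | ⟨rfl, t, ht, htab⟩⟩ y hy hxy
    · refine ⟨hy, ?_⟩
      by_cases hyv : y = v
      · subst hyv
        exact Or.inr ⟨rfl, ⟨x, hxv⟩, hxT, (hN x).1 hxy.symm⟩
      · exact Or.inl ⟨hyv, hT.2 ⟨x, hxv⟩ hxT ⟨y, hyv⟩ hy
          ((contractInto_adj_iff hN hab).2 (Or.inl hxy))⟩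
    · exact ⟨hy, Or.inl ⟨hxy.ne', hTab t ht htab ⟨y, hxy.ne'⟩ ((hN y).1 hxy) hy⟩⟩
  have := hS.2 _ hcl (by
    obtain ⟨t, ht⟩ := hTne
    exact ⟨t, hT.1 ht, Or.inl ⟨t.2, ht⟩⟩)
  rintro ⟨x, hxv⟩ hx
  rcases (this.symm.subset hx).2 with ⟨_, h⟩ | ⟨h, -⟩
  · exact h
  · exact absurd h hxv

theorem IsTwoConnected.contractInto_isTwoConnected [Fintype V] [Fintype ↥(({v} : Set V)ᶜ)]
    (hG : G.IsTwoConnected) (hN : ∀ x, G.Adj v x ↔ x = a ∨ x = b) (hab : a ≠ b)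
    (hcard : 4 ≤ Fintype.card V) :
    (G.contractInto {v} a).IsTwoConnected := by
  rw [isTwoConnected_iff]
  have hva : v ≠ a := ((hN a).2 (Or.inl rfl)).ne
  have hvb : v ≠ b := ((hN b).2 (Or.inr rfl)).ne
  refine ⟨?_, ?_, fun x => ?_⟩
  · have h1 : (({v} : Set V)ᶜ).ncard + ({v} : Set V).ncard = Nat.card V := by
      rw [add_comm, Set.ncard_add_ncard_compl]
    rw [Set.ncard_singleton, Nat.card_eq_fintype_card, ← Nat.card_coe_set_eq,
      Nat.card_eq_fintype_card] at h1
    omega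
  · have := connectedOn_contractInto hN hab hG.connectedOn_univ ⟨a, trivial, hva.symm⟩
    simpa using this
  · have hab' : a ≠ x ∨ b ≠ x := by
      by_contra! h
      exact hab (h.1.trans h.2.symm)
    have := connectedOn_contractInto hN hab (hG.connectedOn_compl x)
      (hab'.elim (fun h => ⟨a, h, hva.symm⟩) (fun h => ⟨b, h, hvb.symm⟩))
    convert this using 1
    ext y
    simp [Subtype.ext_iff]

/-- As `{x, y} ≠ {a, b}`, a neighbour of `v` survives the deletion of `x` and `y`. So `v` is never a
component by itself: its colour is that of a surviving neighbour, and `v` can be dropped from a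
colouring or restored to it. If both `a` and `b` survive, their colours agree, through `v` before
the contraction and through the edge `ab` after it. -/
theorem cellCompletion_contractInto_adj_iff [Finite V]
    (hN : ∀ x, G.Adj v x ↔ x = a ∨ x = b) (hab : a ≠ b) {x y : ↥(({v} : Set V)ᶜ)}
    (hxy : ({(x : V), (y : V)} : Set V) ≠ {a, b}) :
    G.cellCompletion.Adj x y ↔ (G.contractInto {v} a).cellCompletion.Adj x y := by
  classical
  by_cases hxyne : x = y
  · subst hxyne
    simp
  have hva : v ≠ a := ((hN a).2 (Or.inl rfl)).ne
  have hvb : v ≠ b := ((hN b).2 (Or.inr rfl)).ne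
  have hx := x.2
  have hy := y.2
  have hvxy : v ∈ ({(x : V), (y : V)} : Set V)ᶜ := by
    rintro (h | h)
    exacts [x.2 h.symm, y.2 h.symm]
  have hmem : ∀ z : ↥(({v} : Set V)ᶜ), z ∈ ({x, y} : Set _)ᶜ ↔
      (z : V) ∈ ({(x : V), (y : V)} : Set V)ᶜ := by
    intro z
    simp [Subtype.ext_iff]
  have hab' : a ∈ ({(x : V), (y : V)} : Set V)ᶜ ∨ b ∈ ({(x : V), (y : V)} : Set V)ᶜ := by
    by_contra! h
    simp only [Set.mem_compl_iff, not_not] at h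
    apply hxy
    rcases h with ⟨h1 | h1, h2 | h2⟩
    · exact absurd (h1.trans h2.symm) hab
    · rw [h1, h2]
    · rw [h1, h2]; exact Set.pair_comm _ _
    · exact absurd (h1.trans h2.symm) hab
  rw [cellCompletion_adj, cellCompletion_adj, contractInto_adj_iff hN hab]
  have hne : (x : V) ≠ y := fun h => hxyne (Subtype.ext h)
  have hnab : ¬ (((x : V) = a ∧ (y : V) = b) ∨ ((x : V) = b ∧ (y : V) = a)) := by
    rintro (⟨h1, h2⟩ | ⟨h1, h2⟩)
    · exact hxy (by rw [h1, h2])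
    · exact hxy (by rw [h1, h2]; exact Set.pair_comm _ _)
  simp only [hnab, or_false, ne_eq, hne, hxyne, not_false_eq_true, true_and]
  refine or_congr_right ⟨?_, ?_⟩
  · rintro ⟨f, hf, hsurj⟩
    have hfab : a ∈ ({(x : V), (y : V)} : Set V)ᶜ → b ∈ ({(x : V), (y : V)} : Set V)ᶜ →
        f a = f b := fun h1 h2 =>
      (hf v hvxy a h1 ((hN a).2 (Or.inl rfl))).symm.trans (hf v hvxy b h2 ((hN b).2 (Or.inr rfl)))
    refine ⟨fun z => f z, fun p hp q hq hpq => ?_, fun i => ?_⟩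
    · rw [hmem] at hp hq
      rcases (contractInto_adj_iff hN hab).1 hpq with h | ⟨h1, h2⟩ | ⟨h1, h2⟩
      · exact hf _ hp _ hq h
      · beta_reduce; rw [h1, h2]; exact hfab (h1 ▸ hp) (h2 ▸ hq)
      · beta_reduce; rw [h1, h2]; exact (hfab (h2 ▸ hq) (h1 ▸ hp)).symm
    · obtain ⟨z, hz, hzi⟩ := hsurj i
      by_cases hzv : z = v
      · subst hzv
        rcases hab' with h | h
        · exact ⟨⟨a, hva.symm⟩, (hmem _).2 h,
            (hf z hz a h ((hN a).2 (Or.inl rfl))).symm.trans hzi⟩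
        · exact ⟨⟨b, hvb.symm⟩, (hmem _).2 h,
            (hf z hz b h ((hN b).2 (Or.inr rfl))).symm.trans hzi⟩
      · exact ⟨⟨z, hzv⟩, (hmem _).2 hz, hzi⟩
  · rintro ⟨f, hf, hsurj⟩
    have hfab : a ∈ ({(x : V), (y : V)} : Set V)ᶜ → b ∈ ({(x : V), (y : V)} : Set V)ᶜ →
        f ⟨a, hva.symm⟩ = f ⟨b, hvb.symm⟩ := fun h1 h2 =>
      hf _ ((hmem _).2 h1) _ ((hmem _).2 h2)
        ((contractInto_adj_iff hN hab).2 (Or.inr (Or.inl ⟨rfl, rfl⟩)))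
    let g : V → Fin 3 := fun z => if h : z ≠ v then f ⟨z, h⟩ else
      if a ∈ ({(x : V), (y : V)} : Set V)ᶜ then f ⟨a, hva.symm⟩ else f ⟨b, hvb.symm⟩
    have hgne : ∀ z (h : z ≠ v), g z = f ⟨z, h⟩ := fun z h => dif_pos h
    have hgv : ∀ q ∈ ({(x : V), (y : V)} : Set V)ᶜ, G.Adj v q → g v = g q := by
      intro q hq hvq
      rw [hgne q hvq.ne']
      have h1 : g v = if a ∈ ({(x : V), (y : V)} : Set V)ᶜ then f ⟨a, hva.symm⟩ else
        f ⟨b, hvb.symm⟩ := dif_neg (fun h => h rfl)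
      rw [h1]
      rcases (hN q).1 hvq with rfl | rfl
      · rw [if_pos hq]
      · split_ifs with h
        · exact hfab h hq
        · rfl
    refine ⟨g, fun p hp q hq hpq => ?_, fun i => ?_⟩
    · by_cases hpv : p = v
      · subst hpv
        exact hgv q hq hpq
      · by_cases hqv : q = v
        · subst hqv
          exact (hgv p hp hpq.symm).symm
        · rw [hgne p hpv, hgne q hqv]
          exact hf _ ((hmem _).2 hp) _ ((hmem _).2 hq)
            ((contractInto_adj_iff hN hab).2 (Or.inl hpq))
    · obtain ⟨z, hz, hzi⟩ := hsurj i
      exact ⟨z, (hmem z).1 hz, (hgne z z.2).trans hzi⟩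

/-- If `G - {v, y}` had three colour classes, one of them would avoid both neighbours of `v`, and
`y` alone would separate it from `v`. -/
theorem IsTwoConnected.cellCompletion_adj_degree_two [Fintype V] (hG : G.IsTwoConnected)
    (hN : ∀ x, G.Adj v x ↔ x = a ∨ x = b) (y : V) :
    G.cellCompletion.Adj v y ↔ y = a ∨ y = b := by
  rw [← hN, cellCompletion_adj, or_iff_left_iff_imp]
  rintro ⟨hvy, f, hf, hsurj⟩
  exfalso
  obtain ⟨i, hia, hib⟩ : ∃ i : Fin 3, i ≠ f a ∧ i ≠ f b := by
    generalize f a = p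
    generalize f b = q
    revert p q
    decide
  obtain ⟨z, hz, rfl⟩ := hsurj i
  have hz' : z ≠ v ∧ z ≠ y := by simpa using hz
  have := (hG.connectedOn_compl y).2 {x | x ∈ ({v, y} : Set V)ᶜ ∧ f x = f z}
    ⟨fun x hx h => hx.1 (Or.inr h), ?_⟩ ⟨z, hz, rfl⟩
  · have hv : v ∈ ({y} : Set V)ᶜ := hvy
    rw [← this] at hv
    exact hv.1 (Or.inl rfl)
  · rintro p ⟨hp, hpz⟩ q hq hpq
    have hqv : q ≠ v := by
      rintro rfl
      rcases (hN p).1 hpq.symm with rfl | rfl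
      exacts [hia hpz.symm, hib hpz.symm]
    have hq' : q ∈ ({v, y} : Set V)ᶜ := by
      rintro (h | h)
      exacts [hqv h, hq h]
    exact ⟨hq', (hf p hp q hq' hpq).symm.trans hpz⟩

/-- The vertex `v` is a component of `G - {a, b}`. If the rest fell into two parts, there would be
three components and the completion would contain `ab`. -/
theorem connectedOn_of_not_cellCompletion_adj [Finite V]
    (hN : ∀ x, G.Adj v x ↔ x = a ∨ x = b) (hab : a ≠ b)
    (h : ¬ G.cellCompletion.Adj a b) (hne : (({v} : Set V)ᶜ \ {a, b}).Nonempty) :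
    G.ConnectedOn (({v} : Set V)ᶜ \ {a, b}) := by
  classical
  have hva : v ≠ a := ((hN a).2 (Or.inl rfl)).ne
  have hvb : v ≠ b := ((hN b).2 (Or.inr rfl)).ne
  refine ⟨hne, fun T hT hTne => hT.1.antisymm ?_⟩
  by_contra hcon
  obtain ⟨w, hw, hwT⟩ := Set.not_subset.1 hcon
  obtain ⟨t, ht⟩ := hTne
  have hvT : v ∉ T := fun h => (hT.1 h).1 rfl
  have hnv : ∀ x ∈ ({a, b} : Set V)ᶜ, ¬ G.Adj v x := fun x hx h => hx ((hN x).1 h)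
  refine h (cellCompletion_adj.2 (Or.inr ⟨hab, fun x => if x = v then 0 else if x ∈ T then 1 else 2,
    fun x hx y hy hxy => ?_, fun i => ?_⟩))
  · have hxv : x ≠ v := by
      rintro rfl
      exact hnv y hy hxy
    have hyv : y ≠ v := by
      rintro rfl
      exact hnv x hx hxy.symm
    have : x ∈ T ↔ y ∈ T :=
      ⟨fun h => hT.2 x h y ⟨hyv, hy⟩ hxy, fun h => hT.2 y h x ⟨hxv, hx⟩ hxy.symm⟩
    simp [hxv, hyv, this]
  · fin_cases i
    · refine ⟨v, ?_, by simp⟩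
      rintro (h | h)
      exacts [hva h, hvb h]
    · exact ⟨t, (hT.1 ht).2, by
        have : t ≠ v := (hT.1 ht).1
        simp [this, ht]⟩
    · exact ⟨w, hw.2, by
        have : w ≠ v := hw.1
        simp [this, hwT]⟩

/-- Induction by suppressing a vertex `v` of degree two with neighbours `a`, `b`. The smaller
completion contains `ab` and agrees with the present one on all other pairs. If `ab` is an edge of
the present completion, the triangle `vab` is glued along it. Otherwise `v` subdivides `ab`, which
is allowed because `{a, b}` then does not separate the rest. The remaining graph is a triangle. -/
theorem IsTwoConnected.treeOfCyclesOn_cellCompletion_aux : ∀ (n : ℕ) {V : Type u} [Fintype V]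
    (G : SimpleGraph V), Fintype.card V = n → G.IsTwoConnected →
    ¬ (completeGraph (Fin 4)).IsMinorOf G → G.cellCompletion.TreeOfCyclesOn Set.univ := by
  classical
  intro n
  induction n using Nat.strong_induction_on with
  | _ n ih =>
  intro V _ G hn hG hK
  obtain ⟨v, a, b, hab, hN⟩ := hG.exists_degree_two hK
  have hvadja := (hN a).2 (Or.inl rfl)
  have hvadjb := (hN b).2 (Or.inr rfl)
  have hva : v ≠ a := hvadja.ne
  have hvb : v ≠ b := hvadjb.ne
  have hcard := hG.1
  have hvset : Set.univ = insert v ({v} : Set V)ᶜ := by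
    ext x
    simpa using em (x = v)
  by_cases hrest : (({v} : Set V)ᶜ \ {a, b}).Nonempty
  · have h4 : 4 ≤ Fintype.card V := by
      obtain ⟨w, hwv, hw⟩ := hrest
      have hw' : w ≠ a ∧ w ≠ b := by simpa using hw
      have hwv' : w ≠ v := hwv
      have : ({w, v, a, b} : Finset V).card = 4 := by
        rw [Finset.card_insert_of_notMem (by simp [hwv', hw'.1, hw'.2]),
          Finset.card_insert_of_notMem (by simp [hva, hvb]), Finset.card_pair hab]
      rw [← this]
      exact Finset.card_le_univ _
    set G' := G.contractInto {v} a with hG'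
    have hIH := ih _ (hn ▸ card_compl_lt (S := {v}) ⟨v, rfl⟩) G' rfl
      (hG.contractInto_isTwoConnected hN hab h4)
      (fun h => hK (h.trans (contractInto_isMinorOf (connectedOn_pair hvadja.symm))))
    have hIH' := isTreeOfCycles_iff.2 hIH
    have hadj' : ∀ x y : ↥(({v} : Set V)ᶜ), ({(x : V), (y : V)} : Set V) ≠ {a, b} →
        (G.cellCompletion.Adj x y ↔ G'.cellCompletion.Adj x y) := fun x y =>
      cellCompletion_contractInto_adj_iff hN hab
    have hadjab : ∀ x y : ↥(({v} : Set V)ᶜ), ({(x : V), (y : V)} : Set V) = {a, b} →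
        G'.cellCompletion.Adj x y := by
      intro x y hxy
      refine le_cellCompletion ((contractInto_adj_iff hN hab).2 (Or.inr ?_))
      exact Set.pair_eq_pair_iff.1 hxy
    by_cases habc : G.cellCompletion.Adj a b
    · let φ : G'.cellCompletion ↪g G.cellCompletion :=
        ⟨⟨Subtype.val, Subtype.val_injective⟩, fun {x y} => by
          by_cases hxy : ({(x : V), (y : V)} : Set V) = {a, b}
          · refine iff_of_true ?_ (hadjab x y hxy)
            change G.cellCompletion.Adj x y
            rcases Set.pair_eq_pair_iff.1 hxy with ⟨h1, h2⟩ | ⟨h1, h2⟩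
            · rw [h1, h2]; exact habc
            · rw [h1, h2]; exact habc.symm
          · exact hadj' x y hxy⟩
      have h1 := hIH'.treeOfCyclesOn_range φ
      have hr : Set.range φ = ({v} : Set V)ᶜ := Subtype.range_coe
      rw [hr] at h1
      have h2 := TreeOfCyclesOn.glue _ {v, a, b} a b habc ⟨?_, ?_⟩ h1
        (isInducedCycle_triangle (le_cellCompletion hvadja) (le_cellCompletion hvadjb) habc)
      · convert h2 using 1
        rw [hvset]
        ext x
        simp only [Set.mem_insert_iff, Set.mem_compl_iff, Set.mem_singleton_iff, Set.mem_union]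
        tauto
      · ext x
        simp only [Set.mem_insert_iff, Set.mem_compl_iff, Set.mem_singleton_iff, Set.mem_inter_iff]
        constructor
        · tauto
        · rintro (rfl | rfl)
          exacts [⟨hva.symm, by simp⟩, ⟨hvb.symm, by simp⟩]
      · rintro x hx y (rfl | hy) hxy
        · exact Or.inl (Or.inr ((hG.cellCompletion_adj_degree_two hN x).1 hxy.symm))
        · right
          rcases hy with rfl | rfl
          exacts [hva.symm, hvb.symm]
    · let ι : ↥(({v} : Set V)ᶜ) ↪ V := ⟨Subtype.val, Subtype.val_injective⟩
      -- The smaller completion does not embed in the present one, since only the former contains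
      -- `ab`; it is therefore placed on `V` as a graph of its own.
      have h1 := hIH'.treeOfCyclesOn_range (Embedding.map ι G'.cellCompletion)
      have hr : Set.range (Embedding.map ι G'.cellCompletion) = ({v} : Set V)ᶜ :=
        Subtype.range_coe
      rw [hr] at h1
      have hmap : ∀ x y : ↥(({v} : Set V)ᶜ), (G'.cellCompletion.map ι).Adj x y ↔
          G'.cellCompletion.Adj x y := fun x y => map_adj_apply (f := ι) (a := x) (b := y)
      rw [hvset]
      refine h1.subdivide (a := a) (b := b) hva.symm hvb.symm
        ((hmap ⟨a, hva.symm⟩ ⟨b, hvb.symm⟩).2 (hadjab _ _ rfl)) (fun h => h rfl) ?_ ?_ ?_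
      · refine (connectedOn_of_not_cellCompletion_adj hN hab habc hrest).mono ?_
        intro x hx y hy hxy
        exact (hmap ⟨x, hx.1⟩ ⟨y, hy.1⟩).2
          (le_cellCompletion ((contractInto_adj_iff hN hab).2 (Or.inl hxy)))
      · intro x hx y hy
        rw [hmap ⟨x, hx⟩ ⟨y, hy⟩]
        by_cases hxy : ({x, y} : Set V) = {a, b}
        · refine iff_of_false (fun h => habc ?_) (fun h => h.2 hxy)
          rcases Set.pair_eq_pair_iff.1 hxy with ⟨rfl, rfl⟩ | ⟨rfl, rfl⟩
          exacts [h, h.symm]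
        · rw [← hadj' ⟨x, hx⟩ ⟨y, hy⟩ hxy]
          exact ⟨fun h => ⟨h, hxy⟩, fun h => h.1⟩
      · intro x _
        rw [adj_comm]
        exact hG.cellCompletion_adj_degree_two hN x
  · have hsub : ∀ x, x = v ∨ x = a ∨ x = b := by
      intro x
      by_cases hx : x = v
      · exact Or.inl hx
      · exact Or.inr (by_contra fun h => hrest ⟨x, hx, h⟩)
    have habadj : G.Adj a b := by
      obtain ⟨x, rfl, y, hy, hxy⟩ := (hG.connectedOn_compl v).exists_adj (T := {a})
        (by rintro _ rfl; exact hva.symm) ⟨a, rfl⟩ ⟨b, hvb.symm, hab.symm⟩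
      rcases hsub y with rfl | rfl | rfl
      · exact absurd rfl hy.1
      · exact absurd rfl hxy.ne
      · exact hxy
    have : Set.univ = ({v, a, b} : Set V) := by
      ext x
      simpa using hsub x
    rw [this]
    exact .cycle _ (isInducedCycle_triangle (le_cellCompletion hvadja) (le_cellCompletion hvadjb)
      (le_cellCompletion habadj))

/-- The cell completion of a `2`-connected graph without `K₄` minor is a tree of cycles. -/
theorem IsTwoConnected.treeOfCyclesOn_cellCompletion [Fintype V] (hG : G.IsTwoConnected)
    (hK : ¬ (completeGraph (Fin 4)).IsMinorOf G) : G.cellCompletion.TreeOfCyclesOn Set.univ :=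
  IsTwoConnected.treeOfCyclesOn_cellCompletion_aux _ G rfl hG hK

end CellCompletion

/-! ### Minors from violations of the path-of-cycles conditions -/

section Violations

variable {V : Type u} {G : SimpleGraph V} {a b u v x : V} {C D K L T : Set V}

theorem exists_third_colour (p q : Fin 3) : ∃ i : Fin 3, i ≠ p ∧ i ≠ q := by
  revert p q
  decide

/-- The closed sets off a pair are the same for a `2`-connected graph and its cell completion. -/
theorem IsTwoConnected.closedIn_cellCompletion [Fintype V] (hG : G.IsTwoConnected)
    (hT : G.ClosedIn ({a, b}ᶜ) T) : G.cellCompletion.ClosedIn ({a, b}ᶜ) T := by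
  refine ⟨hT.1, fun x hx y hy hxy => ?_⟩
  rcases cellCompletion_adj.1 hxy with h | ⟨hne, f, hf, hsurj⟩
  · exact hT.2 x hx y hy h
  -- A colour class of `G - {x, y}` avoiding `a` and `b` attaches to both `x` and `y`, so it carries
  -- membership in `T` from `x` to `y` along edges of `G`.
  obtain ⟨i, hia, hib⟩ := exists_third_colour (f a) (f b)
  have hW : G.ClosedIn ({x, y}ᶜ) {z | z ∈ ({x, y} : Set V)ᶜ ∧ f z = i} :=
    ⟨fun z hz => hz.1, fun p hp q hq hpq => ⟨hq, (hf p hp.1 q hq hpq).symm.trans hp.2⟩⟩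
  have hWab : ∀ z, f z = i → z ∈ ({a, b} : Set V)ᶜ := by
    rintro z hz (rfl | rfl)
    exacts [hia hz.symm, hib hz.symm]
  obtain ⟨z, hz⟩ := hsurj i
  obtain ⟨w, hw, hwx⟩ := hG.exists_adj_of_closedIn hne hW ⟨z, hz⟩
  have hWT : G.ClosedIn ({x, y}ᶜ) ({z | z ∈ ({x, y} : Set V)ᶜ ∧ f z = i} ∩ T) := by
    refine ⟨fun z hz => hz.1.1, fun p hp q hq hpq => ?_⟩
    have hq' := hW.2 p hp.1 q hq hpq
    exact ⟨hq', hT.2 p hp.2 q (hWab q hq'.2) hpq⟩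
  obtain ⟨w', hw', hwy⟩ := hG.exists_adj_of_closedIn' hne hWT
    ⟨w, hw, hT.2 x hx w (hWab w hw.2) hwx.symm⟩
  exact hT.2 w' hw'.2 y hy hwy

/-- A component off a pair with at least two vertices contains a path of two vertices joining
the pair. -/
theorem IsTwoConnected.exists_split_of_nontrivial [Fintype V] (hG : G.IsTwoConnected) (huv : u ≠ v)
    (hK : G.ConnectedOn K) (hcl : G.ClosedIn ({u, v}ᶜ) K) (hnt : K.Nontrivial) :
    ∃ P Q : Set V, P ∪ Q = K ∧ Disjoint P Q ∧ G.ConnectedOn P ∧ G.ConnectedOn Q ∧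
      (∃ p ∈ P, G.Adj u p) ∧ (∃ p ∈ P, ∃ q ∈ Q, G.Adj p q) ∧ ∃ q ∈ Q, G.Adj q v := by
  -- Otherwise a single vertex `c` of `K` carries all edges from `K` to `u` and `v`, and it
  -- separates the rest of `K` from `u`.
  obtain ⟨p, hp, q, hq, hpq, hpu, hqv⟩ : ∃ p ∈ K, ∃ q ∈ K, p ≠ q ∧ G.Adj p u ∧ G.Adj q v := by
    by_contra! hcon
    obtain ⟨c, hc, hcu⟩ := hG.exists_adj_of_closedIn huv hcl hK.1
    obtain ⟨d, hd, hdv⟩ := hG.exists_adj_of_closedIn' huv hcl hK.1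
    have hcd : c = d := by_contra fun h => hcon c hc d hd h hcu hdv
    subst hcd
    have := (hG.connectedOn_compl c).2 (K \ {c}) ⟨fun x hx => hx.2, fun x hx y hy hxy => ⟨?_, hy⟩⟩
      (by
        obtain ⟨w, hw, hwc⟩ := hnt.exists_ne c
        exact ⟨w, hw, hwc⟩)
    · have h1 : u ∈ K \ {c} := this.symm.subset hcu.ne'
      exact hcl.1 h1.1 (Or.inl rfl)
    · refine hcl.2 x hx.1 y ?_ hxy
      rintro (rfl | rfl)
      · exact hcon x hx.1 c hc hx.2 hxy hdv
      · exact hcon c hc x hx.1 (fun h => hx.2 h.symm) hcu hxy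
  obtain ⟨P, Q, h1, h2, h3, h4, h5, h6, h7⟩ := hK.exists_split hp hq hpq
  exact ⟨P, Q, h1, h2, h5, h6, ⟨p, h3, hpu.symm⟩, h7, q, h4, hqv⟩

/-- The ends of the three paths are `u` and `v`; each of the three parts splits into two branch
sets, the interior of one path. -/
theorem IsTwoConnected.graphD3_isMinorOf [Fintype V] (hG : G.IsTwoConnected) (huv : u ≠ v)
    {K : Fin 3 → Set V} (hK : ∀ i, G.ConnectedOn (K i)) (hcl : ∀ i, G.ClosedIn ({u, v}ᶜ) (K i))
    (hnt : ∀ i, (K i).Nontrivial) (hdis : ∀ i j, i ≠ j → Disjoint (K i) (K j)) :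
    graphD3.IsMinorOf G := by
  choose P Q hPQ hPQd hP hQ hPu hadj hQv using fun i =>
    hG.exists_split_of_nontrivial huv (hK i) (hcl i) (hnt i)
  have hPK : ∀ i, P i ⊆ K i := fun i => hPQ i ▸ Set.subset_union_left
  have hQK : ∀ i, Q i ⊆ K i := fun i => hPQ i ▸ Set.subset_union_right
  have huK : ∀ i, Disjoint {u} (K i) := fun i => by
    rw [Set.disjoint_singleton_left]
    exact fun h => (hcl i).1 h (Or.inl rfl)
  have hvK : ∀ i, Disjoint {v} (K i) := fun i => by
    rw [Set.disjoint_singleton_left]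
    exact fun h => (hcl i).1 h (Or.inr rfl)
  have huv' : Disjoint ({u} : Set V) {v} := by simpa using huv
  have huP : ∀ i, Disjoint {u} (P i) := fun i => (huK i).mono_right (hPK i)
  have huQ : ∀ i, Disjoint {u} (Q i) := fun i => (huK i).mono_right (hQK i)
  have hvP : ∀ i, Disjoint {v} (P i) := fun i => (hvK i).mono_right (hPK i)
  have hvQ : ∀ i, Disjoint {v} (Q i) := fun i => (hvK i).mono_right (hQK i)
  have hPP : ∀ i j, i ≠ j → Disjoint (P i) (P j) := fun i j h => (hdis i j h).mono (hPK i) (hPK j)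
  have hQQ : ∀ i j, i ≠ j → Disjoint (Q i) (Q j) := fun i j h => (hdis i j h).mono (hQK i) (hQK j)
  have hPQ' : ∀ i j, Disjoint (P i) (Q j) := fun i j => by
    by_cases h : i = j
    · exact h ▸ hPQd i
    · exact (hdis i j h).mono (hPK i) (hQK j)
  have h01 : (0 : Fin 3) ≠ 1 := by decide
  have h02 : (0 : Fin 3) ≠ 2 := by decide
  have h12 : (1 : Fin 3) ≠ 2 := by decide
  rw [isMinorOf_iff]
  refine ⟨![{u}, {v}, P 0, Q 0, P 1, Q 1, P 2, Q 2], fun i => ?_, fun i j hij => ?_,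
    fun i j hij => ?_⟩
  · fin_cases i
    exacts [connectedOn_singleton _, connectedOn_singleton _, hP 0, hQ 0, hP 1, hQ 1, hP 2, hQ 2]
  · fin_cases i <;> fin_cases j <;> first
      | exact absurd rfl hij
      | exact huv' | exact huP _ | exact huQ _ | exact hvP _ | exact hvQ _ | exact hPQ' _ _
      | exact hPP _ _ h01 | exact hPP _ _ h02 | exact hPP _ _ h12
      | exact hQQ _ _ h01 | exact hQQ _ _ h02 | exact hQQ _ _ h12
      | exact huv'.symm | exact (huP _).symm | exact (huQ _).symm | exact (hvP _).symm
      | exact (hvQ _).symm | exact (hPQ' _ _).symm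
      | exact (hPP _ _ h01).symm | exact (hPP _ _ h02).symm | exact (hPP _ _ h12).symm
      | exact (hQQ _ _ h01).symm | exact (hQQ _ _ h02).symm | exact (hQQ _ _ h12).symm
  · have hsymm : ∀ {S T : Set V}, (∃ x ∈ S, ∃ y ∈ T, G.Adj x y) → ∃ x ∈ T, ∃ y ∈ S, G.Adj x y :=
      fun ⟨x, hx, y, hy, h⟩ => ⟨y, hy, x, hx, h.symm⟩
    have h1 : ∀ i, ∃ x ∈ ({u} : Set V), ∃ y ∈ P i, G.Adj x y := fun i => ⟨u, rfl, hPu i⟩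
    have h2 : ∀ i, ∃ x ∈ Q i, ∃ y ∈ ({v} : Set V), G.Adj x y := fun i =>
      let ⟨q, hq, h⟩ := hQv i
      ⟨q, hq, v, rfl, h⟩
    have hij' := (fromEdgeSet_adj _).1 hij
    simp only [Set.mem_insert_iff, Set.mem_singleton_iff, Sym2.eq_iff] at hij'
    rcases hij'.1 with (⟨rfl, rfl⟩ | ⟨rfl, rfl⟩) | (⟨rfl, rfl⟩ | ⟨rfl, rfl⟩) |
      (⟨rfl, rfl⟩ | ⟨rfl, rfl⟩) | (⟨rfl, rfl⟩ | ⟨rfl, rfl⟩) | (⟨rfl, rfl⟩ | ⟨rfl, rfl⟩) |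
      (⟨rfl, rfl⟩ | ⟨rfl, rfl⟩) | (⟨rfl, rfl⟩ | ⟨rfl, rfl⟩) | (⟨rfl, rfl⟩ | ⟨rfl, rfl⟩) |
      (⟨rfl, rfl⟩ | ⟨rfl, rfl⟩) <;> first
      | exact h1 _ | exact h2 _ | exact hadj _
      | exact hsymm (h1 _) | exact hsymm (h2 _) | exact hsymm (hadj _)

/-- An induced cycle of the cell completion through `uv` is, off `u` and `v`, in one component. -/
theorem IsTwoConnected.diff_subset_of_closedIn [Fintype V] (hG : G.IsTwoConnected)
    (hC : G.cellCompletion.IsInducedCycle C) (huv : G.cellCompletion.Adj u v)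
    (hK : G.ClosedIn ({u, v}ᶜ) K) (hx : x ∈ C \ {u, v}) (hxK : x ∈ K) : C \ {u, v} ⊆ K :=
  (hC.connectedOn_diff_edge huv).subset_of_closedIn (hG.closedIn_cellCompletion hK)
    (fun _ h => h.2) ⟨x, hx, hxK⟩

theorem pair_eq_of_mem {α : Type*} {u v c d : α} (hu : u = c ∨ u = d) (hv : v = c ∨ v = d) (huv : u ≠ v) :
    ({c, d} : Set α) = {u, v} := by
  rcases hu with rfl | rfl <;> rcases hv with rfl | rfl
  · exact absurd rfl huv
  · rfl
  · exact Set.pair_comm _ _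
  · exact absurd rfl huv

/-- Two cycles are separated by some edge `cd`. Both contain `u` and `v`, so `{c, d} = {u, v}`, and
off this pair the cycles lie in different components. -/
theorem TreeOfCyclesOn.disjoint_compIn (hH : G.cellCompletion.TreeOfCyclesOn Set.univ)
    (hC : G.cellCompletion.IsInducedCycle C) (hD : G.cellCompletion.IsInducedCycle D)
    (hCD : C ≠ D) (huv : G.cellCompletion.Adj u v) (huC : u ∈ C) (hvC : v ∈ C) (huD : u ∈ D)
    (hvD : v ∈ D) {y : V} (hx : x ∈ C \ {u, v}) (hy : y ∈ D \ {u, v}) :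
    Disjoint (G.compIn ({u, v}ᶜ) x) (G.compIn ({u, v}ᶜ) y) := by
  obtain ⟨P, Q, c, d, hcd, hPQ, hs, hCP, hDQ⟩ := hH.exists_pairSeparates C D hCD
    (Set.subset_univ _) (Set.subset_univ _) hC hD
  have hpair := pair_eq_of_mem (hs.eq_or_eq (hCP huC) (hDQ huD))
    (hs.eq_or_eq (hCP hvC) (hDQ hvD)) huv.ne
  have key : ∀ {P Q : Set V}, P ∪ Q = Set.univ → G.cellCompletion.PairSeparates P Q c d →
      G.ClosedIn ({u, v}ᶜ) (P \ {u, v}) := by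
    intro P Q hPQ hs
    have := hs.closedIn
    rw [hpair, hPQ, ← Set.compl_eq_univ_sdiff] at this
    exact ⟨this.1, fun x hx y hy hxy => this.2 x hx y hy (le_cellCompletion hxy)⟩
  have h1 := compIn_subset_of_closedIn (key hPQ hs) ⟨hCP hx.1, hx.2⟩
  have h2 := compIn_subset_of_closedIn (key ((Set.union_comm _ _).trans hPQ) hs.symm)
    ⟨hDQ hy.1, hy.2⟩
  rw [Set.disjoint_left]
  intro z hz1 hz2
  have : z ∈ ({u, v} : Set V) := by
    rw [← hpair]
    exact hs.eq_or_eq (h1 hz1).1 (h2 hz2).1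
  exact (h1 hz1).2 this

/-- Off `u` and `v` the cycle stays in one component. If this is `{x}`, then `x` has no neighbours
but `u` and `v`, even in the completion. -/
theorem IsTwoConnected.isSimplicialTriangle [Fintype V] (hG : G.IsTwoConnected) {C : Finset V}
    (hC : G.cellCompletion.IsInducedCycle (C : Set V)) (huv : G.cellCompletion.Adj u v)
    (hu : u ∈ C) (hv : v ∈ C) (hx : x ∈ (C : Set V) \ {u, v})
    (hs : (G.compIn ({u, v}ᶜ) x).Subsingleton) : G.cellCompletion.IsSimplicialTriangle C := by
  classical
  have hxuv : x ∈ ({u, v} : Set V)ᶜ := hx.2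
  have hcl := closedIn_compIn (G := G) hxuv
  have hsub := hG.diff_subset_of_closedIn hC huv hcl hx mem_compIn
  have hCx : ∀ y ∈ C, y = u ∨ y = v ∨ y = x := by
    intro y hy
    by_cases hyuv : y ∈ ({u, v} : Set V)
    · rcases hyuv with h | h
      exacts [Or.inl h, Or.inr (Or.inl h)]
    · exact Or.inr (Or.inr (hs (hsub ⟨hy, hyuv⟩) mem_compIn))
  have hN : ∀ y, G.cellCompletion.Adj x y → y = u ∨ y = v := by
    intro y hxy
    by_contra hyuv
    exact hxy.ne (hs mem_compIn
      ((hG.closedIn_cellCompletion hcl).2 x mem_compIn y hyuv hxy))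
  obtain ⟨p, hp, q, hq, hpq, hxp, hxq, -⟩ := hC.exists_neighbors hx.1
  have hadj : G.cellCompletion.Adj x u ∧ G.cellCompletion.Adj x v := by
    rcases hN p hxp with rfl | rfl <;> rcases hN q hxq with rfl | rfl
    · exact absurd rfl hpq
    · exact ⟨hxp, hxq⟩
    · exact ⟨hxq, hxp⟩
    · exact absurd rfl hpq
  refine ⟨?_, x, hx.1, ?_⟩
  · rw [is3Clique_iff]
    refine ⟨u, v, x, huv, hadj.1.symm, hadj.2.symm, ?_⟩
    ext y
    simp only [Finset.mem_insert, Finset.mem_singleton]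
    refine ⟨hCx y, ?_⟩
    rintro (rfl | rfl | rfl)
    exacts [hu, hv, hx.1]
  · intro y hy z hz hyz
    rcases hN y hy with rfl | rfl <;> rcases hN z hz with rfl | rfl
    · exact absurd rfl hyz
    · exact huv
    · exact huv.symm
    · exact absurd rfl hyz

/-- Three cycles through `uv` that are not simplicial triangles yield three components of `G - {u,
v}`, each with at least two vertices, hence a `D₃` minor. -/
theorem IsTwoConnected.ncard_le_of_not_graphD3 [Fintype V] (hG : G.IsTwoConnected)
    (hH : G.cellCompletion.TreeOfCyclesOn Set.univ) (hD : ¬ graphD3.IsMinorOf G)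
    {e : Sym2 V} (he : e ∈ G.cellCompletion.edgeSet) :
    (G.cellCompletion.chordlessCyclesThrough e).ncard - 2 ≤
      {C ∈ G.cellCompletion.chordlessCyclesThrough e |
        G.cellCompletion.IsSimplicialTriangle C}.ncard := by
  classical
  induction e with
  | _ u v =>
  by_contra! hlt
  set S := G.cellCompletion.chordlessCyclesThrough s(u, v)
  have huv : G.cellCompletion.Adj u v := he
  have h3 : 3 ≤ (S \ {C ∈ S | G.cellCompletion.IsSimplicialTriangle C}).ncard := by
    rw [Set.ncard_sdiff (Set.sep_subset _ _) (Set.toFinite _)]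
    omega
  obtain ⟨C₁, h1, C₂, h2, C₃, h3, h12, h13, h23⟩ := exists_three_of_three_le_ncard h3
  let C : Fin 3 → Finset V := ![C₁, C₂, C₃]
  have hC : ∀ i, C i ∈ S \ {C ∈ S | G.cellCompletion.IsSimplicialTriangle C} := by
    intro i
    fin_cases i
    exacts [h1, h2, h3]
  have hCne : ∀ i j, i ≠ j → (C i : Set V) ≠ C j := by
    intro i j hij h
    have h := Finset.coe_injective h
    fin_cases i <;> fin_cases j <;> first
      | exact hij rfl | exact h12 h | exact h13 h | exact h23 h
      | exact h12 h.symm | exact h13 h.symm | exact h23 h.symm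
  have hcyc : ∀ i, G.cellCompletion.IsInducedCycle (C i : Set V) := fun i => (hC i).1.1
  have hu : ∀ i, u ∈ C i := fun i => (hC i).1.2 u (Sym2.mem_mk_left _ _)
  have hv : ∀ i, v ∈ C i := fun i => (hC i).1.2 v (Sym2.mem_mk_right _ _)
  choose x hx using fun i => ((hcyc i).connectedOn_diff_edge huv).1
  refine hD (hG.graphD3_isMinorOf huv.ne (K := fun i => G.compIn ({u, v}ᶜ) (x i))
    (fun i => connectedOn_compIn (hx i).2) (fun i => closedIn_compIn (hx i).2) (fun i => ?_)
    (fun i j hij => hH.disjoint_compIn (hcyc i) (hcyc j) (hCne i j hij) huv (hu i) (hv i) (hu j)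
      (hv j) (hx i) (hx j)))
  by_contra hnt
  exact (hC i).2 ⟨(hC i).1, hG.isSimplicialTriangle (hcyc i) huv (hu i) (hv i) (hx i)
    (Set.not_nontrivial_iff.1 hnt)⟩

end Violations

/-! ### Three edge separators on one chordless cycle and the `3`-sun -/

section Sun

variable {V : Type u} {G : SimpleGraph V} {a b u v x : V} {C D K L T : Set V}

/-- `A`, `B`, `C` form the triangle, at the odd places of the hexagon; `K`, `L`, `M` are the ears.
-/
theorem graphS3_isMinorOf {A B C K L M : Set V} (hA : G.ConnectedOn A) (hB : G.ConnectedOn B)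
    (hC : G.ConnectedOn C) (hK : G.ConnectedOn K) (hL : G.ConnectedOn L) (hM : G.ConnectedOn M)
    (dAB : Disjoint A B) (dAC : Disjoint A C) (dBC : Disjoint B C)
    (dKA : Disjoint K A) (dKB : Disjoint K B) (dKC : Disjoint K C)
    (dLA : Disjoint L A) (dLB : Disjoint L B) (dLC : Disjoint L C)
    (dMA : Disjoint M A) (dMB : Disjoint M B) (dMC : Disjoint M C)
    (dKL : Disjoint K L) (dKM : Disjoint K M) (dLM : Disjoint L M)
    (hAB : ∃ x ∈ A, ∃ y ∈ B, G.Adj x y) (hBC : ∃ x ∈ B, ∃ y ∈ C, G.Adj x y)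
    (hCA : ∃ x ∈ C, ∃ y ∈ A, G.Adj x y) (hKA : ∃ x ∈ K, ∃ y ∈ A, G.Adj x y)
    (hKB : ∃ x ∈ K, ∃ y ∈ B, G.Adj x y) (hLB : ∃ x ∈ L, ∃ y ∈ B, G.Adj x y)
    (hLC : ∃ x ∈ L, ∃ y ∈ C, G.Adj x y) (hMC : ∃ x ∈ M, ∃ y ∈ C, G.Adj x y)
    (hMA : ∃ x ∈ M, ∃ y ∈ A, G.Adj x y) : graphS3.IsMinorOf G := by
  rw [isMinorOf_iff]
  refine ⟨![M, A, K, B, L, C], fun i => ?_, fun i j hij => ?_, fun i j hij => ?_⟩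
  · fin_cases i <;> assumption
  · fin_cases i <;> fin_cases j <;> first
      | exact absurd rfl hij | assumption | (refine Disjoint.symm ?_; assumption)
  · have hsymm : ∀ {S T : Set V}, (∃ x ∈ S, ∃ y ∈ T, G.Adj x y) → ∃ x ∈ T, ∃ y ∈ S, G.Adj x y :=
      fun ⟨x, hx, y, hy, h⟩ => ⟨y, hy, x, hx, h.symm⟩
    have hij' := (fromEdgeSet_adj _).1 hij
    simp only [Set.mem_insert_iff, Set.mem_singleton_iff, Sym2.eq_iff] at hij'
    rcases hij'.1 with (⟨rfl, rfl⟩ | ⟨rfl, rfl⟩) | (⟨rfl, rfl⟩ | ⟨rfl, rfl⟩) |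
      (⟨rfl, rfl⟩ | ⟨rfl, rfl⟩) | (⟨rfl, rfl⟩ | ⟨rfl, rfl⟩) | (⟨rfl, rfl⟩ | ⟨rfl, rfl⟩) |
      (⟨rfl, rfl⟩ | ⟨rfl, rfl⟩) | (⟨rfl, rfl⟩ | ⟨rfl, rfl⟩) | (⟨rfl, rfl⟩ | ⟨rfl, rfl⟩) |
      (⟨rfl, rfl⟩ | ⟨rfl, rfl⟩) <;> first
      | assumption | (refine hsymm ?_; assumption)

/-- `K` is empty or a component of `G - {a, b}`, and it avoids `C`. -/
structure IsFlap (G : SimpleGraph V) (C : Set V) (a b : V) (K : Set V) : Prop where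
  disjoint : Disjoint K C
  closedIn : G.ClosedIn ({a, b}ᶜ) K
  connectedOn : K.Nonempty → G.ConnectedOn K

theorem isFlap_empty : G.IsFlap C a b ∅ :=
  ⟨Set.empty_disjoint _, ⟨Set.empty_subset _, fun _ h => h.elim⟩, fun h => absurd rfl h.ne_empty⟩

theorem IsFlap.subset (hK : G.IsFlap C a b K) {a' b' : V} (hL : G.IsFlap C a' b' L)
    (ha : a ∈ C) (hb : b ∈ C) (h : (L ∩ K).Nonempty) : L ⊆ K := by
  refine (hL.connectedOn (h.mono Set.inter_subset_left)).subset_of_closedIn hK.closedIn ?_ h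
  rintro x hx (rfl | rfl)
  exacts [hL.disjoint.le_bot ⟨hx, ha⟩, hL.disjoint.le_bot ⟨hx, hb⟩]

/-- Flaps that meet coincide. A nonempty flap at `ab` attaches to both `a` and `b`, while its
neighbours on `C` lie in the pair of the other edge, so the two pairs agree. -/
theorem IsTwoConnected.disjoint_of_isFlap [Fintype V] (hG : G.IsTwoConnected) {a' b' : V}
    (hK : G.IsFlap C a b K) (hL : G.IsFlap C a' b' L) (ha : a ∈ C) (hb : b ∈ C) (ha' : a' ∈ C)
    (hb' : b' ∈ C) (hab : a ≠ b) (hne : ({a, b} : Set V) ≠ {a', b'}) : Disjoint K L := by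
  rw [Set.disjoint_iff_inter_eq_empty, ← Set.not_nonempty_iff_eq_empty]
  intro h
  have h1 := hL.subset hK ha' hb' h
  have h2 := hK.subset hL ha hb (by rwa [Set.inter_comm])
  obtain rfl := h1.antisymm h2
  have hKne : K.Nonempty := h.mono Set.inter_subset_left
  obtain ⟨x, hx, hxa⟩ := hG.exists_adj_of_closedIn hab hK.closedIn hKne
  obtain ⟨y, hy, hyb⟩ := hG.exists_adj_of_closedIn' hab hK.closedIn hKne
  have key : ∀ z ∈ C, ∀ x ∈ K, G.Adj x z → z = a' ∨ z = b' := by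
    intro z hz x hx hxz
    by_contra hcon
    exact hK.disjoint.le_bot ⟨hL.closedIn.2 x hx z hcon hxz, hz⟩
  exact hne (pair_eq_of_mem (key a ha x hx hxa) (key b hb y hy hyb) hab).symm

/-- The flaps at an edge of an induced cycle of the cell completion: one that exists if the edge
lies in a second induced cycle, and a further one that exists if the edge is new. -/
theorem IsTwoConnected.exists_flaps [Fintype V] (hG : G.IsTwoConnected)
    (hH : G.cellCompletion.TreeOfCyclesOn Set.univ) (hC : G.cellCompletion.IsInducedCycle C)
    (hab : G.cellCompletion.Adj a b) (ha : a ∈ C) (hb : b ∈ C) :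
    ∃ K L : Set V, G.IsFlap C a b K ∧ G.IsFlap C a b L ∧ Disjoint K L ∧
      ((∃ D, D ≠ C ∧ G.cellCompletion.IsInducedCycle D ∧ a ∈ D ∧ b ∈ D) → K.Nonempty) ∧
      (¬ G.Adj a b → L.Nonempty) := by
  obtain ⟨z, hz⟩ := (hC.connectedOn_diff_edge hab).1
  have hdisj : ∀ K, G.ClosedIn ({a, b}ᶜ) K → z ∉ K → Disjoint K C := by
    intro K hK hzK
    rw [Set.disjoint_left]
    intro y hyK hyC
    exact hzK (hG.diff_subset_of_closedIn hC hab hK ⟨hyC, hK.1 hyK⟩ hyK hz)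
  obtain ⟨K, hK, hKne⟩ : ∃ K, G.IsFlap C a b K ∧
      ((∃ D, D ≠ C ∧ G.cellCompletion.IsInducedCycle D ∧ a ∈ D ∧ b ∈ D) → K.Nonempty) := by
    by_cases hD : ∃ D, D ≠ C ∧ G.cellCompletion.IsInducedCycle D ∧ a ∈ D ∧ b ∈ D
    · obtain ⟨D, hDC, hD, haD, hbD⟩ := hD
      obtain ⟨y, hy⟩ := (hD.connectedOn_diff_edge hab).1
      have hd := hH.disjoint_compIn hD hC hDC hab haD hbD ha hb hy hz
      have hcl := closedIn_compIn (G := G) (S := {a, b}ᶜ) hy.2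
      exact ⟨G.compIn ({a, b}ᶜ) y, ⟨hdisj _ hcl fun h => hd.le_bot ⟨h, mem_compIn⟩, hcl,
        fun _ => connectedOn_compIn hy.2⟩, fun _ => ⟨y, mem_compIn⟩⟩
    · exact ⟨∅, isFlap_empty, fun h => absurd h hD⟩
  by_cases hGab : G.Adj a b
  · exact ⟨K, ∅, hK, isFlap_empty, Set.disjoint_empty _, hKne, fun h => absurd hGab h⟩
  obtain ⟨-, f, hf, hsurj⟩ := (cellCompletion_adj.1 hab).resolve_left hGab
  have hlevel : ∀ i, G.ClosedIn ({a, b}ᶜ) {x | x ∈ ({a, b} : Set V)ᶜ ∧ f x = i} := fun i =>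
    ⟨fun x hx => hx.1, fun x hx y hy hxy => ⟨hy, (hf x hx.1 y hy hxy).symm.trans hx.2⟩⟩
  -- `K` has one colour (`0` by convention if it is empty). Some colour differs from it and from the
  -- colour of `z` on the cycle, and a component of that colour is the second flap.
  obtain ⟨j, hj⟩ : ∃ j, ∀ x ∈ K, f x = j := by
    by_cases hKne : K.Nonempty
    · obtain ⟨k, hk⟩ := hKne
      exact ⟨f k, fun x hx => (((hK.connectedOn ⟨k, hk⟩).subset_of_closedIn (hlevel (f k))
        hK.closedIn.1 ⟨k, hk, hK.closedIn.1 hk, rfl⟩) hx).2⟩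
    · exact ⟨0, fun x hx => absurd ⟨x, hx⟩ hKne⟩
  obtain ⟨i, hij, hiz⟩ := exists_third_colour j (f z)
  obtain ⟨y, hy, hyi⟩ := hsurj i
  have hcl := closedIn_compIn (G := G) (x := y) hy
  have hfy : ∀ x ∈ G.compIn ({a, b}ᶜ) y, f x = i := fun x hx =>
    (compIn_subset_of_closedIn (hlevel i) ⟨hy, hyi⟩ hx).2
  refine ⟨K, G.compIn ({a, b}ᶜ) y, hK, ⟨hdisj _ hcl fun h => hiz (hfy z h).symm, hcl,
    fun _ => connectedOn_compIn hy⟩, ?_, hKne, fun _ => ⟨y, mem_compIn⟩⟩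
  rw [Set.disjoint_left]
  intro x hx hx'
  exact hij ((hfy x hx').symm.trans (hj x hx))

/-- The successor of `i` in the cyclic order on `0, …, n - 1`. -/
def cyclicSucc (n i : ℕ) : ℕ := if i + 1 = n then 0 else i + 1

theorem cyclicSucc_lt {n i : ℕ} (hi : i < n) : cyclicSucc n i < n := by
  unfold cyclicSucc
  split_ifs <;> omega

theorem cyclicSucc_of_lt {n i : ℕ} (hi : i + 1 < n) : cyclicSucc n i = i + 1 :=
  if_neg (by omega)

theorem CycleEnum.adj_cyclicSucc {H : SimpleGraph V} {n : ℕ} {c : ℕ → V} (h : H.CycleEnum C n c)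
    {i : ℕ} (hi : i < n) : H.Adj (c i) (c (cyclicSucc n i)) := by
  have hn := h.three_le
  unfold cyclicSucc
  split_ifs with h1
  · exact ((h.adj 0 i (by omega) hi).2 (Or.inr ⟨rfl, by omega⟩)).symm
  · exact (h.adj i (i + 1) (by omega) (by omega)).2 (Or.inl rfl)

theorem CycleEnum.pair_ne {H : SimpleGraph V} {n : ℕ} {c : ℕ → V} (h : H.CycleEnum C n c)
    {i j : ℕ} (hi : i < n) (hj : j < n) (hij : i ≠ j) :
    ({c i, c (cyclicSucc n i)} : Set V) ≠ {c j, c (cyclicSucc n j)} := by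
  have hn := h.three_le
  intro heq
  rcases Set.pair_eq_pair_iff.1 heq with ⟨h1, -⟩ | ⟨h1, h2⟩
  · exact hij (h.inj i hi j hj h1)
  · have h3 := h.inj _ hi _ (cyclicSucc_lt hj) h1
    have h4 := h.inj _ (cyclicSucc_lt hi) _ hj h2
    unfold cyclicSucc at h3 h4
    split_ifs at h3 h4 <;> omega

theorem CycleEnum.exists_index {H : SimpleGraph V} {n : ℕ} {c : ℕ → V} (h : H.CycleEnum C n c)
    (hu : u ∈ C) (hv : v ∈ C) (huv : H.Adj u v) :
    ∃ i < n, ({u, v} : Set V) = {c i, c (cyclicSucc n i)} := by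
  have hn := h.three_le
  obtain ⟨i, hi, rfl⟩ := h.surj u hu
  obtain ⟨j, hj, rfl⟩ := h.surj v hv
  have key : ∀ i j, i < j → j < n → H.Adj (c i) (c j) →
      ∃ k < n, ({c i, c j} : Set V) = {c k, c (cyclicSucc n k)} := by
    intro i j hij hj hadj
    rcases (h.adj i j hij hj).1 hadj with rfl | ⟨rfl, rfl⟩
    · exact ⟨i, by omega, by rw [cyclicSucc_of_lt hj]⟩
    · refine ⟨n - 1, hj, ?_⟩
      rw [cyclicSucc, if_pos (by omega), Set.pair_comm]
  rcases lt_trichotomy i j with h1 | rfl | h1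
  · exact key i j h1 hj huv
  · exact absurd rfl huv.ne
  · obtain ⟨k, hk, hk'⟩ := key j i h1 hi huv.symm
    exact ⟨k, hk, by rw [← hk', Set.pair_comm]⟩

/-- Three edges of an induced cycle of the cell completion, each in a second induced cycle, give
an `S₃` minor. -/
theorem IsTwoConnected.graphS3_isMinorOf_of_enum [Fintype V] (hG : G.IsTwoConnected)
    (hH : G.cellCompletion.TreeOfCyclesOn Set.univ) (hC : G.cellCompletion.IsInducedCycle C)
    {n : ℕ} {c : ℕ → V} (h : G.cellCompletion.CycleEnum C n c) {p q : ℕ} (hpq : p < q)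
    (hq : q + 1 < n)
    (hsep : ∀ i, i = p ∨ i = q ∨ i = n - 1 → ∃ D, D ≠ C ∧ G.cellCompletion.IsInducedCycle D ∧
      c i ∈ D ∧ c (cyclicSucc n i) ∈ D) : graphS3.IsMinorOf G := by
  have hn := h.three_le
  have hfl : ∀ i : ℕ, i < n → _ := fun i hi =>
    hG.exists_flaps hH hC (h.adj_cyclicSucc hi) (h.mem i hi) (h.mem _ (cyclicSucc_lt hi))
  choose! K L hK hL hKL hKne hLne using hfl
  have hcne : ∀ i < n, c i ≠ c (cyclicSucc n i) := fun i hi => (h.adj_cyclicSucc hi).ne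
  have hflap : ∀ i < n, ∀ j < n, i ≠ j → ∀ X Y, G.IsFlap C (c i) (c (cyclicSucc n i)) X →
      G.IsFlap C (c j) (c (cyclicSucc n j)) Y → Disjoint X Y := fun i hi j hj hij X Y hX hY =>
    hG.disjoint_of_isFlap hX hY (h.mem i hi) (h.mem _ (cyclicSucc_lt hi)) (h.mem j hj)
      (h.mem _ (cyclicSucc_lt hj)) (hcne i hi) (h.pair_ne hi hj hij)
  -- the enlarged vertices of the cycle
  set X : ℕ → Set V := fun i => insert (c i) (L i) with hX
  have hXconn : ∀ i < n, G.ConnectedOn (X i) := by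
    intro i hi
    by_cases hne : (L i).Nonempty
    · obtain ⟨x, hx, hxc⟩ := hG.exists_adj_of_closedIn (hcne i hi) (hL i hi).closedIn hne
      have := (connectedOn_singleton (c i)).union_of_adj ((hL i hi).connectedOn hne) rfl hx hxc.symm
      rwa [← Set.insert_eq] at this
    · rw [Set.not_nonempty_iff_eq_empty] at hne
      simp only [hX, hne]
      simpa using connectedOn_singleton (c i)
  -- Where the cycle uses an edge that is missing in `G`, the flap absorbed into `X i` makes the
  -- connection.
  have hXadj : ∀ i < n, ∃ x ∈ X i, ∃ y ∈ X (cyclicSucc n i), G.Adj x y := by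
    intro i hi
    by_cases hadj : G.Adj (c i) (c (cyclicSucc n i))
    · exact ⟨_, Or.inl rfl, _, Or.inl rfl, hadj⟩
    · obtain ⟨x, hx, hxc⟩ := hG.exists_adj_of_closedIn' (hcne i hi) (hL i hi).closedIn
        (hLne i hi hadj)
      exact ⟨x, Or.inr hx, _, Or.inl rfl, hxc⟩
  have hXdis : ∀ i < n, ∀ j < n, i ≠ j → Disjoint (X i) (X j) := by
    intro i hi j hj hij
    rw [Set.disjoint_left]
    rintro x (rfl | hx) (hy | hy)
    · exact hij (h.inj i hi j hj hy)
    · exact (hL j hj).disjoint.le_bot ⟨hy, h.mem i hi⟩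
    · exact (hL i hi).disjoint.le_bot ⟨hx, hy ▸ h.mem j hj⟩
    · exact (hflap i hi j hj hij _ _ (hL i hi) (hL j hj)).le_bot ⟨hx, hy⟩
  have hKX : ∀ i < n, ∀ j < n, Disjoint (K i) (X j) := by
    intro i hi j hj
    rw [Set.disjoint_left]
    rintro x hx (rfl | hy)
    · exact (hK i hi).disjoint.le_bot ⟨hx, h.mem j hj⟩
    · by_cases hij : i = j
      · subst hij
        exact (hKL i hi).le_bot ⟨hx, hy⟩
      · exact (hflap i hi j hj hij _ _ (hK i hi) (hL j hj)).le_bot ⟨hx, hy⟩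
  have hKK : ∀ i < n, ∀ j < n, i ≠ j → Disjoint (K i) (K j) := fun i hi j hj hij =>
    hflap i hi j hj hij _ _ (hK i hi) (hK j hj)
  -- the arcs between the three edges
  set R : ℕ → ℕ → Set V := fun l r => ⋃ i ∈ Set.Icc l r, X i with hR
  have hRconn : ∀ l r, l ≤ r → r < n → G.ConnectedOn (R l r) := fun l r hlr hr =>
    connectedOn_biUnion_Icc hlr (fun i _ h2 => hXconn i (by omega)) (fun i _ h2 => by
      have := hXadj i (by omega)
      rwa [cyclicSucc_of_lt (by omega)] at this)
  have hXR : ∀ {i l r x}, l ≤ i → i ≤ r → x ∈ X i → x ∈ R l r := fun h1 h2 hx =>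
    Set.mem_biUnion (Set.mem_Icc.2 ⟨h1, h2⟩) hx
  have hRdis : ∀ l r l' r', r < l' → r' < n → Disjoint (R l r) (R l' r') := by
    intro l r l' r' hrl hr'
    simp only [hR, Set.disjoint_iUnion_left, Set.disjoint_iUnion_right]
    intro j hj i hi
    have h1 : i ≤ r := hi.2
    have h2 : l' ≤ j := hj.1
    have h3 : j ≤ r' := hj.2
    exact hXdis _ (by omega) _ (by omega) (by omega)
  have hKR : ∀ i l r, i < n → r < n → Disjoint (K i) (R l r) := by
    intro i l r hi hr
    simp only [hR, Set.disjoint_iUnion_right]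
    intro j hj
    have h3 : j ≤ r := hj.2
    exact hKX i hi j (by omega)
  have hKl : ∀ i < n, (K i).Nonempty → ∃ x ∈ K i, ∃ y ∈ X i, G.Adj x y := by
    intro i hi hne
    obtain ⟨x, hx, hxc⟩ := hG.exists_adj_of_closedIn (hcne i hi) (hK i hi).closedIn hne
    exact ⟨x, hx, _, Or.inl rfl, hxc⟩
  have hKr : ∀ i < n, (K i).Nonempty → ∃ x ∈ K i, ∃ y ∈ X (cyclicSucc n i), G.Adj x y := by
    intro i hi hne
    obtain ⟨x, hx, hxc⟩ := hG.exists_adj_of_closedIn' (hcne i hi) (hK i hi).closedIn hne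
    exact ⟨x, hx, _, Or.inl rfl, hxc⟩
  have hp : p < n := by omega
  have hq' : q < n := by omega
  have hl : n - 1 < n := by omega
  have hsp : cyclicSucc n p = p + 1 := cyclicSucc_of_lt (by omega)
  have hsq : cyclicSucc n q = q + 1 := cyclicSucc_of_lt (by omega)
  have hsl : cyclicSucc n (n - 1) = 0 := if_pos (by omega)
  have hKp := hKne p hp (hsep p (Or.inl rfl))
  have hKq := hKne q hq' (hsep q (Or.inr (Or.inl rfl)))
  have hKn := hKne (n - 1) hl (hsep (n - 1) (Or.inr (Or.inr rfl)))
  have lift : ∀ {S S' T T' : Set V}, S ⊆ S' → T ⊆ T' → (∃ x ∈ S, ∃ y ∈ T, G.Adj x y) →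
      ∃ x ∈ S', ∃ y ∈ T', G.Adj x y :=
    fun hS hT ⟨x, hx, y, hy, hxy⟩ => ⟨x, hS hx, y, hT hy, hxy⟩
  have hXsub : ∀ {i l r}, l ≤ i → i ≤ r → X i ⊆ R l r := fun h1 h2 x hx => hXR h1 h2 hx
  -- The edges at `p`, `q` and `n - 1` cut the cycle into three arcs, the triangle of the sun; the
  -- flaps `K` at these edges are its ears.
  refine graphS3_isMinorOf (A := R 0 p) (B := R (p + 1) q) (C := R (q + 1) (n - 1)) (K := K p)
    (L := K q) (M := K (n - 1)) (hRconn _ _ (by omega) hp) (hRconn _ _ (by omega) hq')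
    (hRconn _ _ (by omega) hl) ((hK p hp).connectedOn hKp) ((hK q hq').connectedOn hKq)
    ((hK _ hl).connectedOn hKn) (hRdis _ _ _ _ (by omega) (by omega))
    (hRdis _ _ _ _ (by omega) (by omega)) (hRdis _ _ _ _ (by omega) (by omega))
    (hKR _ _ _ hp hp) (hKR _ _ _ hp hq') (hKR _ _ _ hp hl) (hKR _ _ _ hq' hp)
    (hKR _ _ _ hq' hq') (hKR _ _ _ hq' hl) (hKR _ _ _ hl hp) (hKR _ _ _ hl hq')
    (hKR _ _ _ hl hl) (hKK p hp q hq' (by omega)) (hKK p hp _ hl (by omega))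
    (hKK q hq' _ hl (by omega)) ?_ ?_ ?_ ?_ ?_ ?_ ?_ ?_ ?_
  · exact lift (hXsub (by omega) le_rfl) (hXsub le_rfl (by omega)) (hsp ▸ hXadj p hp)
  · exact lift (hXsub (by omega) le_rfl) (hXsub le_rfl (by omega)) (hsq ▸ hXadj q hq')
  · exact lift (hXsub (by omega) le_rfl) (hXsub le_rfl (by omega)) (hsl ▸ hXadj _ hl)
  · exact lift subset_rfl (hXsub (by omega) le_rfl) (hKl p hp hKp)
  · exact lift subset_rfl (hXsub le_rfl (by omega)) (hsp ▸ hKr p hp hKp)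
  · exact lift subset_rfl (hXsub (by omega) le_rfl) (hKl q hq' hKq)
  · exact lift subset_rfl (hXsub le_rfl (by omega)) (hsq ▸ hKr q hq' hKq)
  · exact lift subset_rfl (hXsub (by omega) le_rfl) (hKl _ hl hKn)
  · exact lift subset_rfl (hXsub le_rfl (by omega)) (hsl ▸ hKr _ hl hKn)

theorem IsTwoConnected.ncard_edgeSeparator_le [Fintype V] (hG : G.IsTwoConnected)
    (hH : G.cellCompletion.TreeOfCyclesOn Set.univ) (hS : ¬ graphS3.IsMinorOf G) {C : Finset V}
    (hC : G.cellCompletion.IsChordlessCycle C) :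
    {e : Sym2 V | G.cellCompletion.IsEdgeSeparator e ∧ ∀ x ∈ e, x ∈ C}.ncard ≤ 2 := by
  classical
  by_contra! hlt
  obtain ⟨e₁, h1, e₂, h2, e₃, h3, h12, h13, h23⟩ := exists_three_of_three_le_ncard hlt
  have hcyc : G.cellCompletion.IsInducedCycle (C : Set V) := hC
  have hother : ∀ a b, G.cellCompletion.IsEdgeSeparator s(a, b) →
      ∃ D : Set V, D ≠ C ∧ G.cellCompletion.IsInducedCycle D ∧ a ∈ D ∧ b ∈ D := by
    intro a b hab
    obtain ⟨D, hD, hDC⟩ := Set.exists_ne_of_one_lt_ncard hab.2 C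
    exact ⟨D, fun h => hDC (Finset.coe_injective h), hD.1, hD.2 a (Sym2.mem_mk_left _ _),
      hD.2 b (Sym2.mem_mk_right _ _)⟩
  induction e₃ with
  | _ u v =>
  have huv : G.cellCompletion.Adj u v := h3.1.1
  obtain ⟨n, c, h, hc⟩ := hcyc.exists_enum (h3.2 u (Sym2.mem_mk_left _ _))
    (h3.2 v (Sym2.mem_mk_right _ _)) huv
  have hn := h.three_le
  have hl : cyclicSucc n (n - 1) = 0 := if_pos (by omega)
  have he3 : s(u, v) = s(c (n - 1), c 0) := by
    rcases hc with ⟨rfl, rfl⟩ | ⟨rfl, rfl⟩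
    exacts [Sym2.eq_swap, rfl]
  have hidx : ∀ e : Sym2 V, G.cellCompletion.IsEdgeSeparator e ∧ (∀ x ∈ e, x ∈ C) →
      e ≠ s(u, v) → ∃ i, i + 1 < n ∧ e = s(c i, c (cyclicSucc n i)) := by
    intro e he hne
    induction e with
    | _ a b =>
    obtain ⟨i, hi, hi'⟩ := h.exists_index (he.2 a (Sym2.mem_mk_left _ _))
      (he.2 b (Sym2.mem_mk_right _ _)) he.1.1
    have heq : s(a, b) = s(c i, c (cyclicSucc n i)) := by
      rw [Sym2.eq_iff]
      exact Set.pair_eq_pair_iff.1 hi'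
    refine ⟨i, ?_, heq⟩
    by_contra hin
    obtain rfl : i = n - 1 := by omega
    rw [hl, ← he3] at heq
    exact hne heq
  obtain ⟨i, hi, hi'⟩ := hidx e₁ h1 h13
  obtain ⟨j, hj, hj'⟩ := hidx e₂ h2 h23
  have hsi := hother _ _ (hi' ▸ h1.1)
  have hsj := hother _ _ (hj' ▸ h2.1)
  have hsl := hother _ _ (he3 ▸ h3.1)
  have hij : i ≠ j := by
    rintro rfl
    exact h12 (hi'.trans hj'.symm)
  rcases hij.lt_or_gt with hlt | hlt
  · refine hS (hG.graphS3_isMinorOf_of_enum hH hcyc h hlt hj ?_)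
    rintro k (rfl | rfl | rfl)
    exacts [hsi, hsj, hl ▸ hsl]
  · refine hS (hG.graphS3_isMinorOf_of_enum hH hcyc h hlt hi ?_)
    rintro k (rfl | rfl | rfl)
    exacts [hsj, hsi, hl ▸ hsl]

/-- The cell completion of a `2`-connected graph without `K₄`, `D₃` and `S₃` minors is a path of
cycles. -/
theorem IsTwoConnected.isPathOfCycles_cellCompletion [Fintype V] (hG : G.IsTwoConnected)
    (hK : ¬ (completeGraph (Fin 4)).IsMinorOf G) (hD : ¬ graphD3.IsMinorOf G)
    (hS : ¬ graphS3.IsMinorOf G) : G.cellCompletion.IsPathOfCycles := by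
  have hH := hG.treeOfCyclesOn_cellCompletion hK
  exact ⟨isTreeOfCycles_iff.2 hH, fun C hC => hG.ncard_edgeSeparator_le hH hS hC,
    fun e he _ => hG.ncard_le_of_not_graphD3 hH hD he⟩

end Sun

/-! ### Path decompositions as lists of bags -/

section BagList

variable {V : Type u} {G : SimpleGraph V} {A B C X Y T : Set V} {L L' L₁ L₂ : List (Set V)}
  {e f : Set V} {u v x : V}

/-- Every vertex lies in consecutive members of the list. -/
def Contiguous (L : List (Set V)) : Prop :=
  ∀ L₁ X L₂, L = L₁ ++ X :: L₂ → ∀ v, (∃ Y ∈ L₁, v ∈ Y) → (∃ Z ∈ L₂, v ∈ Z) → v ∈ X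

theorem Contiguous.reverse (h : Contiguous L) : Contiguous L.reverse := by
  intro L₁ X L₂ hL v h1 h2
  refine h L₂.reverse X L₁.reverse ?_ v ?_ ?_
  · rw [← L.reverse_reverse, hL]
    simp
  · simpa using h2
  · simpa using h1

/-- A vertex occurring on both sides of `e` lies in `e`, so an occurrence in the far half can be
replaced by the one in `e`. -/
theorem contiguous_glue (h1 : Contiguous (L₁ ++ [e])) (h2 : Contiguous (e :: L₂))
    (h : ∀ v, (∃ Y ∈ L₁, v ∈ Y) → (∃ Z ∈ L₂, v ∈ Z) → v ∈ e) : Contiguous (L₁ ++ e :: L₂) := by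
  intro M₁ X M₂ hL v ⟨Y, hY, hvY⟩ ⟨Z, hZ, hvZ⟩
  rcases List.append_eq_append_iff.1 hL with ⟨as, rfl, has⟩ | ⟨bs, rfl, hbs⟩
  · rcases as with _ | ⟨a, as⟩
    · simp only [List.nil_append, List.cons.injEq] at has
      obtain ⟨rfl, rfl⟩ := has
      exact h v ⟨Y, by simpa using hY, hvY⟩ ⟨Z, hZ, hvZ⟩
    · simp only [List.cons_append, List.cons.injEq] at has
      obtain ⟨rfl, rfl⟩ := has
      refine h2 (e :: as) X M₂ rfl v ?_ ⟨Z, hZ, hvZ⟩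
      rcases List.mem_append.1 hY with hY | hY
      · exact ⟨e, by simp, h v ⟨Y, hY, hvY⟩ ⟨Z, by simp [hZ], hvZ⟩⟩
      · exact ⟨Y, hY, hvY⟩
  · rcases bs with _ | ⟨b, bs⟩
    · simp only [List.nil_append, List.cons.injEq] at hbs
      obtain ⟨rfl, rfl⟩ := hbs
      exact h v ⟨Y, by simpa using hY, hvY⟩ ⟨Z, hZ, hvZ⟩
    · simp only [List.cons_append, List.cons.injEq] at hbs
      obtain ⟨rfl, rfl⟩ := hbs
      refine h1 M₁ X (bs ++ [e]) (by simp) v ⟨Y, hY, hvY⟩ ?_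
      rcases List.mem_append.1 hZ with hZ | hZ
      · exact ⟨Z, by simp [hZ], hvZ⟩
      · rcases List.mem_cons.1 hZ with rfl | hZ
        · exact ⟨Z, by simp, hvZ⟩
        · exact ⟨e, by simp, h v ⟨Y, by simp [hY], hvY⟩ ⟨Z, hZ, hvZ⟩⟩

theorem Contiguous.left (h : Contiguous (L₁ ++ e :: L₂)) : Contiguous (L₁ ++ [e]) := by
  intro M₁ X M₂ hL v hY ⟨Z, hZ, hvZ⟩
  refine h M₁ X (M₂ ++ L₂) ?_ v hY ⟨Z, by simp [hZ], hvZ⟩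
  simpa using congrArg (· ++ L₂) hL

theorem Contiguous.right (h : Contiguous (L₁ ++ e :: L₂)) : Contiguous (e :: L₂) := by
  intro M₁ X M₂ hL v ⟨Y, hY, hvY⟩ hZ
  exact h (L₁ ++ M₁) X M₂ (by rw [hL]; simp) v ⟨Y, by simp [hY], hvY⟩ hZ

theorem contiguous_singleton (X : Set V) : Contiguous [X] := by
  intro L₁ Y L₂ hL v ⟨Z, hZ, _⟩ _
  have := congrArg List.length hL
  have := List.length_pos_of_mem hZ
  simp at *
  omega

theorem contiguous_pair (X Y : Set V) : Contiguous [X, Y] := by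
  intro L₁ W L₂ hL v ⟨Z, hZ, _⟩ ⟨Z', hZ', _⟩
  have := congrArg List.length hL
  have := List.length_pos_of_mem hZ
  have := List.length_pos_of_mem hZ'
  simp at *
  omega

theorem contiguous_triple (h : X ⊆ Y) : Contiguous [X, Y, T] :=
  contiguous_glue (L₁ := [X]) (contiguous_pair X Y) (contiguous_pair Y T)
    (fun v ⟨Z, hZ, hv⟩ _ => h (by rwa [← List.mem_singleton.1 hZ]))

/-- `L` is the list of bags of a path decomposition of `G[A]` of width at most two. -/
structure BagList (G : SimpleGraph V) (L : List (Set V)) (A : Set V) : Prop where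
  subset : ∀ X ∈ L, X ⊆ A
  card : ∀ X ∈ L, X.ncard ≤ 3
  vertex : ∀ v ∈ A, ∃ X ∈ L, v ∈ X
  edge : ∀ u ∈ A, ∀ v ∈ A, G.Adj u v → ∃ X ∈ L, u ∈ X ∧ v ∈ X
  contiguous : Contiguous L

theorem BagList.reverse (h : G.BagList L A) : G.BagList L.reverse A :=
  ⟨by simpa using h.subset, by simpa using h.card, by simpa using h.vertex,
    by simpa using h.edge, h.contiguous.reverse⟩

theorem bagList_singleton (h : X.ncard ≤ 3) : G.BagList [X] X :=
  ⟨by simp, by simpa using h, fun v hv => ⟨X, by simp, hv⟩,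
    fun u hu v hv _ => ⟨X, by simp, hu, hv⟩, contiguous_singleton X⟩

theorem bagList_triple [Finite V] (hX : X ⊆ Y) (hT : T ⊆ Y) (h : Y.ncard ≤ 3) :
    G.BagList [X, Y, T] Y := by
  refine ⟨?_, ?_, fun v hv => ⟨Y, by simp, hv⟩, fun u hu v hv _ => ⟨Y, by simp, hu, hv⟩,
    contiguous_triple hX⟩
  · simpa using ⟨hX, hT⟩
  · simpa using ⟨(Set.ncard_le_ncard hX (Set.toFinite _)).trans h, h,
      (Set.ncard_le_ncard hT (Set.toFinite _)).trans h⟩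

theorem BagList.glue (h1 : G.BagList (L₁ ++ [e]) A) (h2 : G.BagList (e :: L₂) B) (hAB : A ∩ B ⊆ e)
    (hcross : ∀ x ∈ A, ∀ y ∈ B, G.Adj x y → x ∈ B ∨ y ∈ A) :
    G.BagList (L₁ ++ e :: L₂) (A ∪ B) := by
  have hm1 : ∀ X ∈ L₁ ++ [e], X ∈ L₁ ++ e :: L₂ := by
    intro X hX
    rcases List.mem_append.1 hX with h | h
    · simp [h]
    · simp [List.mem_singleton.1 h]
  have hm2 : ∀ X ∈ e :: L₂, X ∈ L₁ ++ e :: L₂ := fun X hX => List.mem_append.2 (Or.inr hX)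
  have hm : ∀ X ∈ L₁ ++ e :: L₂, X ∈ L₁ ++ [e] ∨ X ∈ e :: L₂ := by
    intro X hX
    rcases List.mem_append.1 hX with h | h
    · exact Or.inl (by simp [h])
    · exact Or.inr h
  refine ⟨fun X hX => ?_, fun X hX => ?_, fun v hv => ?_, fun u hu v hv huv => ?_,
    contiguous_glue h1.contiguous h2.contiguous fun v ⟨Y, hY, hvY⟩ ⟨Z, hZ, hvZ⟩ =>
      hAB ⟨h1.subset Y (by simp [hY]) hvY, h2.subset Z (by simp [hZ]) hvZ⟩⟩
  · rcases hm X hX with h | h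
    exacts [(h1.subset X h).trans Set.subset_union_left, (h2.subset X h).trans
      Set.subset_union_right]
  · rcases hm X hX with h | h
    exacts [h1.card X h, h2.card X h]
  · rcases hv with hv | hv
    · obtain ⟨X, hX, hvX⟩ := h1.vertex v hv
      exact ⟨X, hm1 X hX, hvX⟩
    · obtain ⟨X, hX, hvX⟩ := h2.vertex v hv
      exact ⟨X, hm2 X hX, hvX⟩
  · have key : (u ∈ A ∧ v ∈ A) ∨ (u ∈ B ∧ v ∈ B) := by
      rcases hu with hu | hu <;> rcases hv with hv | hv
      · exact Or.inl ⟨hu, hv⟩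
      · rcases hcross u hu v hv huv with h | h
        exacts [Or.inr ⟨h, hv⟩, Or.inl ⟨hu, h⟩]
      · rcases hcross v hv u hu huv.symm with h | h
        exacts [Or.inr ⟨hu, h⟩, Or.inl ⟨h, hv⟩]
      · exact Or.inr ⟨hu, hv⟩
    rcases key with h | h
    · obtain ⟨X, hX, hX'⟩ := h1.edge u h.1 v h.2 huv
      exact ⟨X, hm1 X hX, hX'⟩
    · obtain ⟨X, hX, hX'⟩ := h2.edge u h.1 v h.2 huv
      exact ⟨X, hm2 X hX, hX'⟩

/-- The new bag is placed between two copies of the bag `e` that it meets. This works anywhere in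
the list, so any number of triangles can be attached at one edge. -/
theorem BagList.insert [Finite V] (h : G.BagList (L₁ ++ e :: L₂) A) (hX : X.ncard ≤ 3)
    (hAX : A ∩ X = e) (hcross : ∀ x ∈ A, ∀ y ∈ X, G.Adj x y → x ∈ X ∨ y ∈ A) :
    G.BagList (L₁ ++ e :: X :: e :: L₂) (A ∪ X) := by
  have heX : e ⊆ X := hAX ▸ Set.inter_subset_right
  have hm : ∀ Y ∈ L₁ ++ e :: L₂, Y ∈ L₁ ++ e :: X :: e :: L₂ := by
    intro Y hY
    rcases List.mem_append.1 hY with h | h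
    · simp [h]
    · rcases List.mem_cons.1 h with h | h <;> simp [h]
  have hm' : ∀ Y ∈ L₁ ++ e :: X :: e :: L₂, Y = X ∨ Y ∈ L₁ ++ e :: L₂ := by
    intro Y hY
    rcases List.mem_append.1 hY with h | h
    · simp [h]
    · simp only [List.mem_cons] at h
      rcases h with h | h | h | h <;> simp [h]
  refine ⟨fun Y hY => ?_, fun Y hY => ?_, fun v hv => ?_, fun u hu v hv huv => ?_, ?_⟩
  · rcases hm' Y hY with rfl | h'
    exacts [Set.subset_union_right, (h.subset Y h').trans Set.subset_union_left]
  · rcases hm' Y hY with rfl | h'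
    exacts [hX, h.card Y h']
  · rcases hv with hv | hv
    · obtain ⟨Y, hY, hvY⟩ := h.vertex v hv
      exact ⟨Y, hm Y hY, hvY⟩
    · exact ⟨X, by simp, hv⟩
  · have key : (u ∈ A ∧ v ∈ A) ∨ (u ∈ X ∧ v ∈ X) := by
      rcases hu with hu | hu <;> rcases hv with hv | hv
      · exact Or.inl ⟨hu, hv⟩
      · rcases hcross u hu v hv huv with h | h
        exacts [Or.inr ⟨h, hv⟩, Or.inl ⟨hu, h⟩]
      · rcases hcross v hv u hu huv.symm with h | h
        exacts [Or.inr ⟨hu, h⟩, Or.inl ⟨h, hv⟩]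
      · exact Or.inr ⟨hu, hv⟩
    rcases key with h' | h'
    · obtain ⟨Y, hY, hY'⟩ := h.edge u h'.1 v h'.2 huv
      exact ⟨Y, hm Y hY, hY'⟩
    · exact ⟨X, by simp, h'⟩
  · have h1 := contiguous_glue (L₁ := L₁) (e := e) (L₂ := [X, e]) h.contiguous.left
      (contiguous_triple heX) (fun v ⟨Y, hY, hvY⟩ ⟨Z, hZ, hvZ⟩ => by
        have hvA := h.subset Y (by simp [hY]) hvY
        simp only [List.mem_cons, List.not_mem_nil, or_false] at hZ
        rcases hZ with rfl | rfl
        · exact hAX ▸ ⟨hvA, hvZ⟩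
        · exact hvZ)
    have h2 := contiguous_glue (L₁ := L₁ ++ [e, X]) (e := e) (L₂ := L₂) (by simpa using h1)
      h.contiguous.right (fun v ⟨Y, hY, hvY⟩ ⟨Z, hZ, hvZ⟩ => by
        have hvA := h.subset Z (by simp [hZ]) hvZ
        simp only [List.mem_append, List.mem_cons, List.not_mem_nil, or_false] at hY
        rcases hY with hY | rfl | rfl
        · exact h.contiguous L₁ e L₂ rfl v ⟨Y, hY, hvY⟩ ⟨Z, hZ, hvZ⟩
        · exact hvY
        · exact hAX ▸ ⟨hvA, hvY⟩)
    simpa using h2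

theorem ncard_triple_le (a b c : V) : ({a, b, c} : Set V).ncard ≤ 3 := by
  have h1 := Set.ncard_insert_le a {b, c}
  have h2 := ncard_pair_le b c
  omega

/-- The part of a cycle between two edges. -/
theorem CycleEnum.exists_bagList_Icc [Finite V] {n : ℕ} {c : ℕ → V} (h : G.CycleEnum C n c) {p : ℕ} :
    ∀ d i j, j = i + d + 1 → i ≤ p → p + 1 ≤ j → j < n →
    ∃ L L' L'', G.BagList L (c '' Set.Icc i j) ∧ L = {c i, c j} :: L' ∧
      L = L'' ++ [{c p, c (p + 1)}] := by
  have hn := h.three_le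
  have hmem : ∀ {i j k}, k < n → j < n → (c k ∈ c '' Set.Icc i j ↔ i ≤ k ∧ k ≤ j) := by
    intro i j k hk hj
    constructor
    · rintro ⟨l, hl, hlk⟩
      have h1 := hl.2
      have := h.inj l (by omega) k hk hlk
      subst this
      exact hl
    · exact fun hk => ⟨k, hk, rfl⟩
  intro d
  induction d with
  | zero =>
    rintro i j rfl hi hj hjn
    obtain rfl : i = p := by omega
    refine ⟨_, [], [], ?_, rfl, rfl⟩
    have : c '' Set.Icc i (i + 0 + 1) = {c i, c (i + 1)} := by
      have : Set.Icc i (i + 0 + 1) = {i, i + 1} := by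
        ext k
        simp
        omega
      rw [this, Set.image_pair]
    rw [this]
    exact bagList_singleton ((ncard_pair_le _ _).trans (by omega))
  | succ d ih =>
    rintro i j hij hi hj hjn
    -- The bags `{c i, c j}` need not be edges: they are two fronts closing in on `{c p, c (p +
    -- 1)}`. The left front moves until it reaches `p`, then the right front moves down to `p + 1`.
    by_cases hip : i < p
    · obtain ⟨L, L', L'', hL, hhead, hlast⟩ := ih (i + 1) j (by omega) (by omega) hj hjn
      have hT : G.BagList [{c i, c j}, {c i, c (i + 1), c j}, {c (i + 1), c j}]
          {c i, c (i + 1), c j} :=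
        bagList_triple (by intro x; simp; tauto) (by intro x; simp; tauto) (ncard_triple_le _ _ _)
      subst hhead
      have hg := BagList.glue (L₁ := [{c i, c j}, {c i, c (i + 1), c j}]) hT hL ?_ ?_
      · refine ⟨[{c i, c j}, {c i, c (i + 1), c j}] ++ ({c (i + 1), c j} :: L'),
          {c i, c (i + 1), c j} :: {c (i + 1), c j} :: L',
          [{c i, c j}, {c i, c (i + 1), c j}] ++ L'', ?_, rfl, ?_⟩
        · convert hg using 1
          ext x
          constructor
          · rintro ⟨k, hk, rfl⟩
            by_cases hki : k = i
            · subst hki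
              exact Or.inl (Or.inl rfl)
            · have h1 := hk.1
              exact Or.inr ⟨k, ⟨by omega, hk.2⟩, rfl⟩
          · rintro ((rfl | rfl | rfl) | ⟨k, hk, rfl⟩)
            · exact ⟨i, ⟨le_rfl, by omega⟩, rfl⟩
            · exact ⟨i + 1, ⟨by omega, by omega⟩, rfl⟩
            · exact ⟨j, ⟨by omega, le_rfl⟩, rfl⟩
            · have h1 := hk.1
              exact ⟨k, ⟨by omega, hk.2⟩, rfl⟩
        · rw [List.append_assoc, ← hlast]
      · rintro x ⟨rfl | hx, hx'⟩
        · have := (hmem (by omega) hjn).1 hx'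
          omega
        · exact hx
      · rintro x hx y ⟨k, hk, rfl⟩ hxy
        have h1 := hk.1
        have h2 := hk.2
        rcases hx with rfl | rfl | rfl
        · right
          rcases (h.adj i k (by omega) (by omega)).1 hxy with rfl | ⟨rfl, rfl⟩
          · exact Or.inr (Or.inl rfl)
          · exact Or.inr (Or.inr (by rw [show j = n - 1 by omega]; rfl))
        · exact Or.inl ⟨i + 1, ⟨le_rfl, by omega⟩, rfl⟩
        · exact Or.inl ⟨j, ⟨by omega, le_rfl⟩, rfl⟩
    · have hjp : p + 1 < j := by omega
      obtain ⟨L, L', L'', hL, hhead, hlast⟩ := ih i (j - 1) (by omega) hi (by omega) (by omega)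
      have hT : G.BagList [{c i, c j}, {c i, c (j - 1), c j}, {c i, c (j - 1)}]
          {c i, c (j - 1), c j} :=
        bagList_triple (by intro x; simp; tauto) (by intro x; simp; tauto) (ncard_triple_le _ _ _)
      subst hhead
      have hg := BagList.glue (L₁ := [{c i, c j}, {c i, c (j - 1), c j}]) hT hL ?_ ?_
      · refine ⟨[{c i, c j}, {c i, c (j - 1), c j}] ++ ({c i, c (j - 1)} :: L'),
          {c i, c (j - 1), c j} :: {c i, c (j - 1)} :: L',
          [{c i, c j}, {c i, c (j - 1), c j}] ++ L'', ?_, rfl, ?_⟩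
        · convert hg using 1
          ext x
          constructor
          · rintro ⟨k, hk, rfl⟩
            by_cases hki : k = j
            · subst hki
              exact Or.inl (Or.inr (Or.inr rfl))
            · have h1 := hk.2
              exact Or.inr ⟨k, ⟨hk.1, by omega⟩, rfl⟩
          · rintro ((rfl | rfl | rfl) | ⟨k, hk, rfl⟩)
            · exact ⟨i, ⟨le_rfl, by omega⟩, rfl⟩
            · exact ⟨j - 1, ⟨by omega, by omega⟩, rfl⟩
            · exact ⟨j, ⟨by omega, le_rfl⟩, rfl⟩
            · have h1 := hk.2
              exact ⟨k, ⟨hk.1, by omega⟩, rfl⟩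
        · rw [List.append_assoc, ← hlast]
      · rintro x ⟨rfl | rfl | rfl, hx'⟩
        · exact Or.inl rfl
        · exact Or.inr rfl
        · have := (hmem (by omega) (by omega)).1 hx'
          omega
      · rintro x hx y ⟨k, hk, rfl⟩ hxy
        have h1 := hk.1
        have h2 := hk.2
        rcases hx with rfl | rfl | rfl
        · exact Or.inl ⟨i, ⟨le_rfl, by omega⟩, rfl⟩
        · exact Or.inl ⟨j - 1, ⟨by omega, le_rfl⟩, rfl⟩
        · right
          rcases (h.adj k j (by omega) (by omega)).1 hxy.symm with hk' | ⟨rfl, rfl⟩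
          · exact Or.inr (Or.inl (by rw [show k = j - 1 by omega]))
          · exact Or.inl (by rw [show i = 0 by omega])

/-- A cycle has a path decomposition of width two between any two of its edges. -/
theorem IsInducedCycle.exists_bagList [Finite V] (hC : G.IsInducedCycle C) {a b a' b' : V}
    (hab : G.Adj a b) (ha : a ∈ C) (hb : b ∈ C) (hab' : G.Adj a' b') (ha' : a' ∈ C) (hb' : b' ∈ C)
    (hne : ({a, b} : Set V) ≠ {a', b'}) :
    ∃ L L' L'', G.BagList L C ∧ L = {a, b} :: L' ∧ L = L'' ++ [{a', b'}] := by
  obtain ⟨n, c, h, hc⟩ := hC.exists_enum ha hb hab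
  have hn := h.three_le
  have hset : ({a, b} : Set V) = {c 0, c (n - 1)} := by
    rcases hc with ⟨rfl, rfl⟩ | ⟨rfl, rfl⟩
    · rfl
    · exact Set.pair_comm _ _
  obtain ⟨p, hp, hset'⟩ := h.exists_index ha' hb' hab'
  have hpn : p + 1 < n := by
    by_contra hpn
    obtain rfl : p = n - 1 := by omega
    rw [cyclicSucc, if_pos (by omega)] at hset'
    exact hne (hset.trans ((Set.pair_comm _ _).trans hset'.symm))
  rw [cyclicSucc_of_lt hpn] at hset'
  obtain ⟨L, L', L'', hL, h1, h2⟩ := h.exists_bagList_Icc (p := p) (n - 2) 0 (n - 1) (by omega)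
    (by omega) (by omega) (by omega)
  refine ⟨L, L', L'', ?_, by rw [h1, hset], by rw [h2, hset']⟩
  convert hL using 1
  ext x
  constructor
  · intro hx
    obtain ⟨i, hi, rfl⟩ := h.surj x hx
    exact ⟨i, ⟨by omega, by omega⟩, rfl⟩
  · rintro ⟨i, ⟨_, hi⟩, rfl⟩
    exact h.mem i (by omega)

end BagList

/-! ### Paths of cycles have pathwidth two -/

section PathOfCycles

variable {V : Type u} {G : SimpleGraph V} {A B C C' X Y T : Set V} {L L' L₁ L₂ : List (Set V)}
  {e f : Set V} {u v x : V}

theorem TreeOfCyclesOn.exists_cycle_through (h : G.TreeOfCyclesOn A) (hu : u ∈ A) (hv : v ∈ A)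
    (huv : G.Adj u v) : ∃ C ⊆ A, G.IsInducedCycle C ∧ u ∈ C ∧ v ∈ C := by
  induction h with
  | cycle C hC => exact ⟨C, subset_rfl, hC, hu, hv⟩
  | glue A B a b hab hsep hA hB ih =>
    rcases hsep.adj_mem hu hv huv with h | h
    · obtain ⟨C, hCA, h'⟩ := ih h.1 h.2
      exact ⟨C, hCA.trans Set.subset_union_left, h'⟩
    · exact ⟨B, Set.subset_union_right, hB, h⟩

theorem IsInducedCycle.ncard_le_of_isClique [Finite V] (hC : G.IsInducedCycle C) {K : Set V}
    (hKC : K ⊆ C) (hK : G.IsClique K) : K.ncard ≤ 3 := by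
  rcases K.eq_empty_or_nonempty with rfl | ⟨w, hw⟩
  · simp
  obtain ⟨y, -, z, -, -, -, -, hN⟩ := hC.exists_neighbors (hKC hw)
  refine (Set.ncard_le_ncard (t := {w, y, z}) ?_ (Set.toFinite _)).trans (ncard_triple_le _ _ _)
  intro x hx
  by_cases hxw : x = w
  · exact Or.inl hxw
  · exact Or.inr (hN x (hKC hx) (hK hw hx (Ne.symm hxw)))

theorem TreeOfCyclesOn.ncard_le_of_isClique [Finite V] (h : G.TreeOfCyclesOn A) :
    ∀ K ⊆ A, G.IsClique K → K.ncard ≤ 3 := by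
  induction h with
  | cycle C hC => exact fun K hKC hK => hC.ncard_le_of_isClique hKC hK
  | glue A B a b hab hsep hA hB ih =>
    intro K hKAB hK
    by_cases hKA : K ⊆ A
    · exact ih K hKA hK
    obtain ⟨x, hxK, hxA⟩ := Set.not_subset.1 hKA
    refine hB.ncard_le_of_isClique (fun y hy => ?_) hK
    by_cases hxy : x = y
    · subst hxy
      exact (hKAB hy).resolve_left hxA
    · rcases hsep.adj_mem (hKAB hxK) (hKAB hy) (hK hxK hy hxy) with h | h
      exacts [absurd h.1 hxA, h.2]

theorem IsInducedCycle.exists_adj_pair_ne (hC : G.IsInducedCycle C) (hu : u ∈ C) :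
    ∃ a b, G.Adj a b ∧ a ∈ C ∧ b ∈ C ∧ ({a, b} : Set V) ≠ {u, v} := by
  obtain ⟨y, hy, z, hz, hyz, hxy, hxz, -⟩ := hC.exists_neighbors hu
  by_cases hyv : y = v
  · refine ⟨u, z, hxz, hu, hz, fun h => ?_⟩
    have : z ∈ ({u, v} : Set V) := h ▸ Or.inr rfl
    rcases this with h | h
    exacts [hxz.ne h.symm, hyz (hyv.trans h.symm)]
  · refine ⟨u, y, hxy, hu, hy, fun h => ?_⟩
    have : y ∈ ({u, v} : Set V) := h ▸ Or.inr rfl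
    rcases this with h | h
    exacts [hxy.ne h.symm, hyv h]

/-- If at most two edges of a cycle are marked, then every marked edge other than `uv` equals
some fixed edge of the cycle. -/
theorem IsInducedCycle.exists_second_edge (hC : G.IsInducedCycle C) {M : Set (Set V)}
    (hM : ∀ m ∈ M, ∃ u v, G.Adj u v ∧ m = {u, v})
    (h2 : ∀ e₁ ∈ M, ∀ e₂ ∈ M, ∀ e₃ ∈ M, e₁ ⊆ C → e₂ ⊆ C → e₃ ⊆ C → e₁ = e₂ ∨ e₁ = e₃ ∨ e₂ = e₃)
    (hu : u ∈ C) (hv : v ∈ C) (he : {u, v} ∈ M) :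
    ∃ a b, G.Adj a b ∧ a ∈ C ∧ b ∈ C ∧ ({a, b} : Set V) ≠ {u, v} ∧
      ∀ m ∈ M, m ⊆ C → m = {u, v} ∨ m = {a, b} := by
  have huC : ({u, v} : Set V) ⊆ C := Set.pair_subset hu hv
  by_cases h : ∃ f ∈ M, f ⊆ C ∧ f ≠ {u, v}
  · obtain ⟨f, hf, hfC, hne⟩ := h
    obtain ⟨a, b, hab, rfl⟩ := hM f hf
    refine ⟨a, b, hab, hfC (Or.inl rfl), hfC (Or.inr rfl), hne, fun m hm hmC => ?_⟩
    rcases h2 _ he _ hf m hm huC hfC hmC with h | h | h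
    exacts [absurd h.symm hne, Or.inl h.symm, Or.inr h.symm]
  · push Not at h
    obtain ⟨a, b, hab, ha, hb, hne⟩ := hC.exists_adj_pair_ne (v := v) hu
    exact ⟨a, b, hab, ha, hb, hne, fun m hm hmC => Or.inl (h m hm hmC)⟩

/-- The cycles in `G[A]` through `e` that are not triangles with `e` as their only marked edge. -/
def heavyCycles (G : SimpleGraph V) (M : Set (Set V)) (A e : Set V) : Set (Set V) :=
  {C | C ⊆ A ∧ G.IsInducedCycle C ∧ e ⊆ C ∧ ¬ (C.ncard = 3 ∧ ∀ m ∈ M, m ⊆ C → m = e)}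

/-- The number `k m` says how many ends of the list are required to be the bag `m`; they are
reserved for pieces to be attached later at `m`. -/
theorem IsInducedCycle.exists_marked_bagList [Finite V] (hC : G.IsInducedCycle C) {M : Set (Set V)}
    (hM : ∀ m ∈ M, ∃ u v, G.Adj u v ∧ m = {u, v}) (k : Set V → ℕ)
    (h2 : ∀ e₁ ∈ M, ∀ e₂ ∈ M, ∀ e₃ ∈ M, e₁ ⊆ C → e₂ ⊆ C → e₃ ⊆ C → e₁ = e₂ ∨ e₁ = e₃ ∨ e₂ = e₃)
    (h3 : ∀ e ∈ M, e ⊆ C → k e + (G.heavyCycles M C e).ncard ≤ 2) :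
    ∃ L e₁ e₂, G.BagList L C ∧ L.head? = some e₁ ∧ L.getLast? = some e₂ ∧
      ∀ m ∈ M, m ⊆ C → m ∈ L ∧ (0 < k m → m = e₁ ∨ m = e₂) ∧ (1 < k m → m = e₁ ∧ m = e₂) := by
  by_cases hk : ∃ m ∈ M, m ⊆ C ∧ 1 < k m
  -- Both ends are reserved for `m`, which leaves no room for a heavy cycle. So `C` is a triangle
  -- with `m` as its only mark, and it sits between two copies of `m`.
  · obtain ⟨m, hm, hmC, hkm⟩ := hk
    have h0 : (G.heavyCycles M C m).ncard = 0 := by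
      have := h3 m hm hmC
      omega
    rw [Set.ncard_eq_zero] at h0
    have hfree : C.ncard = 3 ∧ ∀ m' ∈ M, m' ⊆ C → m' = m := by
      by_contra hcon
      have : C ∈ G.heavyCycles M C m := ⟨subset_rfl, hC, hmC, hcon⟩
      rw [h0] at this
      exact this
    refine ⟨[m, C, m], m, m, bagList_triple hmC hmC hfree.1.le, rfl, rfl, fun m' hm' hmC' => ?_⟩
    obtain rfl := hfree.2 m' hm' hmC'
    simp
  · push Not at hk
    obtain ⟨u, v, a, b, huv, hu, hv, hab, ha, hb, hne, hall⟩ : ∃ u v a b, G.Adj u v ∧ u ∈ C ∧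
        v ∈ C ∧ G.Adj a b ∧ a ∈ C ∧ b ∈ C ∧ ({a, b} : Set V) ≠ {u, v} ∧
        ∀ m ∈ M, m ⊆ C → m = {u, v} ∨ m = {a, b} := by
      by_cases h : ∃ m ∈ M, m ⊆ C
      · obtain ⟨m, hm, hmC⟩ := h
        obtain ⟨u, v, huv, rfl⟩ := hM m hm
        have hu := hmC (Or.inl rfl)
        have hv := hmC (Or.inr rfl)
        obtain ⟨a, b, h⟩ := hC.exists_second_edge hM h2 hu hv hm
        exact ⟨u, v, a, b, huv, hu, hv, h⟩
      · push Not at h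
        obtain ⟨u, hu⟩ := hC.connectedOn.1
        obtain ⟨v, hv, -, -, -, huv, -⟩ := hC.exists_neighbors hu
        obtain ⟨a, b, hab, ha, hb, hne⟩ := hC.exists_adj_pair_ne (v := v) hu
        exact ⟨u, v, a, b, huv, hu, hv, hab, ha, hb, hne, fun m hm hmC => absurd hmC (h m hm)⟩
    obtain ⟨L, L', L'', hL, h1, h2⟩ := hC.exists_bagList huv hu hv hab ha hb hne.symm
    refine ⟨L, {u, v}, {a, b}, hL, by simp [h1], by simp [h2], fun m hm hmC => ⟨?_, fun _ =>
      hall m hm hmC, fun h => absurd h (hk m hm hmC).not_gt⟩⟩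
    rcases hall m hm hmC with rfl | rfl
    · simp [h1]
    · simp [h2]

/-- Each mark `e` has two slots, one for either direction of the list; a heavy cycle through `e`
takes one slot, and `k e` slots are reserved for ends. When a cycle `B` is glued along `uv`, there
are two cases. If `B` is a triangle with no other mark, it is inserted at the bag `uv` and the ends
do not change. Otherwise `B` takes a slot: the induction hypothesis is used with one more
reservation for `uv`, so that the list of `A` ends in `uv`, and it is continued by sweeping `B` from
`uv` to its second marked edge, the new end. -/
theorem TreeOfCyclesOn.exists_marked_bagList [Finite V] (h : G.TreeOfCyclesOn A) (M : Set (Set V))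
    (hM : ∀ m ∈ M, ∃ u v, G.Adj u v ∧ m = {u, v}) :
    (∀ C C' u v, C ⊆ A → C' ⊆ A → G.IsInducedCycle C → G.IsInducedCycle C' → C ≠ C' →
      G.Adj u v → {u, v} ⊆ C → {u, v} ⊆ C' → {u, v} ∈ M) →
    (∀ C ⊆ A, G.IsInducedCycle C → ∀ e₁ ∈ M, ∀ e₂ ∈ M, ∀ e₃ ∈ M, e₁ ⊆ C → e₂ ⊆ C → e₃ ⊆ C →
      e₁ = e₂ ∨ e₁ = e₃ ∨ e₂ = e₃) →
    ∀ k : Set V → ℕ, (∀ e ∈ M, e ⊆ A → k e + (G.heavyCycles M A e).ncard ≤ 2) →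
    ∃ L e₁ e₂, G.BagList L A ∧ L.head? = some e₁ ∧ L.getLast? = some e₂ ∧
      ∀ m ∈ M, m ⊆ A → m ∈ L ∧ (0 < k m → m = e₁ ∨ m = e₂) ∧ (1 < k m → m = e₁ ∧ m = e₂) := by
  classical
  induction h with
  | cycle C hC =>
    intro _ h2 k h3
    exact hC.exists_marked_bagList hM k (h2 C subset_rfl hC) h3
  | glue A B u v huv hsep hA hB ih =>
    intro hsepM h2 k h3
    have huA := hsep.left_mem
    have hvA := hsep.right_mem
    have heA : ({u, v} : Set V) ⊆ A := Set.pair_subset huA.1 hvA.1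
    have heB : ({u, v} : Set V) ⊆ B := Set.pair_subset huA.2 hvA.2
    have hAA : A ⊆ A ∪ B := Set.subset_union_left
    have hBA : B ⊆ A ∪ B := Set.subset_union_right
    have hBnot : ¬ B ⊆ A := by
      intro hBA
      obtain ⟨y, hy, hy'⟩ := (hB.connectedOn_diff_edge huv).1
      exact hy' (hsep.eq_or_eq (hBA hy) hy)
    have heM : {u, v} ∈ M := by
      obtain ⟨C, hCA, hC, huC, hvC⟩ := hA.exists_cycle_through huA.1 hvA.1 huv
      exact hsepM C B u v (hCA.trans hAA) hBA hC hB (fun h => hBnot (h ▸ hCA)) huv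
        (Set.pair_subset huC hvC) heB
    have hmAB : ∀ m ∈ M, m ⊆ A ∪ B → m ⊆ A ∨ m ⊆ B := by
      intro m hm hmAB
      obtain ⟨a, b, hab, rfl⟩ := hM m hm
      rcases hsep.adj_mem (hmAB (Or.inl rfl)) (hmAB (Or.inr rfl)) hab with h | h
      exacts [Or.inl (Set.pair_subset h.1 h.2), Or.inr (Set.pair_subset h.1 h.2)]
    have hheavy : ∀ e, G.heavyCycles M A e ⊆ G.heavyCycles M (A ∪ B) e :=
      fun e C hC => ⟨hC.1.trans hAA, hC.2⟩
    specialize ih (fun C C' u v hC hC' => hsepM C C' u v (hC.trans hAA) (hC'.trans hAA))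
      (fun C hC => h2 C (hC.trans hAA))
    by_cases hfree : B.ncard = 3 ∧ ∀ m ∈ M, m ⊆ B → m = {u, v}
    · obtain ⟨L, e₁, e₂, hL, hhead, hlast, hmarks⟩ := ih k fun e he heA => by
        have := h3 e he (heA.trans hAA)
        have := Set.ncard_le_ncard (hheavy e) (Set.toFinite _)
        omega
      obtain ⟨L₁, L₂, rfl⟩ := List.append_of_mem (hmarks _ heM heA).1
      refine ⟨L₁ ++ {u, v} :: B :: {u, v} :: L₂, e₁, e₂,
        hL.insert hfree.1.le hsep.inter hsep.noCross, ?_, ?_, fun m hm hmAB' => ?_⟩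
      · rw [← hhead]
        simp
      · rw [← hlast]
        simp [List.getLast?_cons]
      · have hmA : m ⊆ A := by
          rcases hmAB m hm hmAB' with h | h
          · exact h
          · rw [hfree.2 m hm h]
            exact heA
        obtain ⟨h1, h4⟩ := hmarks m hm hmA
        refine ⟨?_, h4⟩
        simp only [List.mem_append, List.mem_cons] at h1 ⊢
        tauto
    · have hBheavy : B ∈ G.heavyCycles M (A ∪ B) {u, v} := ⟨hBA, hB, heB, hfree⟩
      have hke : k {u, v} + (G.heavyCycles M A {u, v}).ncard + 1 ≤ 2 := by
        have h1 := h3 _ heM (heA.trans hAA)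
        have h4 : (insert B (G.heavyCycles M A {u, v})).ncard ≤
            (G.heavyCycles M (A ∪ B) {u, v}).ncard :=
          Set.ncard_le_ncard (Set.insert_subset hBheavy (hheavy _)) (Set.toFinite _)
        rw [Set.ncard_insert_of_notMem (fun h => hBnot h.1) (Set.toFinite _)] at h4
        omega
      obtain ⟨L, e₁, hL, hhead, hlast, hmarks⟩ : ∃ L e₁, G.BagList L A ∧ L.head? = some e₁ ∧
          L.getLast? = some {u, v} ∧ ∀ m ∈ M, m ⊆ A → m ∈ L ∧
            (0 < k m → m = e₁ ∨ m = {u, v}) ∧ (0 < k {u, v} → {u, v} = e₁) ∧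
            (1 < k m → m = e₁ ∧ m = {u, v}) := by
        obtain ⟨L, e₁, e₂, hL, hhead, hlast, hmarks⟩ := ih
          (Function.update k {u, v} (k {u, v} + 1)) fun e he heA => by
          by_cases hee : e = {u, v}
          · subst hee
            rw [Function.update_self]
            omega
          · rw [Function.update_of_ne hee]
            have := h3 e he (heA.trans hAA)
            have := Set.ncard_le_ncard (hheavy e) (Set.toFinite _)
            omega
        have hkey : ∀ m ∈ M, m ⊆ A → m ∈ L ∧ (0 < k m → m = e₁ ∨ m = e₂) ∧
            (0 < k {u, v} → {u, v} = e₁ ∧ {u, v} = e₂) ∧ (1 < k m → m = e₁ ∧ m = e₂) := by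
          intro m hm hmA
          obtain ⟨h1, h4, h5⟩ := hmarks m hm hmA
          have hle : k m ≤ Function.update k {u, v} (k {u, v} + 1) m := by
            by_cases hme : m = {u, v}
            · subst hme
              simp
            · rw [Function.update_of_ne hme]
          refine ⟨h1, fun h => h4 (by omega), fun h => (hmarks _ heM heA).2.2 ?_,
            fun h => h5 (by omega)⟩
          rw [Function.update_self]
          omega
        -- The reserved end may be the first bag; the list is then reversed, so that `B` is always
        -- attached at the last bag.
        rcases (hmarks _ heM heA).2.1 (by simp) with h | h
        · subst h
          refine ⟨L.reverse, e₂, hL.reverse, by simpa using hlast, by simpa using hhead,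
            fun m hm hmA => ?_⟩
          obtain ⟨h1, h4, h5, h6⟩ := hkey m hm hmA
          exact ⟨by simpa using h1, fun h => (h4 h).symm, fun h => (h5 h).2, fun h => (h6 h).symm⟩
        · subst h
          refine ⟨L, e₁, hL, hhead, hlast, fun m hm hmA => ?_⟩
          obtain ⟨h1, h4, h5, h6⟩ := hkey m hm hmA
          exact ⟨h1, h4, fun h => (h5 h).1, h6⟩
      obtain ⟨a, b, hab, ha, hb, hne, hmB⟩ :=
        hB.exists_second_edge hM (h2 B hBA hB) huA.2 hvA.2 heM
      obtain ⟨LB, L', L'', hLB, hB1, hB2⟩ := hB.exists_bagList huv huA.2 hvA.2 hab ha hb hne.symm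
      obtain ⟨L₁, rfl⟩ : ∃ L₁, L = L₁ ++ [{u, v}] := by
        obtain ⟨L₁, h⟩ := List.getLast?_eq_some_iff.1 hlast
        exact ⟨L₁, h⟩
      subst hB1
      refine ⟨L₁ ++ {u, v} :: L', e₁, {a, b}, hL.glue hLB hsep.inter.le hsep.noCross, ?_, ?_,
        fun m hm hmAB' => ?_⟩
      · rw [← hhead]
        simp
      · rw [hB2]
        simp
      · by_cases hmA : m ⊆ A
        · obtain ⟨h1, h4, h5, h6⟩ := hmarks m hm hmA
          by_cases hme : m = {u, v}
          · subst hme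
            exact ⟨by simp, fun h => Or.inl (h5 h), fun h => by omega⟩
          · exact ⟨List.mem_append.2 (Or.inl ((List.mem_append.1 h1).resolve_right
              (by simpa using hme))), fun h => Or.inl ((h4 h).resolve_right hme),
              fun h => absurd (h6 h).2 hme⟩
        · have hmB' := (hmAB m hm hmAB').resolve_left hmA
          obtain rfl := (hmB m hm hmB').resolve_left (fun h => hmA (h ▸ heA))
          refine ⟨?_, fun _ => Or.inr rfl, fun h => ?_⟩
          · rw [hB2]
            simp
          -- `B` is heavy for `ab` too, since it also carries the mark `uv`. So at most one end is
          -- reserved for `ab`, and the case of two does not arise.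
          · have h7 := h3 _ hm hmAB'
            have h8 : B ∈ G.heavyCycles M (A ∪ B) {a, b} :=
              ⟨hBA, hB, hmB', fun h => hne (h.2 _ heM heB).symm⟩
            have h9 : 0 < (G.heavyCycles M (A ∪ B) {a, b}).ncard :=
              (Set.ncard_pos (Set.toFinite _)).2 ⟨B, h8⟩
            omega

end PathOfCycles

/-! ### Simplicial triangles and the number of heavy cycles in a path of cycles -/

section PathOfCycles

variable {V : Type u} {G : SimpleGraph V} {A C C' : Set V} {u v x : V}

/-- A simplicial vertex lies in at most one induced cycle. -/
theorem IsInducedCycle.eq_of_isClique_neighborSet [Finite V]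
    (hK : ∀ K : Set V, G.IsClique K → K.ncard ≤ 3) (hC : G.IsInducedCycle C)
    (hC' : G.IsInducedCycle C') (hx : G.IsClique (G.neighborSet x)) (hxC : x ∈ C) (hxC' : x ∈ C') :
    C = C' := by
  obtain ⟨y, hy, z, hz, hyz, hxy, hxz, -⟩ := hC.exists_neighbors hxC
  obtain ⟨y', hy', z', hz', hyz', hxy', hxz', -⟩ := hC'.exists_neighbors hxC'
  -- A third neighbour of the simplicial vertex `x` would give a clique of four vertices. So both
  -- cycles contain, and therefore equal, the triangle on `x` and its two neighbours.
  have key : ∀ w, G.Adj x w → w = y ∨ w = z := by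
    intro w hw
    by_contra! hcon
    have hyw := hx hxy hw hcon.1.symm
    have hzw := hx hxz hw hcon.2.symm
    have h1 : G.IsClique {x, y, z, w} := by
      have hyz' := hx hxy hxz hyz
      simp only [isClique_iff, Set.pairwise_insert, Set.mem_insert_iff, Set.mem_singleton_iff,
        forall_eq_or_imp, forall_eq, Set.pairwise_singleton]
      simp [hxy, hxz, hw, hyz', hyw, hzw, G.adj_comm]
    have h2 := hK _ h1
    rw [Set.ncard_insert_of_notMem (by simp [hxy.ne, hxz.ne, hw.ne]),
      Set.ncard_insert_of_notMem (by simp [hyz, hyw.ne]), Set.ncard_pair hzw.ne] at h2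
    omega
  have hT := isInducedCycle_triangle hxy hxz (hx hxy hxz hyz)
  have hset : ({x, y, z} : Set V) = {x, y', z'} := by
    rcases key y' hxy' with rfl | rfl <;> rcases key z' hxz' with rfl | rfl
    · exact absurd rfl hyz'
    · rfl
    · exact congrArg (insert x) (Set.pair_comm _ _)
    · exact absurd rfl hyz'
  have h1 := hT.eq_of_subset hC (by rintro w (rfl | rfl | rfl) <;> assumption)
  have h2 := hT.eq_of_subset hC' (by rw [hset]; rintro w (rfl | rfl | rfl) <;> assumption)
  exact h1.symm.trans h2

theorem toFinset_mem_chordlessCyclesThrough [Fintype C] :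
    C.toFinset ∈ G.chordlessCyclesThrough s(u, v) ↔ G.IsInducedCycle C ∧ {u, v} ⊆ C := by
  simp only [chordlessCyclesThrough, Set.mem_ofPred_eq, IsChordlessCycle]
  rw [Set.coe_toFinset]
  simp [IsInducedCycle, Set.insert_subset_iff]

theorem IsInducedCycle.notMem_of_isEdgeSeparator [Fintype V]
    (hK : ∀ K : Set V, G.IsClique K → K.ncard ≤ 3) (hC : G.IsInducedCycle C)
    (hx : G.IsClique (G.neighborSet x)) (hxC : x ∈ C) (h : G.IsEdgeSeparator s(u, v)) :
    x ∉ ({u, v} : Set V) := by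
  classical
  intro hxuv
  obtain ⟨D, D', hD, hD', hne⟩ := (Set.one_lt_ncard_iff (Set.toFinite _)).1 h.2
  have key : ∀ D ∈ G.chordlessCyclesThrough s(u, v), (D : Set V) = C := by
    intro D hD
    rw [← Finset.toFinset_coe D, toFinset_mem_chordlessCyclesThrough] at hD
    exact hD.1.eq_of_isClique_neighborSet hK hC hx (hD.2 hxuv) hxC
  exact hne (Finset.coe_injective ((key D hD).trans (key D' hD').symm))

/-- The only edge separator of a simplicial triangle is the edge opposite to the simplicial
vertex. -/
theorem IsInducedCycle.pair_eq_of_isEdgeSeparator [Fintype V]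
    (hK : ∀ K : Set V, G.IsClique K → K.ncard ≤ 3) (hC : G.IsInducedCycle C)
    (hx : G.IsClique (G.neighborSet x)) (hxC : x ∈ C) (hcard : C.ncard = 3) {a b : V}
    (h : G.IsEdgeSeparator s(u, v)) (huvC : {u, v} ⊆ C) (h' : G.IsEdgeSeparator s(a, b))
    (habC : {a, b} ⊆ C) : ({a, b} : Set V) = {u, v} := by
  have huv : G.Adj u v := h.1
  have hab : G.Adj a b := h'.1
  have hxuv := hC.notMem_of_isEdgeSeparator hK hx hxC h
  have hxab := hC.notMem_of_isEdgeSeparator hK hx hxC h'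
  have hset : insert x {u, v} = C := by
    refine Set.eq_of_subset_of_ncard_le (Set.insert_subset hxC huvC) ?_ (Set.toFinite _)
    rw [Set.ncard_insert_of_notMem hxuv (Set.toFinite _), Set.ncard_pair huv.ne, hcard]
  refine Set.eq_of_subset_of_ncard_le (fun w hw => ?_) ?_ (Set.toFinite _)
  · have hwC := habC hw
    rw [← hset] at hwC
    exact hwC.resolve_left fun h => hxab (h ▸ hw)
  · rw [Set.ncard_pair hab.ne]
    exact ncard_pair_le _ _

/-- A simplicial triangle has at most one edge separator, so it is never heavy. Of `m ≥ 3` cycles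
through an edge at least `m - 2` are simplicial triangles, which leaves at most two heavy ones. -/
theorem IsPathOfCycles.ncard_heavyCycles_le [Fintype V] (hH : G.IsPathOfCycles)
    (hK : ∀ K : Set V, G.IsClique K → K.ncard ≤ 3) {M : Set (Set V)}
    (hM : ∀ m ∈ M, ∃ u v, m = {u, v} ∧ G.IsEdgeSeparator s(u, v))
    (h : G.IsEdgeSeparator s(u, v)) : (G.heavyCycles M A {u, v}).ncard ≤ 2 := by
  classical
  have hle : ∀ R : Set (Finset V), (∀ C ∈ G.heavyCycles M A {u, v}, C.toFinset ∈ R) →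
      (G.heavyCycles M A {u, v}).ncard ≤ R.ncard := fun R hR =>
    Set.ncard_le_ncard_of_injOn (fun C => C.toFinset) hR
      (fun C _ C' _ h => Set.toFinset_inj.1 h) (Set.toFinite _)
  have hmem : ∀ C ∈ G.heavyCycles M A {u, v}, C.toFinset ∈ G.chordlessCyclesThrough s(u, v) :=
    fun C hC => toFinset_mem_chordlessCyclesThrough.2 ⟨hC.2.1, hC.2.2.1⟩
  by_cases h3 : 3 ≤ (G.chordlessCyclesThrough s(u, v)).ncard
  · have h4 := hH.2.2 s(u, v) h.1 h3
    have h5 := Set.ncard_sdiff (s := {C ∈ G.chordlessCyclesThrough s(u, v) |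
      G.IsSimplicialTriangle C}) (t := G.chordlessCyclesThrough s(u, v)) (fun C hC => hC.1)
      (Set.toFinite _)
    refine (hle (_ \ _) fun C hC => ⟨hmem C hC, fun hsimp => hC.2.2.2 ?_⟩).trans
      (h5.le.trans (by omega))
    obtain ⟨-, hN, x, hxC, hx⟩ := hsimp
    rw [Set.mem_toFinset] at hxC
    have hcard : C.ncard = 3 := by
      rw [← hN.card_eq, Set.ncard_eq_toFinset_card']
    refine ⟨hcard, fun m hm hmC => ?_⟩
    obtain ⟨a, b, rfl, h'⟩ := hM m hm
    exact hC.2.1.pair_eq_of_isEdgeSeparator hK hx hxC hcard h hC.2.2.1 h' hmC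
  · exact (hle _ hmem).trans (by omega)

theorem IsPathOfCycles.exists_bagList [Fintype V] (hH : G.IsPathOfCycles) :
    ∃ L, G.BagList L Set.univ := by
  classical
  have hT := isTreeOfCycles_iff.1 hH.1
  have hK : ∀ K : Set V, G.IsClique K → K.ncard ≤ 3 :=
    fun K => hT.ncard_le_of_isClique K (Set.subset_univ _)
  have hpair : ∀ {a b c d : V}, ({a, b} : Set V) = {c, d} ↔ s(a, b) = s(c, d) := by
    intro a b c d
    rw [Set.pair_eq_pair_iff, Sym2.eq_iff]
  have hsub : ∀ {a b : V} {C : Set V}, ({a, b} : Set V) ⊆ C → ∀ x ∈ s(a, b), x ∈ C.toFinset := by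
    simp [Set.insert_subset_iff]
  -- The marks are the edge separators, and no ends are reserved.
  have key := hT.exists_marked_bagList {m | ∃ u v, m = {u, v} ∧ G.IsEdgeSeparator s(u, v)}
    ?_ ?_ ?_ (fun _ => 0) ?_
  · obtain ⟨L, _, _, hL, _⟩ := key
    exact ⟨L, hL⟩
  · rintro m ⟨u, v, rfl, h⟩
    exact ⟨u, v, h.1, rfl⟩
  · intro C C' u v _ _ hC hC' hne huv h h'
    refine ⟨u, v, rfl, huv, ?_⟩
    exact (Set.one_lt_ncard_iff (Set.toFinite (G.chordlessCyclesThrough s(u, v)))).2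
      ⟨C.toFinset, C'.toFinset, toFinset_mem_chordlessCyclesThrough.2 ⟨hC, h⟩,
        toFinset_mem_chordlessCyclesThrough.2 ⟨hC', h'⟩, by simpa using hne⟩
  · rintro C - hC e₁ ⟨u₁, v₁, rfl, h1⟩ e₂ ⟨u₂, v₂, rfl, h2⟩ e₃ ⟨u₃, v₃, rfl, h3⟩ hs1 hs2 hs3
    by_contra! hcon
    rw [Ne, Ne, Ne, hpair, hpair, hpair] at hcon
    have h4 := hH.2.1 C.toFinset (by rw [IsChordlessCycle, Set.coe_toFinset]; exact hC)
    have h5 := three_le_ncard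
      (s := {e : Sym2 V | G.IsEdgeSeparator e ∧ ∀ x ∈ e, x ∈ C.toFinset})
      ⟨h1, hsub hs1⟩ ⟨h2, hsub hs2⟩ ⟨h3, hsub hs3⟩ hcon.1 hcon.2.1 hcon.2.2
    omega
  · rintro m ⟨u, v, rfl, h⟩ -
    rw [zero_add]
    exact hH.ncard_heavyCycles_le hK (fun _ hm => hm) h

end PathOfCycles

/-! ### Path decompositions from lists of bags -/

theorem pathGraph_adj_iff {n : ℕ} {i j : Fin n} :
    (pathGraph n).Adj i j ↔ (j : ℕ) = i + 1 ∨ (i : ℕ) = j + 1 := by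
  rw [pathGraph_adj]
  omega

theorem connectedOn_pathGraph {n : ℕ} {S : Set (Fin n)} (hne : S.Nonempty)
    (hS : ∀ i j k, i ≤ j → j ≤ k → i ∈ S → k ∈ S → j ∈ S) : (pathGraph n).ConnectedOn S := by
  refine ⟨hne, fun T hT ⟨x, hx⟩ => hT.1.antisymm fun y hy => ?_⟩
  have up : ∀ d, ∀ i ∈ T, ∀ j ∈ S, (j : ℕ) = i + d → j ∈ T := by
    intro d
    induction d with
    | zero =>
      intro i hi j hj hij
      rwa [show j = i from Fin.ext (by omega)]
    | succ d ih =>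
      intro i hi j hj hij
      have hlt := j.2
      have hmid : (⟨i + 1, by omega⟩ : Fin n) ∈ S :=
        hS i _ j (Fin.le_def.2 (by simp)) (Fin.le_def.2 (by simp; omega)) (hT.1 hi) hj
      exact ih _ (hT.2 i hi _ hmid (pathGraph_adj_iff.2 (Or.inl rfl))) j hj (by simp; omega)
  have down : ∀ d, ∀ i ∈ T, ∀ j ∈ S, (i : ℕ) = j + d → j ∈ T := by
    intro d
    induction d with
    | zero =>
      intro i hi j hj hij
      rwa [show j = i from Fin.ext (by omega)]
    | succ d ih =>
      intro i hi j hj hij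
      have hlt := i.2
      have hmid : (⟨i - 1, by omega⟩ : Fin n) ∈ S :=
        hS j _ i (Fin.le_def.2 (by simp; omega)) (Fin.le_def.2 (by simp)) hj (hT.1 hi)
      exact ih _ (hT.2 i hi _ hmid (pathGraph_adj_iff.2 (Or.inr (by simp; omega)))) j hj
        (by simp; omega)
  rcases le_total (x : ℕ) y with h | h
  · exact up (y - x) x hx y hy (by omega)
  · exact down (x - y) x hx y hy (by omega)

theorem Reachable.mem_of_closed {V : Type*} {G : SimpleGraph V} {X : Set V} {u v : V}
    (h : G.Reachable u v) (hX : ∀ x ∈ X, ∀ y, G.Adj x y → y ∈ X) (hu : u ∈ X) : v ∈ X := by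
  obtain ⟨p⟩ := h
  induction p with
  | nil => exact hu
  | cons hadj _ ih => exact ih (hX _ hu _ hadj)

/-- A graph is acyclic if every edge is the only edge that crosses some cut. -/
theorem isAcyclic_of_forall_exists_cut {V : Type*} {G : SimpleGraph V}
    (h : ∀ s t, G.Adj s t → (∃ X : Set V, s ∈ X ∧ t ∉ X ∧
      ∀ x ∈ X, ∀ y ∉ X, G.Adj x y → x = s ∧ y = t)) : G.IsAcyclic := by
  rw [isAcyclic_iff_forall_adj_isBridge]
  intro s t hst
  obtain ⟨X, hs, ht, hX⟩ := h s t hst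
  rw [isBridge_iff]
  intro hr
  refine ht (hr.mem_of_closed (fun x hx y hxy => ?_) hs)
  by_contra hy
  rw [deleteEdges_adj] at hxy
  obtain ⟨rfl, rfl⟩ := hX x hx y hy hxy.1
  exact hxy.2 rfl

/-- Every edge of a tree is the only edge that crosses some cut. -/
theorem IsAcyclic.exists_cut {V : Type*} {G : SimpleGraph V} (hG : G.IsAcyclic) {s t : V}
    (hst : G.Adj s t) : ∃ X : Set V, s ∈ X ∧ t ∉ X ∧
      ∀ x ∈ X, ∀ y ∉ X, G.Adj x y → x = s ∧ y = t := by
  have hb := isBridge_iff.1 (isAcyclic_iff_forall_adj_isBridge.1 hG hst)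
  refine ⟨{x | (G.deleteEdges {s(s, t)}).Reachable s x}, Reachable.refl _, hb,
    fun x hx y hy hxy => ?_⟩
  by_contra hcon
  refine hy (Reachable.trans hx (Adj.reachable ?_))
  rw [deleteEdges_adj]
  refine ⟨hxy, fun h => ?_⟩
  rcases Sym2.eq_iff.1 h with h | ⟨rfl, rfl⟩
  · exact hcon h
  · exact hb hx

theorem isTree_pathGraph {n : ℕ} (hn : 0 < n) : (pathGraph n).IsTree := by
  obtain ⟨n, rfl⟩ : ∃ m, n = m + 1 := ⟨n - 1, by omega⟩
  refine ⟨pathGraph_connected n, isAcyclic_of_forall_exists_cut fun s t hst => ?_⟩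
  rcases pathGraph_adj_iff.1 hst with h | h
  · refine ⟨Set.Iic s, Set.mem_Iic.2 le_rfl, fun h' => ?_, fun x hx y hy hxy => ?_⟩
    · have := Fin.le_def.1 (Set.mem_Iic.1 h')
      omega
    · have h1 := Fin.le_def.1 (Set.mem_Iic.1 hx)
      have h2 := Fin.lt_def.1 (not_le.1 fun h => hy (Set.mem_Iic.2 h))
      rw [pathGraph_adj_iff] at hxy
      exact ⟨Fin.ext (by omega), Fin.ext (by omega)⟩
  · refine ⟨Set.Ici s, Set.mem_Ici.2 le_rfl, fun h' => ?_, fun x hx y hy hxy => ?_⟩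
    · have := Fin.le_def.1 (Set.mem_Ici.1 h')
      omega
    · have h1 := Fin.le_def.1 (Set.mem_Ici.1 hx)
      have h2 := Fin.lt_def.1 (not_le.1 fun h => hy (Set.mem_Ici.2 h))
      rw [pathGraph_adj_iff] at hxy
      exact ⟨Fin.ext (by omega), Fin.ext (by omega)⟩

theorem BagList.exists_treeDecomposition {V : Type u} [Fintype V] [Nonempty V]
    {G H : SimpleGraph V} {L : List (Set V)} (h : H.BagList L Set.univ) (hGH : G ≤ H) :
    ∃ D : TreeDecomposition G, D.IsPathDecomposition ∧ D.width ≤ 2 := by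
  classical
  have hget : ∀ X ∈ L, ∃ i : Fin L.length, L.get i = X := fun X hX => List.get_of_mem hX
  have hpos : 0 < L.length := by
    obtain ⟨X, hX, -⟩ := h.vertex (Classical.arbitrary V) trivial
    exact List.length_pos_of_mem hX
  have hsplit : ∀ j : Fin L.length, L = L.take j ++ L.get j :: L.drop (j + 1) := by
    intro j
    simp
  let D : TreeDecomposition G :=
    { Node := Fin L.length
      tree := pathGraph L.length
      isTree := isTree_pathGraph hpos
      bag := fun i => (L.get i).toFinset
      exists_mem_bag := fun v => by
        obtain ⟨X, hX, hv⟩ := h.vertex v trivial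
        obtain ⟨i, rfl⟩ := hget X hX
        exact ⟨i, by simpa using hv⟩
      exists_edge_bag := fun u v huv => by
        obtain ⟨X, hX, hu, hv⟩ := h.edge u trivial v trivial (hGH huv)
        obtain ⟨i, rfl⟩ := hget X hX
        exact ⟨i, by simpa using hu, by simpa using hv⟩
      connected_bags := fun v => by
        rw [connectedOn_iff]
        refine connectedOn_pathGraph ?_ fun i j k hij hjk hi hk => ?_
        · obtain ⟨X, hX, hv⟩ := h.vertex v trivial
          obtain ⟨i, rfl⟩ := hget X hX
          exact ⟨i, by simpa using hv⟩
        · by_cases hij' : i = j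
          · exact hij' ▸ hi
          by_cases hjk' : j = k
          · exact hjk' ▸ hk
          have h1 : (i : ℕ) < j := lt_of_le_of_ne hij (fun h => hij' (Fin.ext h))
          have h2 : (j : ℕ) < k := lt_of_le_of_ne hjk (fun h => hjk' (Fin.ext h))
          have hi' : v ∈ L.get i := by simpa using hi
          have hk' : v ∈ L.get k := by simpa using hk
          have := h.contiguous _ _ _ (hsplit j) v
            ⟨L.get i, List.mem_take_iff_getElem.2 ⟨i, by have := i.2; omega, rfl⟩, hi'⟩
            ⟨L.get k, List.mem_drop_iff_getElem.2 ⟨k - (j + 1), by have := k.2; omega, by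
              simp only [List.get_eq_getElem]
              congr 1
              omega⟩, hk'⟩
          simpa using this }
  refine ⟨D, ⟨L.length, ⟨Iso.refl⟩⟩, ?_⟩
  have : (@Finset.univ D.Node D.fintypeNode).sup (fun x => (D.bag x).card) ≤ 3 := by
    refine Finset.sup_le fun i _ => ?_
    rw [← Set.ncard_coe_finset]
    have : ((D.bag i : Finset V) : Set V) = L.get i := Set.coe_toFinset _
    rw [this]
    exact h.card _ (List.get_mem L i)
  unfold TreeDecomposition.width
  omega

/-! ### Cuts of trees and tree decompositions -/

/-- `st` is the only edge of `T` from `X` to its complement. -/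
structure IsCut {N : Type*} (T : SimpleGraph N) (X : Set N) (s t : N) : Prop where
  mem : s ∈ X
  notMem : t ∉ X
  eq : ∀ x ∈ X, ∀ y ∉ X, T.Adj x y → x = s ∧ y = t

section Cut

variable {V : Type u} {G : SimpleGraph V} {N : Type*} {T : SimpleGraph N} {X S U : Set N}
  {s t : N} {bag : N → Finset V}

theorem IsCut.symm (h : T.IsCut X s t) : T.IsCut Xᶜ t s :=
  ⟨h.notMem, fun h' => h' h.mem, fun x hx y hy hxy =>
    (h.eq y (by_contra fun h' => hy h') x hx hxy.symm).symm⟩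

/-- Any detour through `X` leaves and returns at `t`. A closed part containing `t` can be enlarged
by all of `U ∩ X`; one without `t` has no neighbours in `X`. -/
theorem ConnectedOn.diff_of_isCut (hU : T.ConnectedOn U) (h : T.IsCut X s t)
    (hne : (U \ X).Nonempty) : T.ConnectedOn (U \ X) := by
  refine ⟨hne, fun W hW hWne => ?_⟩
  by_cases htW : t ∈ W
  · have hcl : T.ClosedIn U (W ∪ (U ∩ X)) := by
      refine ⟨Set.union_subset (hW.1.trans Set.sdiff_subset) Set.inter_subset_left, ?_⟩
      rintro x (hx | hx) y hy hxy
      · by_cases hyX : y ∈ X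
        · exact Or.inr ⟨hy, hyX⟩
        · exact Or.inl (hW.2 x hx y ⟨hy, hyX⟩ hxy)
      · by_cases hyX : y ∈ X
        · exact Or.inr ⟨hy, hyX⟩
        · rw [(h.eq x hx.2 y hyX hxy).2]
          exact Or.inl htW
    have hWU := hU.2 _ hcl (hWne.mono Set.subset_union_left)
    refine hW.1.antisymm fun y hy => ?_
    have : y ∈ W ∪ (U ∩ X) := by
      rw [hWU]
      exact hy.1
    exact this.resolve_right fun h' => hy.2 h'.2
  · have hcl : T.ClosedIn U W := by
      refine ⟨hW.1.trans Set.sdiff_subset, fun x hx y hy hxy => ?_⟩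
      by_cases hyX : y ∈ X
      · exact absurd ((h.eq y hyX x (hW.1 hx).2 hxy.symm).2 ▸ hx) htW
      · exact hW.2 x hx y ⟨hy, hyX⟩ hxy
    have := hU.2 W hcl hWne
    subst this
    exact hW.1.antisymm Set.sdiff_subset

/-- The bags at the nodes in `S` form a tree decomposition of `G` over `T[S]`. -/
structure DecomposesOn (G : SimpleGraph V) (T : SimpleGraph N) (bag : N → Finset V) (S : Set N) :
    Prop where
  connected : T.ConnectedOn S
  vertex : ∀ v, ∃ x ∈ S, v ∈ bag x
  edge : ∀ u v, G.Adj u v → ∃ x ∈ S, u ∈ bag x ∧ v ∈ bag x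
  bags : ∀ v, T.ConnectedOn (S ∩ {x | v ∈ bag x})

theorem TreeDecomposition.decomposesOn (D : TreeDecomposition G) :
    G.DecomposesOn D.tree D.bag Set.univ where
  connected := by
    rw [← connectedOn_iff]
    exact (Iso.connected_iff (induceUnivIso D.tree)).2 D.isTree.1
  vertex := fun v => by simpa using D.exists_mem_bag v
  edge := fun u v huv => by simpa using D.exists_edge_bag u v huv
  bags := fun v => by
    rw [Set.univ_inter]
    exact connectedOn_iff.1 (D.connected_bags v)

theorem DecomposesOn.mem_inter [DecidableEq V] (hD : G.DecomposesOn T bag S) (h : T.IsCut X s t)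
    {x y : N} {v : V} (hx : x ∈ S) (hy : y ∈ S) (hxX : x ∈ X) (hyX : y ∉ X) (hvx : v ∈ bag x)
    (hvy : v ∈ bag y) : v ∈ bag s ∩ bag t := by
  obtain ⟨a, ha, b, hb, hab⟩ := (hD.bags v).exists_adj (T := S ∩ {x | v ∈ bag x} ∩ X)
    Set.inter_subset_left ⟨x, ⟨hx, hvx⟩, hxX⟩ ⟨y, ⟨hy, hvy⟩, fun h' => hyX h'.2⟩
  obtain ⟨rfl, rfl⟩ := h.eq a ha.2 b (fun h' => hb.2 ⟨hb.1, h'⟩) hab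
  exact Finset.mem_inter.2 ⟨ha.1.2, hb.1.2⟩

theorem DecomposesOn.diff_of_isCut (hD : G.DecomposesOn T bag S) (h : T.IsCut X s t)
    (ht : t ∈ S) (hsub : ∀ x ∈ S ∩ X, bag x ⊆ bag t) (hcard : ∀ x ∈ S ∩ X, (bag x).card ≤ 1) :
    G.DecomposesOn T bag (S \ X) := by
  have hv : ∀ v, ∃ x ∈ S \ X, v ∈ bag x := by
    intro v
    obtain ⟨x, hx, hv⟩ := hD.vertex v
    by_cases hxX : x ∈ X
    · exact ⟨t, ⟨ht, h.notMem⟩, hsub x ⟨hx, hxX⟩ hv⟩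
    · exact ⟨x, ⟨hx, hxX⟩, hv⟩
  refine ⟨hD.connected.diff_of_isCut h ⟨t, ht, h.notMem⟩, hv, fun u v huv => ?_, fun v => ?_⟩
  · obtain ⟨x, hx, hxu, hxv⟩ := hD.edge u v huv
    refine ⟨x, ⟨hx, fun hxX => huv.ne ?_⟩, hxu, hxv⟩
    exact Finset.card_le_one.1 (hcard x ⟨hx, hxX⟩) u hxu v hxv
  · obtain ⟨x, hx, hxv⟩ := hv v
    have := (hD.bags v).diff_of_isCut h ⟨x, ⟨hx.1, hxv⟩, hx.2⟩
    convert this using 1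
    ext y
    simp
    tauto

/-- The set `Z` of vertices occurring on both sides of the cut has at most one element, so `G - Z`
is connected and lives on one side. The bags on the other side lie in `Z`, and that side can be
deleted. -/
theorem DecomposesOn.exists_ssubset [Fintype V] (hG : G.IsTwoConnected)
    (hD : G.DecomposesOn T bag S) (h : T.IsCut X s t) (hs : s ∈ S) (ht : t ∈ S)
    (hst : ∀ u ∈ bag s, u ∈ bag t → ∀ v ∈ bag s, v ∈ bag t → u = v) :
    ∃ S' ⊂ S, G.DecomposesOn T bag S' := by
  classical
  set Z : Set V := {v | (∃ x ∈ S ∩ X, v ∈ bag x) ∧ ∃ y ∈ S \ X, v ∈ bag y} with hZ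
  have hZst : ∀ v ∈ Z, v ∈ bag s ∧ v ∈ bag t := fun v ⟨⟨x, hx, hvx⟩, ⟨y, hy, hvy⟩⟩ =>
    Finset.mem_inter.1 (hD.mem_inter h hx.1 hy.1 hx.2 hy.2 hvx hvy)
  have hZ1 : Z.Subsingleton := fun u hu v hv =>
    hst u (hZst u hu).1 (hZst u hu).2 v (hZst v hv).1 (hZst v hv).2
  have hconn : G.ConnectedOn Zᶜ := by
    rcases hZ1.eq_empty_or_singleton with h | ⟨z, h⟩
    · rw [h, Set.compl_empty]
      exact hG.connectedOn_univ
    · rw [h]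
      exact hG.connectedOn_compl z
  have hcl : G.ClosedIn Zᶜ ({v | ∃ x ∈ S ∩ X, v ∈ bag x} \ Z) := by
    refine ⟨fun v hv => hv.2, fun u hu v hv huv => ⟨?_, hv⟩⟩
    obtain ⟨x, hx, hxu, hxv⟩ := hD.edge u v huv
    by_cases hxX : x ∈ X
    · exact ⟨x, ⟨hx, hxX⟩, hxv⟩
    · exact absurd ⟨hu.1, x, ⟨hx, hxX⟩, hxu⟩ hu.2
  have hsmall : ∀ x, (∀ v ∈ bag x, v ∈ Z) → (bag x).card ≤ 1 := fun x hx =>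
    Finset.card_le_one.2 fun u hu v hv => hZ1 (hx u hu) (hx v hv)
  by_cases hne : ({v | ∃ x ∈ S ∩ X, v ∈ bag x} \ Z).Nonempty
  · have heq := hconn.2 _ hcl hne
    have hsub : ∀ x ∈ S ∩ Xᶜ, ∀ v ∈ bag x, v ∈ Z := by
      intro x hx v hv
      by_contra hvZ
      have hv' : v ∈ {v | ∃ x ∈ S ∩ X, v ∈ bag x} \ Z := heq ▸ hvZ
      exact hvZ ⟨hv'.1, x, hx, hv⟩
    refine ⟨S \ Xᶜ, ⟨Set.sdiff_subset, fun h' => (h' ht).2 h.notMem⟩,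
      hD.diff_of_isCut h.symm hs (fun x hx v hv => (hZst v (hsub x hx v hv)).1)
        fun x hx => hsmall x (hsub x hx)⟩
  · have hsub : ∀ x ∈ S ∩ X, ∀ v ∈ bag x, v ∈ Z := by
      intro x hx v hv
      by_contra hvZ
      exact hne ⟨v, ⟨x, hx, hv⟩, hvZ⟩
    refine ⟨S \ X, ⟨Set.sdiff_subset, fun h' => (h' hs).2 h.mem⟩,
      hD.diff_of_isCut h ht (fun x hx v hv => (hZst v (hsub x hx v hv)).2)
        fun x hx => hsmall x (hsub x hx)⟩

/-- In a suitable part of a tree decomposition of a `2`-connected graph, the bags of adjacent nodes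
have at least two vertices in common. -/
theorem DecomposesOn.exists_adhesion [Fintype V] [DecidableEq V] [Finite N]
    (hG : G.IsTwoConnected) (hT : T.IsAcyclic) : ∀ n, ∀ S : Set N, S.ncard = n →
    G.DecomposesOn T bag S → ∃ S, G.DecomposesOn T bag S ∧
      ∀ s ∈ S, ∀ t ∈ S, T.Adj s t → 2 ≤ (bag s ∩ bag t).card := by
  intro n
  induction n using Nat.strong_induction_on with
  | _ n ih =>
    intro S hn hD
    by_cases hgood : ∀ s ∈ S, ∀ t ∈ S, T.Adj s t → 2 ≤ (bag s ∩ bag t).card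
    · exact ⟨S, hD, hgood⟩
    push Not at hgood
    obtain ⟨s, hs, t, ht, hst, hlt⟩ := hgood
    obtain ⟨X, hX⟩ := hT.exists_cut hst
    obtain ⟨S', hS', hD'⟩ := hD.exists_ssubset hG ⟨hX.1, hX.2.1, hX.2.2⟩ hs ht
      fun u hu hu' v hv hv' => Finset.card_le_one.1 (by omega) u (Finset.mem_inter.2 ⟨hu, hu'⟩) v
        (Finset.mem_inter.2 ⟨hv, hv'⟩)
    exact ih _ (hn ▸ Set.ncard_lt_ncard hS' (Set.toFinite _)) S' rfl hD'

theorem TreeDecomposition.card_bag_le (D : TreeDecomposition G) {k : ℕ} (h : D.width ≤ k)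
    (x : D.Node) : (D.bag x).card ≤ k + 1 := by
  have h1 := Finset.le_sup (f := fun x => (D.bag x).card) (@Finset.mem_univ _ D.fintypeNode x)
  unfold TreeDecomposition.width at h
  omega

/-- With bags of at most two vertices and adjacent bags sharing two, all remaining bags are equal,
so the graph would have at most two vertices. -/
theorem IsTwoConnected.two_le_width [Fintype V] (hG : G.IsTwoConnected) (D : TreeDecomposition G) :
    2 ≤ D.width := by
  classical
  have := D.fintypeNode
  by_contra! hlt
  have hcard := D.card_bag_le (Nat.lt_succ_iff.1 hlt)
  obtain ⟨S, hD, hadh⟩ := DecomposesOn.exists_adhesion hG D.isTree.2 _ _ rfl D.decomposesOn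
  obtain ⟨x, hx⟩ := hD.connected.1
  have heq : ∀ s ∈ S, ∀ t ∈ S, D.tree.Adj s t → D.bag s = D.bag t := by
    intro s hs t ht hst
    have h2 := hadh s hs t ht hst
    have h3 := Finset.eq_of_subset_of_card_le (Finset.inter_subset_left (s₁ := D.bag s)
      (s₂ := D.bag t)) ((hcard s).trans h2)
    have h4 := Finset.eq_of_subset_of_card_le (Finset.inter_subset_right (s₁ := D.bag s)
      (s₂ := D.bag t)) ((hcard t).trans h2)
    exact h3.symm.trans h4
  have hall := hD.connected.2 {y ∈ S | D.bag y = D.bag x} ⟨fun y hy => hy.1,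
    fun y hy z hz hyz => ⟨hz, (heq y hy.1 z hz hyz).symm.trans hy.2⟩⟩ ⟨x, hx, rfl⟩
  have huniv : D.bag x = Finset.univ := by
    refine Finset.eq_univ_iff_forall.2 fun v => ?_
    obtain ⟨y, hy, hv⟩ := hD.vertex v
    rw [← hall] at hy
    exact hy.2 ▸ hv
  have h1 := hcard x
  rw [huniv, Finset.card_univ] at h1
  have := hG.1
  omega

end Cut

/-! ### Directed spaghetti decompositions of width two -/

section Spaghetti

variable {V : Type u} {G : SimpleGraph V}

theorem contiguous_map_range {n : ℕ} {b : ℕ → Set V} (h : ∀ i j k v, i < j → j < k → k < n →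
    v ∈ b i → v ∈ b k → v ∈ b j) : Contiguous ((List.range n).map b) := by
  intro L₁ X L₂ hL v ⟨Y, hY, hvY⟩ ⟨Z, hZ, hvZ⟩
  obtain ⟨i, hi, rfl⟩ := List.mem_iff_getElem.1 hY
  obtain ⟨k, hk, rfl⟩ := List.mem_iff_getElem.1 hZ
  have hlen := congrArg List.length hL
  simp only [List.length_map, List.length_range, List.length_append, List.length_cons] at hlen
  have key : ∀ (j : ℕ) (hj : j < n), (L₁ ++ X :: L₂)[j]? = some (b j) := by
    intro j hj
    rw [← hL]
    simp [hj]
  have h1 := key i (by omega)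
  have h2 := key L₁.length (by omega)
  have h3 := key (L₁.length + 1 + k) (by omega)
  rw [List.getElem?_append_left hi, List.getElem?_eq_getElem hi, Option.some_inj] at h1
  rw [List.getElem?_append_right le_rfl] at h2
  rw [List.getElem?_append_right (by omega)] at h3
  simp only [Nat.sub_self, List.getElem?_cons_zero, Option.some_inj] at h2
  rw [show L₁.length + 1 + k - L₁.length = k + 1 by omega, List.getElem?_cons_succ,
    List.getElem?_eq_getElem hk, Option.some_inj] at h3
  rw [h1] at hvY
  rw [h3] at hvZ
  rw [h2]
  exact h i _ _ v hi (by omega) (by omega) hvY hvZ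

/-- An acyclic graph, oriented with in- and outdegrees at most one and connected on `S`, is a path
on `S`. -/
theorem ConnectedOn.exists_directed_path {N : Type*} [Finite N] {T : SimpleGraph N} {A : Digraph N}
    {S : Set N} (hS : T.ConnectedOn S) (hT : T.IsAcyclic) (hA : IsOrientation T A)
    (hin : ∀ s ∈ S, ∀ s' ∈ S, ∀ t ∈ S, A.Adj s t → A.Adj s' t → s = s')
    (hout : ∀ s ∈ S, ∀ t ∈ S, ∀ t' ∈ S, A.Adj s t → A.Adj s t' → t = t') :
    ∃ (n : ℕ) (p : ℕ → N), (∀ x, x ∈ S ↔ ∃ i ≤ n, p i = x) ∧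
      (∀ i ≤ n, ∀ j ≤ n, p i = p j → i = j) ∧
      ∀ i j, i ≤ j → j ≤ n → T.Adj (p i) (p j) → j = i + 1 := by
  let P : ℕ → Prop := fun n => ∃ p : ℕ → N, (∀ i ≤ n, p i ∈ S) ∧
    (∀ i ≤ n, ∀ j ≤ n, p i = p j → i = j) ∧ ∀ i < n, A.Adj (p i) (p (i + 1))
  obtain ⟨n, ⟨p, hpS, hinj, hadj⟩, hmax⟩ : ∃ n, P n ∧ ¬ P (n + 1) := by
    by_contra! hcon
    have hall : ∀ n, P n := by
      intro n
      induction n with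
      | zero =>
        obtain ⟨x, hx⟩ := hS.1
        exact ⟨fun _ => x, fun _ _ => hx, fun i hi j hj _ => by omega, fun i hi => by omega⟩
      | succ n ih => exact hcon n ih
    obtain ⟨p, -, hinj, -⟩ := hall (Nat.card N)
    have hle := Nat.card_le_card_of_injective (fun i : Fin (Nat.card N + 1) => p i)
      (fun i j hij => Fin.ext (hinj i (by omega) j (by omega) hij))
    simp at hle
  -- A neighbour off the path would extend it at one end, against maximality, or give one of its
  -- nodes a second in- or out-neighbour.
  have hcl : T.ClosedIn S {x | ∃ i ≤ n, p i = x} := by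
    refine ⟨?_, ?_⟩
    · rintro x ⟨i, hi, rfl⟩
      exact hpS i hi
    · rintro x ⟨i, hi, rfl⟩ y hy hxy
      by_contra hyp
      rcases (hA.1 _ _).1 hxy with h | h
      · rcases Nat.lt_or_ge i n with hin' | hin'
        · exact hyp ⟨i + 1, hin', hout _ (hpS i hi) _ (hpS _ hin') y hy (hadj i hin') h⟩
        obtain rfl : i = n := by omega
        refine hmax ⟨fun j => if j = i + 1 then y else p j, fun j hj => ?_, fun j hj k hk hjk => ?_,
          fun j hj => ?_⟩
        · dsimp only
          split_ifs with h1
          · exact hy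
          · exact hpS j (by omega)
        · dsimp only at hjk
          split_ifs at hjk with h1 h2 h2
          · omega
          · exact absurd ⟨k, by omega, hjk.symm⟩ hyp
          · exact absurd ⟨j, by omega, hjk⟩ hyp
          · exact hinj j (by omega) k (by omega) hjk
        · dsimp only
          rw [if_neg (by omega)]
          by_cases h1 : j = i
          · subst h1
            rwa [if_pos rfl]
          · rw [if_neg (by omega)]
            exact hadj j (by omega)
      · rcases Nat.eq_zero_or_pos i with rfl | hpos
        · refine hmax ⟨fun j => if j = 0 then y else p (j - 1), fun j hj => ?_,
            fun j hj k hk hjk => ?_, fun j hj => ?_⟩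
          · dsimp only
            split_ifs with h1
            · exact hy
            · exact hpS _ (by omega)
          · dsimp only at hjk
            split_ifs at hjk with h1 h2 h2
            · omega
            · exact absurd ⟨k - 1, by omega, hjk.symm⟩ hyp
            · exact absurd ⟨j - 1, by omega, hjk⟩ hyp
            · have := hinj _ (by omega) _ (by omega) hjk
              omega
          · dsimp only
            rw [if_neg (Nat.succ_ne_zero j), Nat.add_sub_cancel]
            by_cases h1 : j = 0
            · subst h1
              rwa [if_pos rfl]
            · rw [if_neg h1]
              have := hadj (j - 1) (by omega)
              rwa [Nat.sub_add_cancel (by omega)] at this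
        · have h1 := hadj (i - 1) (by omega)
          rw [Nat.sub_add_cancel hpos] at h1
          exact hyp ⟨i - 1, by omega, hin _ (hpS _ (by omega)) y hy _ (hpS i hi) h1 h⟩
  have hset := hS.2 _ hcl ⟨p 0, 0, Nat.zero_le _, rfl⟩
  refine ⟨n, p, fun x => by rw [← hset]; rfl, hinj, fun i j hij hj hTij => ?_⟩
  rcases (hA.1 _ _).1 hTij with h | h
  · have hij' : i ≠ j := fun h' => T.irrefl (h' ▸ hTij)
    have := hout _ (hpS i (by omega)) _ (hpS _ (by omega)) _ (hpS j hj) (hadj i (by omega)) h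
    exact (hinj _ (by omega) _ hj this).symm
  · exfalso
    rcases Nat.lt_or_ge j n with hjn | hjn
    · have := hinj _ (by omega) _ (by omega)
        (hout _ (hpS j hj) _ (hpS _ (by omega)) _ (hpS i (by omega)) (hadj j hjn) h)
      omega
    obtain rfl : j = n := by omega
    rcases Nat.eq_zero_or_pos i with rfl | hpos
    -- An arc from the last node back to the first is excluded by its cut: the directed path must
    -- cross the same cut, hence by the same edge in the opposite direction.
    · obtain ⟨X, hX1, hX2, hX⟩ := hT.exists_cut hTij
      have hcross : ∀ d, d ≤ j → p d ∈ X ∨ ∃ i < d, p i ∈ X ∧ p (i + 1) ∉ X := by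
        intro d
        induction d with
        | zero => exact fun _ => Or.inl hX1
        | succ d ih =>
          intro hd
          rcases ih (by omega) with h1 | ⟨i, hi, h1⟩
          · by_cases h2 : p (d + 1) ∈ X
            · exact Or.inl h2
            · exact Or.inr ⟨d, by omega, h1, h2⟩
          · exact Or.inr ⟨i, by omega, h1⟩
      obtain ⟨i, hi, h1, h2⟩ := (hcross j le_rfl).resolve_left hX2
      obtain ⟨h3, h4⟩ := hX _ h1 _ h2 ((hA.1 _ _).2 (Or.inl (hadj i hi)))
      have h5 := hadj i hi
      rw [h3, h4] at h5
      exact hA.2 _ _ h h5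
    · have h1 := hadj (i - 1) (by omega)
      rw [Nat.sub_add_cancel hpos] at h1
      have := hinj _ (by omega) _ (by omega) (hin _ (hpS _ (by omega)) _ (hpS j hj) _
        (hpS i (by omega)) h1 h)
      omega

theorem InducesDirectedPath.eq_of_adj_left {N : Type*} {A : Digraph N} {S : Set N}
    (h : InducesDirectedPath A S) {s s' t : N} (hs : s ∈ S) (hs' : s' ∈ S) (ht : t ∈ S)
    (hst : A.Adj s t) (hst' : A.Adj s' t) : s = s' := by
  obtain ⟨n, p, hinj, rfl, hp⟩ := h
  obtain ⟨i, rfl⟩ := hs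
  obtain ⟨j, rfl⟩ := hs'
  obtain ⟨k, rfl⟩ := ht
  rw [hp] at hst hst'
  exact congrArg p (Fin.ext (by omega))

theorem InducesDirectedPath.eq_of_adj_right {N : Type*} {A : Digraph N} {S : Set N}
    (h : InducesDirectedPath A S) {s t t' : N} (hs : s ∈ S) (ht : t ∈ S) (ht' : t' ∈ S)
    (hst : A.Adj s t) (hst' : A.Adj s t') : t = t' := by
  obtain ⟨n, p, hinj, rfl, hp⟩ := h
  obtain ⟨i, rfl⟩ := hs
  obtain ⟨j, rfl⟩ := ht
  obtain ⟨k, rfl⟩ := ht'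
  rw [hp] at hst hst'
  exact congrArg p (Fin.ext (by omega))

/-- After pruning, adjacent bags share at least two vertices. Two such pairs inside a bag of at most
three vertices intersect. The directed path of a common vertex allows only one in-neighbour and one
out-neighbour, so the remaining nodes form a path. -/
theorem IsTwoConnected.exists_isPathDecomposition [Fintype V] (hG : G.IsTwoConnected)
    (D : TreeDecomposition G) (hD : D.IsDirectedSpaghetti) (hw : D.width ≤ 2) :
    ∃ D : TreeDecomposition G, D.IsPathDecomposition ∧ D.width ≤ 2 := by
  classical
  have := D.fintypeNode
  have hcard := D.card_bag_le hw
  obtain ⟨A, hA, hdir⟩ := hD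
  obtain ⟨S, hD, hadh⟩ := DecomposesOn.exists_adhesion hG D.isTree.2 _ _ rfl D.decomposesOn
  have hshare : ∀ s ∈ S, ∀ s' ∈ S, ∀ t ∈ S, D.tree.Adj s t → D.tree.Adj s' t →
      ∃ v, v ∈ D.bag s ∧ v ∈ D.bag s' ∧ v ∈ D.bag t := by
    intro s hs s' hs' t ht hst hst'
    by_contra! hcon
    have hdisj : Disjoint (D.bag s ∩ D.bag t) (D.bag s' ∩ D.bag t) := by
      rw [Finset.disjoint_left]
      intro v hv hv'
      rw [Finset.mem_inter] at hv hv'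
      exact hcon v hv.1 hv'.1 hv.2
    have h1 := Finset.card_le_card (Finset.union_subset
      (Finset.inter_subset_right (s₁ := D.bag s) (s₂ := D.bag t))
      (Finset.inter_subset_right (s₁ := D.bag s') (s₂ := D.bag t)))
    rw [Finset.card_union_of_disjoint hdisj] at h1
    have h2 := hadh s hs t ht hst
    have h3 := hadh s' hs' t ht hst'
    have := hcard t
    omega
  obtain ⟨n, p, hp, hinj, hpadj⟩ := hD.connected.exists_directed_path D.isTree.2 hA
    (fun s hs s' hs' t ht hst hst' => by
      obtain ⟨v, h1, h2, h3⟩ := hshare s hs s' hs' t ht ((hA.1 _ _).2 (Or.inl hst))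
        ((hA.1 _ _).2 (Or.inl hst'))
      exact (hdir v).eq_of_adj_left h1 h2 h3 hst hst')
    (fun s hs t ht t' ht' hst hst' => by
      obtain ⟨v, h1, h2, h3⟩ := hshare t ht t' ht' s hs ((hA.1 _ _).2 (Or.inr hst))
        ((hA.1 _ _).2 (Or.inr hst'))
      exact (hdir v).eq_of_adj_right h3 h1 h2 hst hst')
  have : Nonempty V := Fintype.card_pos_iff.1 (by have := hG.1; omega)
  have hbag : ∀ i ≤ n, (D.bag (p i) : Set V) ∈
      (List.range (n + 1)).map fun i => (D.bag (p i) : Set V) := fun i hi =>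
    List.mem_map.2 ⟨i, List.mem_range.2 (by omega), rfl⟩
  refine BagList.exists_treeDecomposition (H := G)
    (L := (List.range (n + 1)).map fun i => (D.bag (p i) : Set V))
    ⟨fun _ _ => Set.subset_univ _, ?_, ?_, ?_, contiguous_map_range ?_⟩ le_rfl
  · intro X hX
    obtain ⟨i, -, rfl⟩ := List.mem_map.1 hX
    rw [Set.ncard_coe_finset]
    exact hcard _
  · intro v _
    obtain ⟨x, hx, hv⟩ := hD.vertex v
    obtain ⟨i, hi, rfl⟩ := (hp x).1 hx
    exact ⟨_, hbag i hi, hv⟩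
  · intro u _ v _ huv
    obtain ⟨x, hx, hu, hv⟩ := hD.edge u v huv
    obtain ⟨i, hi, rfl⟩ := (hp x).1 hx
    exact ⟨_, hbag i hi, hu, hv⟩
  · intro i j k v hij hjk hk hvi hvk
    by_contra hvj
    have hmem : ∀ l ≤ n, p l ∈ S := fun l hl => (hp _).2 ⟨l, hl, rfl⟩
    -- Tree edges join consecutive nodes only. If `v` were missing at `j`, its nodes before `j`
    -- would form a closed part without `p k`.
    have hcl : D.tree.ClosedIn (S ∩ {x | v ∈ D.bag x})
        {x | v ∈ D.bag x ∧ ∃ l < j, p l = x} := by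
      refine ⟨?_, ?_⟩
      · rintro x ⟨hv, l, hl, rfl⟩
        exact ⟨hmem l (by omega), hv⟩
      · rintro x ⟨hv, l, hl, rfl⟩ y ⟨hyS, hvy⟩ hxy
        obtain ⟨m, hm, rfl⟩ := (hp y).1 hyS
        refine ⟨hvy, m, ?_, rfl⟩
        by_contra! hmj
        have := hpadj l m (by omega) hm hxy
        obtain rfl : m = j := by omega
        exact hvj hvy
    have hset := (hD.bags v).2 _ hcl ⟨p i, hvi, i, hij, rfl⟩
    have hkmem : p k ∈ S ∩ {x | v ∈ D.bag x} := ⟨hmem k (by omega), hvk⟩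
    rw [← hset] at hkmem
    obtain ⟨-, l, hl, hlk⟩ := hkmem
    have := hinj l (by omega) k (by omega) hlk
    omega

end Spaghetti

/-! ### Coordinates on a path -/

/-- `f` numbers the nodes of `T` along a path. -/
structure IsPathCoord {N : Type*} (T : SimpleGraph N) (n : ℕ) (f : N → ℕ) : Prop where
  lt : ∀ x, f x < n
  inj : Function.Injective f
  surj : ∀ i < n, ∃ x, f x = i
  adj : ∀ x y, T.Adj x y ↔ f y = f x + 1 ∨ f x = f y + 1

section PathCoord

variable {V : Type u} {G : SimpleGraph V} {N : Type*} {T : SimpleGraph N} {n : ℕ} {f : N → ℕ}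
  {S : Set N} {x y z : N}

theorem TreeDecomposition.IsPathDecomposition.exists_isPathCoord {D : TreeDecomposition G}
    (h : D.IsPathDecomposition) : ∃ n f, D.tree.IsPathCoord n f := by
  obtain ⟨n, ⟨e⟩⟩ := h
  refine ⟨n, fun x => e x, fun x => (e x).2, fun x y hxy => e.injective (Fin.ext hxy),
    fun i hi => ⟨e.symm ⟨i, hi⟩, by simp⟩, fun x y => ?_⟩
  rw [← e.map_adj_iff, pathGraph_adj_iff]

theorem IsPathCoord.mem_of_connectedOn (h : T.IsPathCoord n f) (hS : T.ConnectedOn S) (hx : x ∈ S)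
    (hz : z ∈ S) (hxy : f x ≤ f y) (hyz : f y ≤ f z) : y ∈ S := by
  by_contra hy
  have hne : ∀ w ∈ S, f w ≠ f y := fun w hw hwy => hy (h.inj hwy ▸ hw)
  have hcl : T.ClosedIn S {w ∈ S | f w < f y} := by
    refine ⟨fun w hw => hw.1, fun w hw w' hw' hww' => ⟨hw', ?_⟩⟩
    have h1 := hne w' hw'
    have h2 := hw.2
    have h3 := (h.adj w w').1 hww'
    omega
  have hset := hS.2 _ hcl ⟨x, hx, lt_of_le_of_ne hxy (hne x hx)⟩
  have hz' := hz
  rw [← hset] at hz'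
  exact hz'.2.not_ge hyz

theorem IsPathCoord.exists_interval (h : T.IsPathCoord n f) (hS : T.ConnectedOn S) :
    ∃ l r, l ≤ r ∧ r < n ∧ ∀ x, x ∈ S ↔ l ≤ f x ∧ f x ≤ r := by
  have hfin : S.Finite := (Set.Finite.subset (Set.finite_Iio n) (by
    rintro _ ⟨x, -, rfl⟩
    exact h.lt x)).of_finite_image h.inj.injOn
  obtain ⟨a, ha, hmin⟩ := Set.exists_min_image S f hfin hS.1
  obtain ⟨b, hb, hmax⟩ := Set.exists_max_image S f hfin hS.1
  exact ⟨f a, f b, hmin b hb, h.lt b, fun x => ⟨fun hx => ⟨hmin x hx, hmax x hx⟩,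
    fun hx => h.mem_of_connectedOn hS ha hb hx.1 hx.2⟩⟩

theorem IsPathCoord.inducesDirectedPath (h : T.IsPathCoord n f) (hS : T.ConnectedOn S) :
    InducesDirectedPath ⟨fun x y => f y = f x + 1⟩ S := by
  obtain ⟨l, r, hlr, hr, hmem⟩ := h.exists_interval hS
  have hsurj : ∀ i : Fin (r - l + 1), ∃ x, f x = l + i := fun i => h.surj _ (by omega)
  choose p hp using hsurj
  refine ⟨r - l, p, fun i j hij => Fin.ext ?_, ?_, fun i j => ?_⟩
  · have := congrArg f hij
    rw [hp, hp] at this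
    omega
  · ext x
    rw [hmem]
    constructor
    · rintro ⟨i, rfl⟩
      rw [hp]
      omega
    · intro hx
      exact ⟨⟨f x - l, by omega⟩, h.inj (by rw [hp]; dsimp only; omega)⟩
  · change f (p j) = f (p i) + 1 ↔ _
    rw [hp, hp]
    omega

theorem IsPathCoord.le_add_length (h : T.IsPathCoord n f) (p : T.Walk x y) :
    f y ≤ f x + p.length := by
  induction p with
  | nil => simp
  | cons hadj p ih =>
    rw [Walk.length_cons]
    have := (h.adj _ _).1 hadj
    omega

theorem IsPathCoord.dist_eq (h : T.IsPathCoord n f) (hT : T.Connected) (hxy : f x ≤ f y) :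
    T.dist x y = f y - f x := by
  refine le_antisymm ?_ ?_
  · have key : ∀ d, ∀ x, f y = f x + d → T.dist x y ≤ d := by
      intro d
      induction d with
      | zero =>
        intro x hx
        rw [h.inj hx, dist_self]
      | succ d ih =>
        intro x hx
        obtain ⟨z, hz⟩ := h.surj (f x + 1) (by have := h.lt y; omega)
        have h1 := ih z (by omega)
        have h2 := hT.dist_triangle (u := x) (v := z) (w := y)
        rw [dist_eq_one_iff_adj.2 ((h.adj x z).2 (Or.inl hz))] at h2
        omega
    exact key _ x (by omega)
  · obtain ⟨p, hp⟩ := hT.exists_walk_length_eq_dist x y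
    have := h.le_add_length p
    omega

/-- All arcs point to the last node of the path, which is the root. -/
theorem TreeDecomposition.IsPathDecomposition.isSpecial {D : TreeDecomposition G}
    (h : D.IsPathDecomposition) : D.IsSpecial := by
  obtain ⟨n, f, hf⟩ := h.exists_isPathCoord
  obtain ⟨x₀⟩ := D.isTree.1.nonempty
  obtain ⟨r, hr⟩ := hf.surj (n - 1) (by have := hf.lt x₀; omega)
  refine ⟨⟨fun x y => f y = f x + 1⟩, r, ⟨fun x y => hf.adj x y, fun x y hxy hyx => ?_⟩,
    fun x y hxy => ?_, fun v => hf.inducesDirectedPath (connectedOn_iff.1 (D.connected_bags v))⟩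
  · have h1 : f y = f x + 1 := hxy
    have h2 : f x = f y + 1 := hyx
    omega
  · have h1 : f y = f x + 1 := hxy
    have h2 := hf.lt y
    rw [hf.dist_eq D.isTree.1 (by omega), hf.dist_eq D.isTree.1 (by omega)]
    omega

theorem TreeDecomposition.IsSpecial.isDirectedSpaghetti {D : TreeDecomposition G}
    (h : D.IsSpecial) : D.IsDirectedSpaghetti := by
  obtain ⟨A, -, hA, -, h⟩ := h
  exact ⟨A, hA, h⟩

end PathCoord

/-! ### Minors of graphs of pathwidth two -/

section Minor

variable {V W : Type*} {G : SimpleGraph V} {H : SimpleGraph W}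

theorem ConnectedOn.biUnion_of_inter {N : Type*} {T : SimpleGraph N} {B : Set V}
    (hB : G.ConnectedOn B) {F : V → Set N} (hF : ∀ v ∈ B, T.ConnectedOn (F v))
    (hadj : ∀ u ∈ B, ∀ v ∈ B, G.Adj u v → (F u ∩ F v).Nonempty) :
    T.ConnectedOn (⋃ v ∈ B, F v) := by
  obtain ⟨v₀, hv₀⟩ := hB.1
  have hsub : ∀ v ∈ B, F v ⊆ ⋃ v ∈ B, F v := fun v hv => Set.subset_biUnion_of_mem hv
  refine ⟨(hF v₀ hv₀).1.mono (hsub v₀ hv₀), fun X hX ⟨x, hx⟩ => hX.1.antisymm ?_⟩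
  have key : ∀ v ∈ B, (F v ∩ X).Nonempty → F v ⊆ X := fun v hv =>
    (hF v hv).subset_of_closedIn hX (hsub v hv)
  obtain ⟨v, hv, hxv⟩ := Set.mem_iUnion₂.1 (hX.1 hx)
  have hset := hB.2 {v ∈ B | F v ⊆ X} ⟨fun v hv => hv.1, fun u hu v hv huv => ⟨hv, by
    obtain ⟨y, hyu, hyv⟩ := hadj u hu.1 v hv huv
    exact key v hv ⟨y, hyv, hu.2 hyu⟩⟩⟩ ⟨v, hv, key v hv ⟨x, hxv, hx⟩⟩
  refine Set.iUnion₂_subset fun v hv => ?_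
  rw [← hset] at hv
  exact hv.2

/-- The intervals `[l a, r a]` meet for adjacent `a`, and no four of them have a common point. -/
structure IntervalModel (H : SimpleGraph W) (l r : W → ℕ) : Prop where
  le : ∀ a, l a ≤ r a
  adj : ∀ a b, H.Adj a b → l a ≤ r b ∧ l b ≤ r a
  not_four : ∀ a b c d, a ≠ b → a ≠ c → a ≠ d → b ≠ c → b ≠ d → c ≠ d → ∀ i,
    l a ≤ i → i ≤ r a → l b ≤ i → i ≤ r b → l c ≤ i → i ≤ r c → l d ≤ i → i ≤ r d → False

/-- The nodes whose bags meet a branch set form a connected set, an interval of the path. Four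
intervals through one node would put four distinct vertices into one bag, as branch sets are
disjoint. -/
theorem IsMinorOf.exists_intervalModel {V : Type u} {G : SimpleGraph V} (h : H.IsMinorOf G)
    {D : TreeDecomposition G} (hD : D.IsPathDecomposition) (hw : D.width ≤ 2) :
    ∃ l r, H.IntervalModel l r := by
  classical
  rw [isMinorOf_iff] at h
  obtain ⟨B, hB, hdisj, hadj⟩ := h
  obtain ⟨n, f, hf⟩ := hD.exists_isPathCoord
  have hconn : ∀ a, D.tree.ConnectedOn (⋃ v ∈ B a, D.nodesOf v) := fun a =>
    (hB a).biUnion_of_inter (fun v _ => connectedOn_iff.1 (D.connected_bags v))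
      fun u _ v _ huv => D.exists_edge_bag u v huv
  choose l r hlr hr hmem using fun a => hf.exists_interval (hconn a)
  have hmem' : ∀ a x, l a ≤ f x → f x ≤ r a → ∃ v ∈ B a, v ∈ D.bag x := by
    intro a x h1 h2
    obtain ⟨v, hv, hx⟩ := Set.mem_iUnion₂.1 ((hmem a x).2 ⟨h1, h2⟩)
    exact ⟨v, hv, hx⟩
  have hmem'' : ∀ a x, ∀ v ∈ B a, v ∈ D.bag x → l a ≤ f x ∧ f x ≤ r a := fun a x v hv hx =>
    (hmem a x).1 (Set.mem_iUnion₂.2 ⟨v, hv, hx⟩)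
  refine ⟨l, r, hlr, fun a b hab => ?_, ?_⟩
  · obtain ⟨u, hu, v, hv, huv⟩ := hadj a b hab
    obtain ⟨x, hux, hvx⟩ := D.exists_edge_bag u v huv
    have h1 := hmem'' a x u hu hux
    have h2 := hmem'' b x v hv hvx
    omega
  · intro a b c d hab hac had hbc hbd hcd i h1 h2 h3 h4 h5 h6 h7 h8
    obtain ⟨x, rfl⟩ := hf.surj i (lt_of_le_of_lt h2 (hr a))
    obtain ⟨va, hva, hax⟩ := hmem' a x h1 h2
    obtain ⟨vb, hvb, hbx⟩ := hmem' b x h3 h4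
    obtain ⟨vc, hvc, hcx⟩ := hmem' c x h5 h6
    obtain ⟨vd, hvd, hdx⟩ := hmem' d x h7 h8
    have hne : ∀ {a b va vb}, a ≠ b → va ∈ B a → vb ∈ B b → va ≠ vb := fun hab ha hb h =>
      Set.disjoint_left.1 (hdisj _ _ hab) ha (h ▸ hb)
    have hsub : ({va, vb, vc, vd} : Finset V) ⊆ D.bag x := by
      intro w hw
      simp only [Finset.mem_insert, Finset.mem_singleton] at hw
      rcases hw with rfl | rfl | rfl | rfl <;> assumption
    have h9 := Finset.card_le_card hsub
    rw [Finset.card_insert_of_notMem, Finset.card_insert_of_notMem, Finset.card_pair] at h9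
    · have := D.card_bag_le hw x
      omega
    · exact hne hcd hvc hvd
    · simp [hne hbc hvb hvc, hne hbd hvb hvd]
    · simp [hne hab hva hvb, hne hac hva hvc, hne had hva hvd]

/-- Pairwise intersecting intervals all contain the largest left end. -/
theorem not_intervalModel_completeGraph_four {l r : Fin 4 → ℕ} :
    ¬ (completeGraph (Fin 4)).IntervalModel l r := by
  intro h
  obtain ⟨j, hj⟩ : ∃ j, ∀ a, l a ≤ l j := Finite.exists_max l
  have hr : ∀ a, l j ≤ r a := by
    intro a
    by_cases haj : a = j
    · exact haj ▸ h.le a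
    · exact (h.adj a j haj).2
  exact h.not_four 0 1 2 3 (by decide) (by decide) (by decide) (by decide) (by decide) (by decide)
    (l j) (hj 0) (hr 0) (hj 1) (hr 1) (hj 2) (hr 2) (hj 3) (hr 3)

/-- The triangle `1`, `3`, `5` has a common interval `[a, b]`, which each ear must avoid. Two of the
three ears lie on the same side of it, say to the left. Together they are adjacent to all of `1`,
`3`, `5`, in particular to the one whose left end is `a`, which is impossible. -/
theorem not_intervalModel_graphS3 {l r : Fin 6 → ℕ} : ¬ graphS3.IntervalModel l r := by
  intro h
  have h01 := h.adj 0 1 (by simp [graphS3])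
  have h12 := h.adj 1 2 (by simp [graphS3])
  have h23 := h.adj 2 3 (by simp [graphS3])
  have h34 := h.adj 3 4 (by simp [graphS3])
  have h45 := h.adj 4 5 (by simp [graphS3])
  have h50 := h.adj 5 0 (by simp [graphS3])
  have h13 := h.adj 1 3 (by simp [graphS3])
  have h35 := h.adj 3 5 (by simp [graphS3])
  have h51 := h.adj 5 1 (by simp [graphS3])
  have hle := h.le
  obtain ⟨a, ha1, ha3, ha5, ha⟩ : ∃ a, l 1 ≤ a ∧ l 3 ≤ a ∧ l 5 ≤ a ∧
      (a = l 1 ∨ a = l 3 ∨ a = l 5) := ⟨max (l 1) (max (l 3) (l 5)), by omega⟩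
  obtain ⟨b, hb1, hb3, hb5, hb⟩ : ∃ b, b ≤ r 1 ∧ b ≤ r 3 ∧ b ≤ r 5 ∧
      (b = r 1 ∨ b = r 3 ∨ b = r 5) := ⟨min (r 1) (min (r 3) (r 5)), by omega⟩
  have hab : a ≤ b := by
    have := hle 1
    have := hle 3
    have := hle 5
    omega
  have key : ∀ e, 1 ≠ e → 3 ≠ e → 5 ≠ e → r e < a ∨ b < l e := by
    intro e h1 h3 h5
    by_contra! hcon
    have := hle e
    exact h.not_four 1 3 5 e (by decide) (by decide) h1 (by decide) h3 h5 (max a (l e))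
      (by omega) (by omega) (by omega) (by omega) (by omega) (by omega) (by omega) (by omega)
  have k0 := key 0 (by decide) (by decide) (by decide)
  have k2 := key 2 (by decide) (by decide) (by decide)
  have k4 := key 4 (by decide) (by decide) (by decide)
  omega

/-- The two inner vertices of a path together cover an interval that meets the intervals of both `0`
and `1`. The argument depends on whether the intervals of `0` and `1` meet. -/
theorem not_intervalModel_graphD3 {l r : Fin 8 → ℕ} : ¬ graphD3.IntervalModel l r := by
  intro h
  have hle := h.le
  have h0 := hle 0
  have h1 := hle 1
  let P : Fin 8 → Fin 8 → Prop := fun x x' => l x ≤ r x ∧ l x' ≤ r x' ∧ (l x ≤ r 0 ∧ l 0 ≤ r x) ∧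
    (l x' ≤ r 1 ∧ l 1 ≤ r x') ∧ (l x ≤ r x' ∧ l x' ≤ r x)
  have h2 : P 2 3 := ⟨hle _, hle _, h.adj _ _ (by simp [graphD3]), h.adj _ _ (by simp [graphD3]),
    h.adj _ _ (by simp [graphD3])⟩
  have h4 : P 4 5 := ⟨hle _, hle _, h.adj _ _ (by simp [graphD3]), h.adj _ _ (by simp [graphD3]),
    h.adj _ _ (by simp [graphD3])⟩
  have h6 : P 6 7 := ⟨hle _, hle _, h.adj _ _ (by simp [graphD3]), h.adj _ _ (by simp [graphD3]),
    h.adj _ _ (by simp [graphD3])⟩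
  have hcover : ∀ x x' i, P x x' → min (l x) (l x') ≤ i → i ≤ max (r x) (r x') →
      ∃ y, (y = x ∨ y = x') ∧ l y ≤ i ∧ i ≤ r y := by
    intro x x' i hP h5 h7
    obtain ⟨p1, p2, p3, p4, p5⟩ := hP
    by_cases hx : l x ≤ i ∧ i ≤ r x
    · exact ⟨x, Or.inl rfl, hx⟩
    · exact ⟨x', Or.inr rfl, by omega⟩
  -- If they meet, two overlapping path intervals would have a point in common with both `0` and
  -- `1`, by the Helly property. So the three are disjoint, and the middle one lies within both `0`
  -- and `1`; its two adjacent vertices share a point there, which makes four.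
  by_cases hd : l 0 ≤ r 1 ∧ l 1 ≤ r 0
  · have hdisj : ∀ x x' y y', P x x' → P y y' → (∀ z w, (z = x ∨ z = x') → (w = y ∨ w = y') →
        z ≠ 0 ∧ z ≠ 1 ∧ w ≠ 0 ∧ w ≠ 1 ∧ z ≠ w) →
        max (r x) (r x') < min (l y) (l y') ∨ max (r y) (r y') < min (l x) (l x') := by
      intro x x' y y' hx hy hne
      by_contra! hcon
      obtain ⟨i, hi0, hi0', hi1, hi1', hix, hix', hiy, hiy'⟩ : ∃ i, l 0 ≤ i ∧ i ≤ r 0 ∧ l 1 ≤ i ∧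
          i ≤ r 1 ∧ min (l x) (l x') ≤ i ∧ i ≤ max (r x) (r x') ∧ min (l y) (l y') ≤ i ∧
          i ≤ max (r y) (r y') := by
        obtain ⟨p1, p2, p3, p4, p5⟩ := hx
        obtain ⟨q1, q2, q3, q4, q5⟩ := hy
        exact ⟨max (max (l 0) (l 1)) (max (min (l x) (l x')) (min (l y) (l y'))), by omega⟩
      obtain ⟨z, hz, hz1, hz2⟩ := hcover x x' i hx hix hix'
      obtain ⟨w, hw, hw1, hw2⟩ := hcover y y' i hy hiy hiy'
      obtain ⟨n1, n2, n3, n4, n5⟩ := hne z w hz hw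
      exact h.not_four 0 1 z w (by decide) n1.symm n3.symm n2.symm n4.symm n5 i hi0 hi0' hi1 hi1'
        hz1 hz2 hw1 hw2
    have hmid : ∀ x x' y y' z z', P x x' → P y y' → P z z' → y ≠ 0 → y ≠ 1 → y' ≠ 0 → y' ≠ 1 →
        y ≠ y' → max (r x) (r x') < min (l y) (l y') → max (r y) (r y') < min (l z) (l z') →
        False := by
      intro x x' y y' z z' hx hy hz n1 n2 n3 n4 n5 hxy hyz
      obtain ⟨p1, p2, p3, p4, p5⟩ := hx
      obtain ⟨q1, q2, q3, q4, q5⟩ := hy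
      obtain ⟨s1, s2, s3, s4, s5⟩ := hz
      exact h.not_four 0 1 y y' (by decide) n1.symm n3.symm n2.symm n4.symm n5 (max (l y) (l y'))
        (by omega) (by omega) (by omega) (by omega) (by omega) (by omega) (by omega) (by omega)
    have d1 := hdisj 2 3 4 5 h2 h4 (by decide)
    have d2 := hdisj 2 3 6 7 h2 h6 (by decide)
    have d3 := hdisj 4 5 6 7 h4 h6 (by decide)
    have m1 := hmid 2 3 4 5 6 7 h2 h4 h6 (by decide) (by decide) (by decide) (by decide) (by decide)
    have m2 := hmid 6 7 4 5 2 3 h6 h4 h2 (by decide) (by decide) (by decide) (by decide) (by decide)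
    have m3 := hmid 4 5 2 3 6 7 h4 h2 h6 (by decide) (by decide) (by decide) (by decide) (by decide)
    have m4 := hmid 6 7 2 3 4 5 h6 h2 h4 (by decide) (by decide) (by decide) (by decide) (by decide)
    have m5 := hmid 2 3 6 7 4 5 h2 h6 h4 (by decide) (by decide) (by decide) (by decide) (by decide)
    have m6 := hmid 4 5 6 7 2 3 h4 h6 h2 (by decide) (by decide) (by decide) (by decide) (by decide)
    rcases d1 with d1 | d1 <;> rcases d2 with d2 | d2 <;> rcases d3 with d3 | d3
    · exact m1 d1 d3
    · exact m5 d2 d3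
    · exact m4 d2 d1
    · exact m4 d2 d1
    · exact m3 d1 d2
    · exact m3 d1 d2
    · exact m6 d3 d2
    · exact m2 d3 d1
  -- If they are disjoint, every path interval bridges the gap and contains the right end of the
  -- left one, so four intervals meet there.
  · have hpt : ∃ i, (l 0 ≤ i ∧ i ≤ r 0 ∨ l 1 ≤ i ∧ i ≤ r 1) ∧ ∀ x x', P x x' →
        min (l x) (l x') ≤ i ∧ i ≤ max (r x) (r x') := by
      refine ⟨min (r 0) (r 1), by omega, fun x x' hx => ?_⟩
      obtain ⟨p1, p2, p3, p4, p5⟩ := hx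
      omega
    obtain ⟨i, hi, hall⟩ := hpt
    obtain ⟨y2, hy2, a2, b2⟩ := hcover 2 3 i h2 (hall _ _ h2).1 (hall _ _ h2).2
    obtain ⟨y4, hy4, a4, b4⟩ := hcover 4 5 i h4 (hall _ _ h4).1 (hall _ _ h4).2
    obtain ⟨y6, hy6, a6, b6⟩ := hcover 6 7 i h6 (hall _ _ h6).1 (hall _ _ h6).2
    have hne : ∀ y2 y4 y6 : Fin 8, (y2 = 2 ∨ y2 = 3) → (y4 = 4 ∨ y4 = 5) → (y6 = 6 ∨ y6 = 7) →
        0 ≠ y2 ∧ 0 ≠ y4 ∧ 0 ≠ y6 ∧ 1 ≠ y2 ∧ 1 ≠ y4 ∧ 1 ≠ y6 ∧ y2 ≠ y4 ∧ y2 ≠ y6 ∧ y4 ≠ y6 := by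
      decide
    obtain ⟨n1, n2, n3, n4, n5, n6, n7, n8, n9⟩ := hne y2 y4 y6 hy2 hy4 hy6
    rcases hi with hi | hi
    · exact h.not_four 0 y2 y4 y6 n1 n2 n3 n7 n8 n9 i hi.1 hi.2 a2 b2 a4 b4 a6 b6
    · exact h.not_four 1 y2 y4 y6 n4 n5 n6 n7 n8 n9 i hi.1 hi.2 a2 b2 a4 b4 a6 b6

end Minor

/-! ### Width parameters equal to two -/

/-- The infimum of the empty set is `0`, so the value two is attained by a decomposition;
conversely, no decomposition of a 2-connected graph has width below two. -/
theorem sInf_eq_two_iff {V : Type u} [Fintype V] {G : SimpleGraph V} (hG : G.IsTwoConnected)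
    {P : TreeDecomposition G → Prop} :
    sInf {k | ∃ D : TreeDecomposition G, P D ∧ D.width = k} = 2 ↔
      ∃ D : TreeDecomposition G, P D ∧ D.width ≤ 2 := by
  constructor
  · intro h
    have hne : {k | ∃ D : TreeDecomposition G, P D ∧ D.width = k}.Nonempty := by
      by_contra hcon
      rw [Set.not_nonempty_iff_eq_empty] at hcon
      rw [hcon, Nat.sInf_empty] at h
      omega
    obtain ⟨D, hD, hw⟩ := Nat.sInf_mem hne
    exact ⟨D, hD, (hw.trans h).le⟩
  · rintro ⟨D, hD, hw⟩
    have hw2 := le_antisymm hw (hG.two_le_width D)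
    refine le_antisymm (Nat.sInf_le ⟨D, hD, hw2⟩) (le_csInf ⟨2, D, hD, hw2⟩ ?_)
    rintro k ⟨D', -, rfl⟩
    exact hG.two_le_width D'

theorem IsTwoConnected.isMamba_iff {V : Type u} [Fintype V] {G : SimpleGraph V}
    (hG : G.IsTwoConnected) : G.IsMamba ↔ G.pathwidth = 2 := by
  constructor
  · have h3 := hG.1
    rintro (h | ⟨⟨e⟩⟩ | ⟨⟨e⟩⟩)
    · exact h.2
    · have := Fintype.card_congr e.toEquiv
      simp at this
      omega
    · have := Fintype.card_congr e.toEquiv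
      simp at this
      omega
  · exact fun h => Or.inl ⟨hG, h⟩

end SimpleGraph

theorem mainTheorem6 {V : Type*} [Fintype V] (G : SimpleGraph V) (hG : G.IsTwoConnected) :
    List.TFAE [
      G.pathwidth = 2,
      G.IsMamba,
      G.specialTreewidth = 2,
      G.directedSpaghettiTreewidth = 2,
      ¬ (SimpleGraph.completeGraph (Fin 4)).IsMinorOf G ∧
        ¬ SimpleGraph.graphD3.IsMinorOf G ∧ ¬ SimpleGraph.graphS3.IsMinorOf G,
      G.cellCompletion.IsPathOfCycles] := by
  have : Nonempty V := Fintype.card_pos_iff.1 (by have := hG.1; omega)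
  have hpw : G.pathwidth = 2 ↔ _ := SimpleGraph.sInf_eq_two_iff hG
  have hst : G.specialTreewidth = 2 ↔ _ := SimpleGraph.sInf_eq_two_iff hG
  have hds : G.directedSpaghettiTreewidth = 2 ↔ _ := SimpleGraph.sInf_eq_two_iff hG
  tfae_have 1 ↔ 2 := hG.isMamba_iff.symm
  tfae_have 1 → 3 := fun h => by
    obtain ⟨D, hD, hw⟩ := hpw.1 h
    exact hst.2 ⟨D, hD.isSpecial, hw⟩
  tfae_have 3 → 4 := fun h => by
    obtain ⟨D, hD, hw⟩ := hst.1 h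
    exact hds.2 ⟨D, hD.isDirectedSpaghetti, hw⟩
  tfae_have 4 → 1 := fun h => by
    obtain ⟨D, hD, hw⟩ := hds.1 h
    exact hpw.2 (hG.exists_isPathDecomposition D hD hw)
  tfae_have 1 → 5 := fun h => by
    obtain ⟨D, hD, hw⟩ := hpw.1 h
    refine ⟨fun hm => ?_, fun hm => ?_, fun hm => ?_⟩ <;>
      obtain ⟨l, r, hlr⟩ := hm.exists_intervalModel hD hw
    · exact SimpleGraph.not_intervalModel_completeGraph_four hlr
    · exact SimpleGraph.not_intervalModel_graphD3 hlr
    · exact SimpleGraph.not_intervalModel_graphS3 hlr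
  tfae_have 5 → 6 := fun ⟨hK, hD, hS⟩ => hG.isPathOfCycles_cellCompletion hK hD hS
  tfae_have 6 → 1 := fun h => by
    obtain ⟨L, hL⟩ := h.exists_bagList
    exact hpw.2 (hL.exists_treeDecomposition SimpleGraph.le_cellCompletion)
  tfae_finish
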